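/- For $k\ge 1$, let $P_k$ be the path with $k$ vertices. Let $S_k$ be the graph obtained from the claw $K_{1,3}$ by replacing each edge with a path of length $k$ (that is, with $k$ edges), and let $T_k$ be the graph obtained from the complete graph $K_3$ by appending a path of length $k$ to each of its vertices. Let $\mathcal{M}$ be the class of graphs that consist of a path $P$ and one further vertex $a$, the center, such that $a$ is nonadjacent to the endpoints of $P$ and has at least two neighbors in $P$; the extremities of such a graph are its vertices of degree one (the two endpoints of $P$) and its center $a$. Let $\mathcal{M}_k$ be the family of graphs obtained from a graph in $\mathcal{M}$ by replacing each of its three extremities by an extremity of a $P_k$ (that is, by attaching to it a pendant path with $k-1$ new vertices). The eccentricity of a path in a connected graph is the maximum distance from a vertex of the graph to the path. Theorem. There is an algorithm that, given any connected graph $G$ with $n$ vertices and $m$ edges (by adjacency lists) and any integer $k\ge 1$, finds one of the following: - a path in $G$ with eccentricity less than $k$, or - an induced subgraph of $G$ that is isomorphic to $S_k$, to $T_k$, or to a graph in $\mathcal{M}_k$, and tells which of the two it has found. Its running time on a random access machine is $\mathcal{O}(n^2(n+m))$, where the constant does not depend on $G$ or $k$; here $k$ is part of the input and is stored in one register. The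 algorithm is robust: nothing is assumed about $G$ other than that it is connected. -/

import Mathlib

namespace PathEcc

/-! ### Paths and their eccentricity -/

/-- The distance from a vertex `w` to (the vertex set of) the walk `p`. -/
noncomputable def distTo {V : Type*} [DecidableEq V] {G : SimpleGraph V} {u v : V}
    (p : G.Walk u v) (w : V) : ℕ :=
  p.support.toFinset.inf' ⟨u, by simp⟩ (fun x => G.dist w x)

/-- The eccentricity of `p`: the maximum distance from a vertex of `G` to `p`. -/
noncomputable def eccentricity {V : Type*} [Fintype V] [DecidableEq V] {G : SimpleGraph V} {u v : V}
    (p : G.Walk u v) : ℕ :=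
  Finset.univ.sup (fun w => distTo p w)

/-! ### The graphs `S_k` and `T_k` and the family `M_k` -/

/-- The `k`-subdivided claw: a center `none` and three legs with `k` vertices each; the vertex
`some (i, j)` is at distance `j + 1` from the center along the `i`-th leg. -/
def subdividedClaw (k : ℕ) : SimpleGraph (Option (Fin 3 × Fin k)) :=
  SimpleGraph.fromRel fun x y =>
    match x, y with
    | none, some (_, j) => (j : ℕ) = 0
    | some (i, j), some (i', j') => i = i' ∧ (j : ℕ) + 1 = j'
    | _, _ => False

/-- The `k`-subdivided net: a triangle on the vertices `(i, 0)`, with a path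
`(i, 0), (i, 1), …, (i, k)` of length `k` appended to each of its vertices. -/
def subdividedNet (k : ℕ) : SimpleGraph (Fin 3 × Fin (k + 1)) :=
  SimpleGraph.fromRel fun x y =>
    ((x.2 : ℕ) = 0 ∧ (y.2 : ℕ) = 0) ∨ (x.1 = y.1 ∧ (x.2 : ℕ) + 1 = y.2)

/-- The graph that consists of the path `some 0, some 1, …, some (p - 1)` and of one more vertex
`none` (the center) whose set of neighbors is `A`. -/
def pathWithCenter (p : ℕ) (A : Finset (Fin p)) : SimpleGraph (Option (Fin p)) :=
  SimpleGraph.fromRel fun x y =>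
    match x, y with
    | none, some j => j ∈ A
    | some i, some j => (i : ℕ) + 1 = j
    | _, _ => False

/-- `pathWithCenter p A` belongs to the class `M`: the center is nonadjacent to the endpoints of
the path and has at least two neighbors on the path. -/
def IsM (p : ℕ) (A : Finset (Fin p)) : Prop :=
  2 ≤ A.card ∧ ∀ i ∈ A, (i : ℕ) ≠ 0 ∧ (i : ℕ) + 1 ≠ p

/-- The extremities of a graph in `M`: its center and its vertices of degree one. -/
def extremities (p : ℕ) (A : Finset (Fin p)) : Set (Option (Fin p)) :=
  {x | x = none ∨ ((pathWithCenter p A).neighborSet x).ncard = 1}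

/-- The graph obtained from `H` by replacing each vertex `v ∈ E` by an extremity of a path
`(v, 0), (v, 1), …, (v, k - 1)` with `k` vertices (for `k ≥ 1`); the vertices `(v, 0)` form a copy
of `H`. -/
def attachPaths {V : Type*} (H : SimpleGraph V) (E : Set V) (k : ℕ) :
    SimpleGraph {x : V × ℕ // x.2 = 0 ∨ (x.1 ∈ E ∧ x.2 < k)} :=
  SimpleGraph.fromRel fun x y =>
    (x.1.2 = 0 ∧ y.1.2 = 0 ∧ H.Adj x.1.1 y.1.1) ∨ (x.1.1 = y.1.1 ∧ x.1.2 + 1 = y.1.2)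

/-- `H` is (isomorphic to) a member of the family `M_k`. -/
def IsMk (k : ℕ) {V : Type*} (H : SimpleGraph V) : Prop :=
  ∃ (p : ℕ) (A : Finset (Fin p)), IsM p A ∧
    Nonempty (H ≃g attachPaths (pathWithCenter p A) (extremities p A) k)

/-! ### The machine model

A random access machine, programmed in a structured language: a memory of scalar registers
`var 0, var 1, …` and arrays `arr 0, arr 1, …`, all holding natural numbers. A program is a fixed
finite text, so it names only finitely many registers and arrays. Every constant, register access,
array access, increment, decrement, comparison, connective, assignment costs one step. The only
arithmetic is increment and decrement, so a run of `t` steps only produces numbers that exceed the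
numbers in the input and in the program text by at most `t`: nothing can be gained by packing
information into large numbers. -/

/-- The memory. -/
structure State where
  var : ℕ → ℕ
  arr : ℕ → ℕ → ℕ

/-- Expressions. -/
inductive Expr where
  | const (c : ℕ)
  | var (x : ℕ)
  | read (a : ℕ) (i : Expr)
  | succ (e : Expr)
  | pred (e : Expr)

/-- The value of an expression; `pred` of `0` is `0`. -/
def Expr.eval (s : State) : Expr → ℕ
  | .const c => c
  | .var x => s.var x
  | .read a i => s.arr a (i.eval s)
  | .succ e => e.eval s + 1
  | .pred e => e.eval s - 1

/-- The number of steps to evaluate an expression. -/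
def Expr.cost : Expr → ℕ
  | .const _ => 1
  | .var _ => 1
  | .read _ i => i.cost + 1
  | .succ e => e.cost + 1
  | .pred e => e.cost + 1

/-- Tests. -/
inductive Test where
  | lt (e f : Expr)
  | eq (e f : Expr)
  | not (b : Test)
  | and (b c : Test)

/-- The truth of a test. -/
def Test.holds (s : State) : Test → Prop
  | .lt e f => e.eval s < f.eval s
  | .eq e f => e.eval s = f.eval s
  | .not b => ¬ b.holds s
  | .and b c => b.holds s ∧ c.holds s

/-- The number of steps to evaluate a test. -/
def Test.cost : Test → ℕ
  | .lt e f => e.cost + f.cost + 1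
  | .eq e f => e.cost + f.cost + 1
  | .not b => b.cost + 1
  | .and b c => b.cost + c.cost + 1

/-- Programs. -/
inductive Program where
  | skip
  | assign (x : ℕ) (e : Expr)
  | write (a : ℕ) (i e : Expr)
  | seq (P Q : Program)
  | branch (b : Test) (P Q : Program)
  | loop (b : Test) (P : Program)

/-- `Exec P s t s'`: started in the memory `s`, the program `P` halts after exactly `t` steps, and
the memory is then `s'`. -/
inductive Exec : Program → State → ℕ → State → Prop where
  | skip (s : State) : Exec .skip s 1 s
  | assign (s : State) (x : ℕ) (e : Expr) :
      Exec (.assign x e) s (e.cost + 1) { s with var := Function.update s.var x (e.eval s) }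
  | write (s : State) (a : ℕ) (i e : Expr) :
      Exec (.write a i e) s (i.cost + e.cost + 1)
        { s with arr := Function.update s.arr a
                    (Function.update (s.arr a) (i.eval s) (e.eval s)) }
  | seq {P Q : Program} {s s' s'' : State} {t t' : ℕ} :
      Exec P s t s' → Exec Q s' t' s'' → Exec (.seq P Q) s (t + t') s''
  | branch_true {b : Test} {P Q : Program} {s s' : State} {t : ℕ} :
      b.holds s → Exec P s t s' → Exec (.branch b P Q) s (b.cost + t) s'
  | branch_false {b : Test} {P Q : Program} {s s' : State} {t : ℕ} :
      ¬ b.holds s → Exec Q s t s' → Exec (.branch b P Q) s (b.cost + t) s'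
  | loop_true {b : Test} {P : Program} {s s' s'' : State} {t t' : ℕ} :
      b.holds s → Exec P s t s' → Exec (.loop b P) s' t' s'' →
        Exec (.loop b P) s (b.cost + t + t') s''
  | loop_false {b : Test} {P : Program} {s : State} :
      ¬ b.holds s → Exec (.loop b P) s b.cost s

/-! ### Input and output -/

/-- `L` is a representation of `G` by adjacency lists (the neighbors come in any order). -/
def IsAdjLists {n : ℕ} (G : SimpleGraph (Fin n)) (L : Fin n → List (Fin n)) : Prop :=
  ∀ v, (L v).Nodup ∧ ∀ w, w ∈ L v ↔ G.Adj v w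

/-- The memory in which a run is started. Register `0` holds the number `n` of vertices and
register `1` holds `k`. Array `1` holds the concatenation of the adjacency lists of the vertices
`0, …, n - 1`; for `i ≤ n`, cell `i` of array `0` holds the total length of the first `i` of these
lists, which is where the list of vertex `i` begins. All the rest is `0`. -/
def inputState {n : ℕ} (L : Fin n → List (Fin n)) (k : ℕ) : State where
  var x := if x = 0 then n else if x = 1 then k else 0
  arr a i :=
    if a = 0 then (if i ≤ n then (((List.ofFn L).take i).map List.length).sum else 0)
    else if a = 1 then ((List.ofFn L).flatten.map Fin.val).getD i 0
    else 0

/-- The output in the final memory `s` is the number `flag` (register `2`) and the list `l` of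
vertices (its length is in register `3`, its entries are in array `2`). -/
def Outputs {n : ℕ} (s : State) (flag : ℕ) (l : List (Fin n)) : Prop :=
  s.var 2 = flag ∧ s.var 3 = l.length ∧ ∀ (i : ℕ) (h : i < l.length), s.arr 2 i = (l[i] : ℕ)

end PathEcc

namespace PathEcc

/-! ### Reasoning about programs -/

/-! Call a vertex far from a set if its distance to every vertex of the set is at least k. The
algorithm extends a path Q with current end a and maintains a connected set C of unvisited vertices
such that (`Inv`): every vertex far from Q lies in C; a has a neighbor in C; a neighbor of C outside
C is on Q or adjacent to Q; and some induced path with k vertices, the leg, starts at a, avoids C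
and has no vertex but a adjacent to C. Once nothing is far from Q, the path Q is the answer.

Start (`inv_init`). Unless a single vertex already suffices, grow a connected set R that leaves some
vertex far, until adding any neighbor of R would leave none. If x is far from R and a is a neighbor
of R, then a must be at distance exactly k - 1 from x. A shortest path from x to a is both the first
Q and, read from a, the first leg; C is what can be reached from R without meeting a or the closed
neighborhoods of the other vertices of that path.

One round. Let N be the set of neighbors of a in C, and call a vertex of C deep if its distance in C
from N is at least k. Let w₀ be deep, or any vertex of N if none is deep.

If another deep vertex y is separated from w₀ in C by N, then a shortest path in C between the two
meets N, and its vertices in N are at least k steps away from both of its ends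
(`obstruction_of_deep`). The part from k steps before the first to k steps after the last of them,
together with the leg, is an induced S_k if there is one such vertex and a member of M_k otherwise
(`IsTripod.claw`, `IsTripod.isMk`). The graph T_k is thus never produced: two consecutive attachment
vertices already give a member of M_k.

Otherwise let v be a vertex of N farthest from w₀ in C, and let C' be the component of w₀ in C - v.
A vertex lost with C - C' is separated from w₀ by v, so it is farther from w₀ than v, hence not in
N. A shortest way from it to N passes through v, and it is not deep, so it is within k - 1 of v
(`Round.dist_lt`). There are three ways on. If some y at distance k - 1 from v is far from C', move
to v, with a shortest path from v to y as leg (`Round.inv_newLeg`). If there is no such y and a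
still has neighbors in C', stay at a and drop v: a lost vertex far from Q would be such a y
(`Round.inv_delete`). If a has no neighbors left, move to v and put v in front of the old leg
(`Round.inv_shift`). If w₀ = v, then Q followed by v covers the graph (`Round.not_far_of_eq`).

Time. All sets are masks and all distances come from breadth-first searches, so a building block
takes O(n + m) steps. C shrinks in every unfinished round, so there are O(n) rounds. Growing R takes
O(n²) tests, since the scan restarts whenever R gains a vertex; this dominates the bound. -/

/-- The registers that a program may change. -/
def Program.vars : Program → List ℕ
  | .skip => []
  | .assign x _ => [x]
  | .write _ _ _ => []
  | .seq P Q => P.vars ++ Q.vars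
  | .branch _ P Q => P.vars ++ Q.vars
  | .loop _ P => P.vars

/-- The arrays that a program may change. -/
def Program.arrs : Program → List ℕ
  | .skip => []
  | .assign _ _ => []
  | .write a _ _ => [a]
  | .seq P Q => P.arrs ++ Q.arrs
  | .branch _ P Q => P.arrs ++ Q.arrs
  | .loop _ P => P.arrs

theorem Exec.var_eq {P : Program} {s s' : State} {t x : ℕ} (h : Exec P s t s')
    (hx : x ∉ P.vars) : s'.var x = s.var x := by
  induction h with
  | skip => rfl
  | assign s y e =>
    simp only [Program.vars, List.mem_singleton] at hx
    simp [Function.update_of_ne hx]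
  | write => rfl
  | seq _ _ ih ih' =>
    simp only [Program.vars, List.mem_append, not_or] at hx
    rw [ih' hx.2, ih hx.1]
  | branch_true _ _ ih =>
    simp only [Program.vars, List.mem_append, not_or] at hx
    exact ih hx.1
  | branch_false _ _ ih =>
    simp only [Program.vars, List.mem_append, not_or] at hx
    exact ih hx.2
  | loop_true _ _ _ ih ih' => rw [ih' hx, ih hx]
  | loop_false => rfl

theorem Exec.arr_eq {P : Program} {s s' : State} {t A : ℕ} (h : Exec P s t s')
    (hA : A ∉ P.arrs) : s'.arr A = s.arr A := by
  induction h with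
  | skip => rfl
  | assign => rfl
  | write s a i e =>
    simp only [Program.arrs, List.mem_singleton] at hA
    simp [Function.update_of_ne hA]
  | seq _ _ ih ih' =>
    simp only [Program.arrs, List.mem_append, not_or] at hA
    rw [ih' hA.2, ih hA.1]
  | branch_true _ _ ih =>
    simp only [Program.arrs, List.mem_append, not_or] at hA
    exact ih hA.1
  | branch_false _ _ ih =>
    simp only [Program.arrs, List.mem_append, not_or] at hA
    exact ih hA.2
  | loop_true _ _ _ ih ih' => rw [ih' hA, ih hA]
  | loop_false => rfl

/-- Started in `s`, the program halts after at most `B` steps in a memory that satisfies `post`. -/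
def Runs (P : Program) (s : State) (B : ℕ) (post : State → Prop) : Prop :=
  ∃ t s', Exec P s t s' ∧ t ≤ B ∧ post s'

namespace Runs

variable {P Q : Program} {s : State} {B B' : ℕ} {post post' : State → Prop}

theorem mono (h : Runs P s B post) (hB : B ≤ B') (hp : ∀ s', post s' → post' s') :
    Runs P s B' post' := by
  obtain ⟨t, s', he, ht, hs⟩ := h
  exact ⟨t, s', he, ht.trans hB, hp s' hs⟩

/-- What the program does not write is unchanged. -/
theorem frame (h : Runs P s B post) :
    Runs P s B fun s' => post s' ∧ (∀ x, x ∉ P.vars → s'.var x = s.var x) ∧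
      ∀ A, A ∉ P.arrs → s'.arr A = s.arr A := by
  obtain ⟨t, s', he, ht, hs⟩ := h
  exact ⟨t, s', he, ht, hs, fun x hx => he.var_eq hx, fun A hA => he.arr_eq hA⟩

theorem skip (h : post s) : Runs .skip s 1 post := ⟨_, _, .skip s, le_rfl, h⟩

theorem assign {x : ℕ} {e : Expr}
    (h : post { s with var := Function.update s.var x (e.eval s) }) :
    Runs (.assign x e) s (e.cost + 1) post := ⟨_, _, .assign s x e, le_rfl, h⟩

theorem write {a : ℕ} {i e : Expr}
    (h : post { s with arr := Function.update s.arr a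
                          (Function.update (s.arr a) (i.eval s) (e.eval s)) }) :
    Runs (.write a i e) s (i.cost + e.cost + 1) post := ⟨_, _, .write s a i e, le_rfl, h⟩

theorem seq (h : Runs P s B fun s' => Runs Q s' B' post) : Runs (.seq P Q) s (B + B') post := by
  obtain ⟨t, s', he, ht, t', s'', he', ht', hs⟩ := h
  exact ⟨_, _, .seq he he', by omega, hs⟩

theorem branch {b : Test} (h1 : b.holds s → Runs P s B post) (h2 : ¬ b.holds s → Runs Q s B post) :
    Runs (.branch b P Q) s (b.cost + B) post := by
  by_cases hb : b.holds s
  · obtain ⟨t, s', he, ht, hs⟩ := h1 hb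
    exact ⟨_, _, .branch_true hb he, by omega, hs⟩
  · obtain ⟨t, s', he, ht, hs⟩ := h2 hb
    exact ⟨_, _, .branch_false hb he, by omega, hs⟩

theorem _root_.PathEcc.Test.cost_pos (b : Test) : 1 ≤ b.cost := by
  cases b <;> simp [Test.cost]

/-- The loop rule: the index of the invariant pays for the steps. -/
theorem loop {b : Test} (I : ℕ → State → Prop)
    (hstep : ∀ j s, I j s → b.holds s → ∃ B, Runs P s B fun s' =>
      ∃ j', b.cost + B + j' ≤ j ∧ I j' s') {j : ℕ} (h : I j s) :
    Runs (.loop b P) s (j + b.cost) fun s' => (∃ j', I j' s') ∧ ¬ b.holds s' := by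
  induction j using Nat.strong_induction_on generalizing s with
  | _ j ih =>
    by_cases hb : b.holds s
    · obtain ⟨B, t, s', he, ht, j', hj', hI⟩ := hstep j s h hb
      -- A round costs at least its test, so the index strictly drops; this is what makes the
      -- induction, and hence the loop, terminate.
      have := b.cost_pos
      obtain ⟨t', s'', he', ht', hs⟩ := ih j' (by omega) hI
      exact ⟨_, _, .loop_true hb he he', by omega, hs⟩
    · exact ⟨_, _, .loop_false hb, by omega, ⟨j, h⟩, hb⟩

/-- The loop rule with a bound on the number of rounds and a bound on the steps of one round. -/
theorem loop_uniform {b : Test} (I : ℕ → State → Prop)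
    (hstep : ∀ j s, I j s → b.holds s → Runs P s B fun s' => ∃ j' < j, I j' s') {j : ℕ} (h : I j s) :
    Runs (.loop b P) s (j * (b.cost + B) + b.cost) fun s' => (∃ j', I j' s') ∧ ¬ b.holds s' := by
  refine (loop (fun i s => ∃ j, i = j * (b.cost + B) ∧ I j s) ?_ ⟨j, rfl, h⟩).mono le_rfl ?_
  · rintro _ s ⟨j, rfl, hI⟩ hb
    refine ⟨B, (hstep j s hI hb).mono le_rfl ?_⟩
    rintro s' ⟨j', hj', hI'⟩
    refine ⟨_, ?_, j', rfl, hI'⟩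
    calc b.cost + B + j' * (b.cost + B) = (j' + 1) * (b.cost + B) := by ring
      _ ≤ j * (b.cost + B) := Nat.mul_le_mul_right _ hj'
  · rintro s' ⟨⟨_, j, rfl, hI⟩, hb⟩
    exact ⟨⟨j, hI⟩, hb⟩

end Runs

/-! ### Loops over the vertices -/

/-- For each `i < n` (in register `10`), run `body`. -/
def forN (body : Program) : Program :=
  .seq (.assign 10 (.const 0))
    (.loop (.lt (.var 10) (.var 0)) (.seq body (.assign 10 (.succ (.var 10)))))

/-- The counter lives in register `10`, so the invariant has to be insensitive to that register
(`hI`). A round costs the body plus 3 for the test and 3 for the increment; the final 5 is the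
initialization and the last, failing test. -/
theorem Runs.forN {body : Program} {s₀ : State} {n B : ℕ} (I : ℕ → State → Prop)
    (hn : s₀.var 0 = n) (h10 : 10 ∉ body.vars) (h0 : 0 ∉ body.vars)
    (hI : ∀ i s x, I i s → I i { s with var := Function.update s.var 10 x })
    (hinit : I 0 s₀)
    (hstep : ∀ i s, i < n → s.var 10 = i → (∀ x, x ≠ 10 → x ∉ body.vars → s.var x = s₀.var x) →
      (∀ A, A ∉ body.arrs → s.arr A = s₀.arr A) → I i s → Runs body s B (I (i + 1))) :
    Runs (forN body) s₀ (n * (B + 6) + 5) (I n) := by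
  have key := Runs.loop_uniform (b := .lt (.var 10) (.var 0))
    (P := .seq body (.assign 10 (.succ (.var 10)))) (B := B + 3)
    (s := { s₀ with var := Function.update s₀.var 10 0 }) (j := n)
    (fun j s => s.var 10 + j = n ∧ (∀ x, x ≠ 10 → x ∉ body.vars → s.var x = s₀.var x) ∧
      (∀ A, A ∉ body.arrs → s.arr A = s₀.arr A) ∧ I (s.var 10) s) ?_ ?_
  · refine (Runs.seq (B := 2) (B' := n * (B + 6) + 3) (Runs.assign ?_)).mono (by omega)
      fun _ h => h
    refine key.mono (le_of_eq ?_) ?_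
    · simp only [Test.cost, Expr.cost]
      ring
    · rintro s ⟨⟨j, hj, hv, -, hIs⟩, hb⟩
      simp only [Test.holds, Expr.eval, not_lt] at hb
      rw [hv 0 (by decide) h0, hn] at hb
      rwa [show s.var 10 = n by omega] at hIs
  · rintro j s ⟨hj, hv, ha, hIs⟩ hb
    simp only [Test.holds, Expr.eval] at hb
    rw [hv 0 (by decide) h0, hn] at hb
    refine Runs.seq ((hstep _ s hb rfl hv ha hIs).frame.mono le_rfl ?_)
    rintro s' ⟨hI', hv', ha'⟩
    refine Runs.assign ⟨j - 1, by omega, ?_, ?_, ?_, ?_⟩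
    · simp only [Function.update_self, Expr.eval, hv' 10 h10]
      omega
    · intro x hx hxb
      simp only [Function.update_of_ne hx, hv' x hxb, hv x hx hxb]
    · intro A hA
      exact (ha' A hA).trans (ha A hA)
    · simp only [Function.update_self, Expr.eval, hv' 10 h10]
      exact hI _ _ _ hI'
  · refine ⟨by simp, fun x hx _ => by simp [Function.update_of_ne hx], fun _ _ => rfl, ?_⟩
    simpa using hI _ _ 0 hinit

/-- Set the cells of `dst` to `1` or `0` according to a test about the number in register `10`. -/
def mapMask (dst : ℕ) (b : Test) : Program :=
  forN (.branch b (.write dst (.var 10) (.const 1)) (.write dst (.var 10) (.const 0)))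

theorem Runs.mapMask {dst n : ℕ} {b : Test} {s₀ : State} (p : ℕ → Prop) (hn : s₀.var 0 = n)
    (hb : ∀ i s, i < n → s.var 10 = i → (∀ x, x ≠ 10 → s.var x = s₀.var x) →
      (∀ A, A ≠ dst → s.arr A = s₀.arr A) → s.arr dst i = s₀.arr dst i → (b.holds s ↔ p i)) :
    Runs (mapMask dst b) s₀ (n * (b.cost + 9) + 5) fun s' => ∀ i < n, s'.arr dst i = 1 ↔ p i := by
  refine (Runs.forN (B := b.cost + 3) (fun i s => (∀ j < i, s.arr dst j = 1 ↔ p j) ∧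
    ∀ j, i ≤ j → s.arr dst j = s₀.arr dst j) hn ?_ ?_ ?_ ?_ ?_).mono le_rfl fun s h => h.1
  · simp [Program.vars]
  · simp [Program.vars]
  · exact fun _ _ _ h => h
  · exact ⟨fun j hj => absurd hj (by omega), fun _ _ => rfl⟩
  · rintro i s hi h10 hv ha ⟨h1, h2⟩
    have hbi := hb i s hi h10 (fun x hx => hv x hx (by simp [Program.vars]))
      (fun A hA => ha A (by simp [Program.arrs, hA])) (h2 i le_rfl)
    have key : ∀ c, (c = 1 ↔ p i) →
        (∀ j < i + 1, Function.update (s.arr dst) i c j = 1 ↔ p j) ∧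
        ∀ j, i + 1 ≤ j → Function.update (s.arr dst) i c j = s₀.arr dst j := by
      intro c hc
      refine ⟨fun j hj => ?_, fun j hj => ?_⟩
      · rcases eq_or_ne j i with rfl | hji
        · simpa using hc
        · rw [Function.update_of_ne hji]
          exact h1 j (by omega)
      · rw [Function.update_of_ne (by omega)]
        exact h2 j (by omega)
    refine Runs.branch (fun hh => Runs.write ?_) (fun hh => Runs.write ?_)
    · simpa [Expr.eval, h10] using key 1 (by simpa using hbi.1 hh)
    · simpa [Expr.eval, h10] using key 0 (by simpa using fun h => hh (hbi.2 h))

/-- Put into register `x` some `i < n` that passes the test about register `10`, or else `n`. -/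
def find (x : ℕ) (b : Test) : Program :=
  .seq (.assign x (.var 0)) (forN (.branch b (.assign x (.var 10)) .skip))

theorem Runs.find {x n : ℕ} {b : Test} {s₀ : State} (p : ℕ → Prop) (hn : s₀.var 0 = n)
    (hx10 : x ≠ 10) (hx0 : x ≠ 0)
    (hb : ∀ i s, i < n → s.var 10 = i → (∀ y, y ≠ 10 → y ≠ x → s.var y = s₀.var y) →
      s.arr = s₀.arr → (b.holds s ↔ p i)) :
    Runs (find x b) s₀ (n * (b.cost + 8) + 7) fun s' =>
      (s'.var x < n ∧ p (s'.var x)) ∨ (s'.var x = n ∧ ∀ i < n, ¬ p i) := by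
  refine (Runs.seq (B := 2) (B' := n * (b.cost + 8) + 5) (Runs.assign ?_)).mono (by omega)
    fun _ h => h
  refine (Runs.forN (n := n) (B := b.cost + 2) (fun i s => (s.var x < n ∧ p (s.var x)) ∨
    (s.var x = n ∧ ∀ j < i, ¬ p j)) ?_ ?_ ?_ ?_ ?_ ?_).mono le_rfl fun s h => h
  · simp [Function.update_of_ne hx0.symm, hn]
  · simp [Program.vars, hx10.symm]
  · simp [Program.vars, hx0.symm]
  · intro i s y h
    simpa [Function.update_of_ne hx10] using h
  · right
    simp [Expr.eval, hn]
  · intro i s hi h10 hv ha hI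
    have hv' : ∀ y, y ≠ 10 → y ≠ x → s.var y = s₀.var y := by
      intro y h1 h2
      rw [hv y h1 (by simp [Program.vars, h2])]
      simp [Function.update_of_ne h2]
    have hbi := hb i s hi h10 hv' (funext fun A => ha A (by simp [Program.arrs]))
    refine Runs.branch (fun hh => Runs.assign ?_)
      (fun hh => (Runs.skip ?_).mono (by omega) fun _ h => h)
    · left
      simpa [Expr.eval, h10] using ⟨hi, hbi.1 hh⟩
    · rcases hI with h | ⟨h1, h2⟩
      · exact .inl h
      · refine .inr ⟨h1, fun j hj => ?_⟩
        rcases eq_or_ne j i with rfl | hji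
        · exact fun h => hh (hbi.2 h)
        · exact h2 j (by omega)

/-- Copy the first `n` cells of `src` into `dst`. -/
def copy (dst src : ℕ) : Program := forN (.write dst (.var 10) (.read src (.var 10)))

theorem Runs.copy {dst src n : ℕ} {s₀ : State} (hn : s₀.var 0 = n) (hne : src ≠ dst) :
    Runs (copy dst src) s₀ (n * 10 + 5) fun s' => ∀ i < n, s'.arr dst i = s₀.arr src i := by
  refine (Runs.forN (B := 4) (fun i s => ∀ j < i, s.arr dst j = s₀.arr src j) hn ?_ ?_ ?_ ?_
    ?_).mono le_rfl fun s h => h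
  · simp [Program.vars]
  · simp [Program.vars]
  · exact fun _ _ _ h => h
  · exact fun j hj => absurd hj (by omega)
  · intro i s hi h10 hv ha hI
    refine Runs.write ?_
    intro j hj
    simp only [Expr.eval, h10, Function.update_self]
    rcases eq_or_ne j i with rfl | hji
    · rw [Function.update_self, ha src (by simp [Program.arrs, hne])]
    · rw [Function.update_of_ne hji]
      exact hI j (by omega)

/-- Put into register `x` some `i < n` with a cell `1` in `M`, the cell of which in `D` is as large
as possible; at the start, register `x` holds some number with a cell `1` in `M`. -/
def argmax (x M D : ℕ) : Program :=
  forN (.branch (.and (.eq (.read M (.var 10)) (.const 1))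
    (.lt (.read D (.var x)) (.read D (.var 10)))) (.assign x (.var 10)) .skip)

theorem Runs.argmax {x M D n : ℕ} {s₀ : State} (hn : s₀.var 0 = n) (hx10 : x ≠ 10) (hx0 : x ≠ 0)
    (hxn : s₀.var x < n) (hxM : s₀.arr M (s₀.var x) = 1) :
    Runs (argmax x M D) s₀ (n * 18 + 5) fun s' =>
      s'.var x < n ∧ s₀.arr M (s'.var x) = 1 ∧
        ∀ i < n, s₀.arr M i = 1 → s₀.arr D i ≤ s₀.arr D (s'.var x) := by
  refine (Runs.forN (B := 12) (fun i s => s.var x < n ∧ s₀.arr M (s.var x) = 1 ∧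
    ∀ j < i, s₀.arr M j = 1 → s₀.arr D j ≤ s₀.arr D (s.var x)) hn ?_ ?_ ?_ ?_
    ?_).mono le_rfl fun s h => h
  · simp [Program.vars, hx10.symm]
  · simp [Program.vars, hx0.symm]
  · intro i s y h
    simpa [Function.update_of_ne hx10] using h
  · exact ⟨hxn, hxM, fun j hj => absurd hj (by omega)⟩
  · rintro i s hi h10 hv ha ⟨h1, h2, h3⟩
    have ha' : ∀ A, s.arr A = s₀.arr A := fun A => ha A (by simp [Program.arrs])
    refine (Runs.branch (B := 2) (fun hh => Runs.assign ?_) (fun hh =>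
      (Runs.skip ?_).mono (by omega) fun _ h => h)).mono (by simp [Test.cost, Expr.cost])
      fun _ h => h
    · simp only [Test.holds, Expr.eval, h10, ha'] at hh
      simp only [Expr.eval, h10, Function.update_self]
      refine ⟨hi, hh.1, fun j hj hM => ?_⟩
      rcases eq_or_ne j i with rfl | hji
      · exact le_rfl
      · have := h3 j (by omega) hM
        omega
    · simp only [Test.holds, Expr.eval, h10, ha', not_and, not_lt] at hh
      refine ⟨h1, h2, fun j hj hM => ?_⟩
      rcases eq_or_ne j i with rfl | hji
      · exact hh hM
      · exact h3 j (by omega) hM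

end PathEcc

namespace PathEcc

/-! ### Breadth-first labelings -/

/-- `d` is the labeling produced by a breadth-first search that starts in `S` and otherwise visits
vertices of `A` only: `d w` is the distance from `S` plus one, and `0` if `w` is not reached. -/
structure IsBfs {V : Type*} (G : SimpleGraph V) (S A : Set V) (d : V → ℕ) : Prop where
  source : ∀ w, d w = 1 ↔ w ∈ S
  step : ∀ u w, d u ≠ 0 → G.Adj u w → w ∈ A → d w ≠ 0 ∧ d w ≤ d u + 1
  parent : ∀ w, 2 ≤ d w → w ∈ A ∧ ∃ u, G.Adj u w ∧ d u + 1 = d w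

/-- Every two vertices of `C` are joined by a path inside `C`. -/
def Linked {V : Type*} (G : SimpleGraph V) (C : Set V) : Prop :=
  ∀ x ∈ C, ∀ y ∈ C, Relation.ReflTransGen (fun u w => G.Adj u w ∧ u ∈ C ∧ w ∈ C) x y

/-- The vertex `x` has distance at least `k` from `S`. -/
def Far {V : Type*} (G : SimpleGraph V) (k : ℕ) (S : Set V) (x : V) : Prop :=
  ∀ s ∈ S, k ≤ G.dist s x

section

variable {V : Type*} {G : SimpleGraph V} {S A : Set V} {d : V → ℕ}

theorem IsBfs.reach_of_adj (h : IsBfs G S A d) {u w : V} (hu : d u ≠ 0) (ha : G.Adj u w)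
    (hw : w ∈ A) : d w ≠ 0 := (h.step u w hu ha hw).1

theorem IsBfs.mem_or_mem (h : IsBfs G S A d) {w : V} (hw : d w ≠ 0) : w ∈ S ∨ w ∈ A := by
  by_cases h1 : d w = 1
  · exact .inl ((h.source w).1 h1)
  · exact .inr (h.parent w (by omega)).1

theorem IsBfs.source_ne_zero (h : IsBfs G S A d) {w : V} (hw : w ∈ S) : d w ≠ 0 := by
  have := (h.source w).2 hw; omega

theorem IsBfs.le_of_walk (h : IsBfs G S Set.univ d) {u w : V} (p : G.Walk u w) (hu : d u ≠ 0) :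
    d w ≠ 0 ∧ d w ≤ d u + p.length := by
  induction p with
  | nil => simpa using hu
  | cons ha p ih =>
    have h1 := h.step _ _ hu ha (Set.mem_univ _)
    have h2 := ih h1.1
    simp only [SimpleGraph.Walk.length_cons]
    omega

theorem IsBfs.exists_dist_lt (h : IsBfs G S A d) (hG : G.Connected) {w : V} (hw : d w ≠ 0) :
    ∃ s ∈ S, G.dist s w < d w := by
  induction hd : d w using Nat.strong_induction_on generalizing w with
  | _ m ih =>
    by_cases h1 : d w = 1
    · exact ⟨w, (h.source w).1 h1, by simp; omega⟩
    · obtain ⟨-, u, hu, hdu⟩ := h.parent w (by omega)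
      obtain ⟨s, hs, hlt⟩ := ih (d u) (by omega) (by omega : d u ≠ 0) rfl
      have := hG.dist_triangle (u := s) (v := u) (w := w)
      have h1 : G.dist u w = 1 := SimpleGraph.dist_eq_one_iff_adj.2 hu
      exact ⟨s, hs, by omega⟩

theorem IsBfs.le_dist (h : IsBfs G S Set.univ d) (hG : G.Connected) {s w : V} (hs : s ∈ S) :
    d w ≠ 0 ∧ d w ≤ G.dist s w + 1 := by
  obtain ⟨p, hp⟩ := hG.exists_walk_length_eq_dist s w
  have h1 := (h.source s).2 hs
  have := h.le_of_walk p (by omega)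
  omega

/-- Labels are distances plus one, which turns `k ≤` into `k <`. With no source all labels are 0
although everything is vacuously far, so `S` has to be nonempty. -/
theorem IsBfs.far_iff (h : IsBfs G S Set.univ d) (hG : G.Connected) (hS : S.Nonempty) {k : ℕ}
    {w : V} : Far G k S w ↔ k < d w := by
  constructor
  · intro hf
    obtain ⟨s, hs⟩ := hS
    obtain ⟨t, ht, hlt⟩ := h.exists_dist_lt hG (h.le_dist hG (w := w) hs).1
    have := hf t ht
    omega
  · intro hk s hs
    have := h.le_dist hG (w := w) hs
    omega

theorem IsBfs.eq_dist (h : IsBfs G S Set.univ d) (hG : G.Connected) {v : V} (hS : S = {v}) (w : V) :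
    d w = G.dist v w + 1 := by
  have h1 := h.le_dist hG (s := v) (w := w) (by simp [hS])
  obtain ⟨t, ht, hlt⟩ := h.exists_dist_lt hG h1.1
  simp only [hS, Set.mem_singleton_iff] at ht
  subst ht
  omega

/-- This is how the program recognizes neighbors: it has no adjacency test, but label 2 of an
unrestricted search marks the vertices outside `S` adjacent to `S`. -/
theorem IsBfs.eq_two_iff (h : IsBfs G S Set.univ d) (w : V) :
    d w = 2 ↔ w ∉ S ∧ ∃ u ∈ S, G.Adj u w := by
  constructor
  · intro h2
    obtain ⟨-, u, hu, hdu⟩ := h.parent w (by omega)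
    refine ⟨fun hw => ?_, u, (h.source u).1 (by omega), hu⟩
    have := (h.source w).2 hw
    omega
  · rintro ⟨hw, u, hu, ha⟩
    have h1 := (h.source u).2 hu
    have h2 := h.step u w (by omega) ha (Set.mem_univ _)
    have h3 : d w ≠ 1 := fun h' => hw ((h.source w).1 h')
    omega

theorem IsBfs.reach_of_chain (h : IsBfs G S A d) {C : Set V} (hC : C ⊆ A) {x y : V}
    (hx : d x ≠ 0)
    (hxy : Relation.ReflTransGen (fun u w => G.Adj u w ∧ u ∈ C ∧ w ∈ C) x y) : d y ≠ 0 := by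
  induction hxy with
  | refl => exact hx
  | tail _ hab ih => exact h.reach_of_adj ih hab.1 (hC hab.2.2)

theorem IsBfs.linked (h : IsBfs G S A d) (hS : Linked G S) : Linked G {w | d w ≠ 0} := by
  set r := fun u w => G.Adj u w ∧ u ∈ {w | d w ≠ 0} ∧ w ∈ {w | d w ≠ 0} with hr
  -- Parents lead from any reached vertex back to a source; symmetry allows two such chains to be
  -- joined through the sources.
  have hsym : ∀ x y, Relation.ReflTransGen r x y → Relation.ReflTransGen r y x := by
    intro x y hxy
    have : Std.Symm r := ⟨fun u w h => ⟨h.1.symm, h.2.2, h.2.1⟩⟩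
    exact (Relation.ReflTransGen.stdSymm (r := r)).symm _ _ hxy
  have key : ∀ x, d x ≠ 0 → ∃ s ∈ S, Relation.ReflTransGen r s x := by
    intro x hx
    induction hd : d x using Nat.strong_induction_on generalizing x with
    | _ m ih =>
      by_cases h1 : d x = 1
      · exact ⟨x, (h.source x).1 h1, .refl⟩
      · obtain ⟨-, u, hu, hdu⟩ := h.parent x (by omega)
        have hu0 : d u ≠ 0 := by
          intro h0
          have : d x = 1 := by omega
          exact h1 this
        obtain ⟨s, hs, hsu⟩ := ih (d u) (by omega) u hu0 rfl
        exact ⟨s, hs, hsu.tail ⟨hu, hu0, hx⟩⟩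
  intro x hx y hy
  obtain ⟨s, hs, hsx⟩ := key x hx
  obtain ⟨t, ht, hty⟩ := key y hy
  have hst : Relation.ReflTransGen r s t := by
    refine Relation.ReflTransGen.mono (p := r) ?_ _ _ (hS s hs t ht)
    rintro u w ⟨h1, h2, h3⟩
    exact ⟨h1, h.source_ne_zero h2, h.source_ne_zero h3⟩
  exact ((hsym _ _ hsx).trans hst).trans hty

theorem linked_singleton (v : V) : Linked G {v} := by
  rintro x rfl y rfl
  exact .refl

/-- A shortest path that leaves a set has a first edge out of it. -/
theorem exists_exit (hG : G.Connected) {A : Set V} {x c : V} (hx : x ∈ A) (hc : c ∉ A) :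
    ∃ u ∈ A, ∃ z ∉ A, G.Adj u z ∧ G.dist x z + G.dist z c = G.dist x c := by
  have : ∀ {x c : V} (p : G.Walk x c), x ∈ A → c ∉ A →
      ∃ u ∈ A, ∃ z ∉ A, G.Adj u z ∧ G.dist x z + G.dist z c ≤ p.length := by
    intro x c p
    induction p with
    | nil => intro h1 h2; exact absurd h1 h2
    | @cons x y c ha p ih =>
      intro h1 h2
      by_cases hy : y ∈ A
      · obtain ⟨u, hu, z, hz, hadj, hle⟩ := ih hy h2
        refine ⟨u, hu, z, hz, hadj, ?_⟩
        have := hG.dist_triangle (u := x) (v := y) (w := z)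
        have h1 : G.dist x y = 1 := SimpleGraph.dist_eq_one_iff_adj.2 ha
        simp only [SimpleGraph.Walk.length_cons]
        omega
      · refine ⟨x, h1, y, hy, ha, ?_⟩
        have h1 : G.dist x y = 1 := SimpleGraph.dist_eq_one_iff_adj.2 ha
        have := SimpleGraph.dist_le p
        simp only [SimpleGraph.Walk.length_cons]
        omega
  obtain ⟨p, hp⟩ := hG.exists_walk_length_eq_dist x c
  obtain ⟨u, hu, z, hz, ha, hle⟩ := this p hx hc
  refine ⟨u, hu, z, hz, ha, ?_⟩
  have := hG.dist_triangle (u := x) (v := z) (w := c)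
  omega

/-! ### The invariant of the search -/

/-- `f 0, …, f (m - 1)` is an induced path. -/
structure IsIndPath (G : SimpleGraph V) (m : ℕ) (f : ℕ → V) : Prop where
  inj : ∀ i < m, ∀ j < m, f i = f j → i = j
  adj : ∀ i < m, ∀ j < m, G.Adj (f i) (f j) ↔ (i + 1 = j ∨ j + 1 = i)

/-- The path `Q` ends in `a`, all that is far from `Q` lies in the connected set `C` of unvisited
vertices, and `leg` is an induced path with `k` vertices that leaves `a` away from `C`. -/
structure Inv (G : SimpleGraph V) (k : ℕ) (Q C : Set V) (a : V) (leg : ℕ → V) : Prop where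
  mem : a ∈ Q
  disj : ∀ x ∈ C, x ∉ Q
  nbr : ∃ v ∈ C, G.Adj a v
  linked : Linked G C
  far : ∀ x, Far G k Q x → x ∈ C
  bd : ∀ c ∈ C, ∀ z ∉ C, G.Adj c z → ∃ q ∈ Q, q = z ∨ G.Adj q z
  leg_zero : leg 0 = a
  leg_path : IsIndPath G k leg
  leg_notMem : ∀ i < k, leg i ∉ C
  leg_nadj : ∀ i, 1 ≤ i → i < k → ∀ c ∈ C, ¬ G.Adj (leg i) c

/-- An edge raises a search label by at most one, so a path whose labels are 1, 2, 3, … has no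
chords. -/
theorem isIndPath_of_chain (h : IsBfs G S A d) {m : ℕ} {f : ℕ → V}
    (hA : ∀ i < m, f i ∈ A ∨ f i ∈ S)
    (hd : ∀ i < m, d (f i) = i + 1) (ha : ∀ i, i + 1 < m → G.Adj (f i) (f (i + 1))) :
    IsIndPath G m f := by
  have hinj : ∀ i < m, ∀ j < m, f i = f j → i = j := by
    intro i hi j hj hij
    have h1 := hd i hi
    have h2 := hd j hj
    rw [hij] at h1
    omega
  have hle : ∀ i < m, ∀ j < m, G.Adj (f i) (f j) → j ≤ i + 1 := by
    intro i hi j hj hadj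
    rcases hA j hj with hj' | hj'
    · have := (h.step _ _ (by rw [hd i hi]; omega) hadj hj').2
      rw [hd i hi, hd j hj] at this
      omega
    · have := (h.source _).2 hj'
      rw [hd j hj] at this
      omega
  refine ⟨hinj, fun i hi j hj => ⟨fun hadj => ?_, ?_⟩⟩
  · have h1 := hle i hi j hj hadj
    have h2 := hle j hj i hi hadj.symm
    have h3 : i ≠ j := by rintro rfl; exact hadj.ne rfl
    omega
  · rintro (rfl | rfl)
    · exact ha i hj
    · exact (ha j hi).symm

theorem IsIndPath.reverse {m : ℕ} {f : ℕ → V} (h : IsIndPath G m f) :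
    IsIndPath G m (fun i => f (m - 1 - i)) := by
  refine ⟨fun i hi j hj hij => ?_, fun i hi j hj => ?_⟩
  · have := h.inj _ (by omega) _ (by omega) hij
    omega
  · rw [h.adj _ (by omega) _ (by omega)]
    omega

/-- The invariant holds for a shortest path that leaves a maximal connected set that does not
cover the graph. -/
theorem inv_init (hG : G.Connected) {k : ℕ} (hk : 1 ≤ k) {R : Set V} (hR : Linked G R)
    (hmax : ∀ v ∉ R, (∃ u ∈ R, G.Adj u v) → ∀ x, ¬ Far G k (insert v R) x)
    {x a : V} (hx : Far G k R x) (ha : a ∉ R) (haR : ∃ u ∈ R, G.Adj u a)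
    {w : ℕ → V} (hw0 : w 0 = x) (hwa : ∀ i < k, G.dist a (w i) = k - 1 - i)
    (hadj : ∀ i, i + 1 < k → G.Adj (w i) (w (i + 1)))
    {A : Set V} (hA : ∀ v, v ∈ A ↔ v ≠ a ∧ ∀ i < k - 1, v ≠ w i ∧ ¬ G.Adj (w i) v)
    {d : V → ℕ} (hd : IsBfs G R A d) :
    Inv G k {v | ∃ i < k, w i = v} {v | d v ≠ 0} a (fun i => w (k - 1 - i)) := by
  have hlast : w (k - 1) = a := by
    have h1 := hwa (k - 1) (by omega)
    rw [Nat.sub_self] at h1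
    exact ((hG.dist_eq_zero_iff).1 h1).symm
  have hxw : ∀ i < k, G.dist (w i) x ≤ i := by
    intro i
    induction i with
    | zero => intro _; simp [hw0]
    | succ i ih =>
      intro hi
      have h1 := ih (by omega)
      have h2 := hG.dist_triangle (u := w (i + 1)) (v := w i) (w := x)
      have h3 : G.dist (w (i + 1)) (w i) = 1 := SimpleGraph.dist_eq_one_iff_adj.2 (hadj i hi).symm
      omega
  have hnR : ∀ i < k, w i ∉ R := by
    intro i hi hmem
    have := hx _ hmem
    have := hxw i hi
    omega
  have hnA : ∀ i < k, w i ∉ A := by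
    intro i hi hmem
    rw [hA] at hmem
    by_cases h : i < k - 1
    · exact (hmem.2 i h).1 rfl
    · have : i = k - 1 := by omega
      exact hmem.1 (this ▸ hlast)
  have hdisj : ∀ i < k, d (w i) = 0 := by
    intro i hi
    by_contra h0
    rcases hd.mem_or_mem h0 with h | h
    · exact hnR i hi h
    · exact hnA i hi h
  have hpath : IsIndPath G k (fun i => w (k - 1 - i)) := by
    refine IsIndPath.reverse ⟨fun i hi j hj hij => ?_, fun i hi j hj => ⟨fun hij => ?_, ?_⟩⟩
    · have h1 := hwa i hi
      have h2 := hwa j hj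
      rw [hij] at h1
      omega
    · have h1 := hwa i hi
      have h2 := hwa j hj
      have h3 := hG.dist_triangle (u := a) (v := w i) (w := w j)
      have h4 := hG.dist_triangle (u := a) (v := w j) (w := w i)
      have h5 : G.dist (w i) (w j) = 1 := SimpleGraph.dist_eq_one_iff_adj.2 hij
      have h6 : G.dist (w j) (w i) = 1 := SimpleGraph.dist_eq_one_iff_adj.2 hij.symm
      have h7 : i ≠ j := by rintro rfl; exact hij.ne rfl
      omega
    · rintro (rfl | rfl)
      · exact hadj i hj
      · exact (hadj j hi).symm
  refine ⟨⟨k - 1, by omega, hlast⟩, ?_, ?_, hd.linked hR, ?_, ?_, by simpa using hlast, hpath, ?_,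
    ?_⟩
  · rintro v hv ⟨i, hi, rfl⟩
    exact hv (hdisj i hi)
  · obtain ⟨u, hu, hua⟩ := haR
    exact ⟨u, hd.source_ne_zero hu, hua.symm⟩
  · intro y hy
    have h1 := hmax a ha haR y
    -- By maximality, `y` is within `k - 1` of some vertex of `R` or of `a`; the latter is
    -- impossible because `a` is on the path.
    simp only [Far, not_forall, not_le] at h1
    obtain ⟨r, hr, hlt⟩ := h1
    rcases hr with rfl | hr
    · have := hy r ⟨k - 1, by omega, hlast⟩
      omega
    obtain ⟨p, hp⟩ := hG.exists_walk_length_eq_dist r y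
    -- A walk with fewer than `k` edges from `R` to `y` never leaves the searched region: a vertex
    -- on it after the first is within `k - 2` of `y`, so if it were `a`, some `w i`, or a neighbor
    -- of some `w i`, then `y` would be within `k - 1` of the path.
    have key : ∀ {r y : V} (p : G.Walk r y), d r ≠ 0 →
        Far G k {v | ∃ i < k, w i = v} y → p.length < k → d y ≠ 0 := by
      intro r y p
      induction p with
      | nil => intro h _ _; exact h
      | @cons r z y hrz p ih =>
        intro hr hfar hlen
        rw [SimpleGraph.Walk.length_cons] at hlen
        have hzy := SimpleGraph.dist_le p
        refine ih (hd.reach_of_adj hr hrz ((hA z).2 ⟨?_, fun i hi => ⟨?_, fun hadj => ?_⟩⟩)) hfar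
          (by omega)
        · rintro rfl
          have := hfar z ⟨k - 1, by omega, hlast⟩
          omega
        · rintro rfl
          have := hfar _ ⟨i, by omega, rfl⟩
          omega
        · have h1 := hfar _ ⟨i, by omega, rfl⟩
          have h2 := hG.dist_triangle (u := w i) (v := z) (w := y)
          have h3 : G.dist (w i) z = 1 := SimpleGraph.dist_eq_one_iff_adj.2 hadj
          omega
    exact key p (hd.source_ne_zero hr) hy (by omega)
  · intro c hc z hz hcz
    have hzA : z ∉ A := fun h => hz (hd.reach_of_adj hc hcz h)
    rw [hA] at hzA
    push Not at hzA
    by_cases hza : z = a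
    · exact ⟨a, ⟨k - 1, by omega, hlast⟩, .inl hza.symm⟩
    · obtain ⟨i, hi, h⟩ := hzA hza
      refine ⟨w i, ⟨i, by omega, rfl⟩, ?_⟩
      by_cases h' : z = w i
      · exact .inl h'.symm
      · exact .inr (h h')
  · intro i hi h
    exact h (hdisj _ (by omega))
  · intro i h1 hi c hc hadj
    -- The sources in `R` need not lie in `A`. For them the distance to `x` decides: it is at least
    -- `k`, while the leg vertex is within `k - 2` of `x`.
    rcases hd.mem_or_mem hc with h | h
    · have h2 := hx c h
      have h3 := hxw (k - 1 - i) (by omega)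
      have h4 := hG.dist_triangle (u := c) (v := w (k - 1 - i)) (w := x)
      have h5 : G.dist c (w (k - 1 - i)) = 1 := SimpleGraph.dist_eq_one_iff_adj.2 hadj.symm
      omega
    · rw [hA] at h
      exact (h.2 (k - 1 - i) (by omega)).2 hadj

end

end PathEcc

namespace PathEcc

/-! ### Breadth-first search -/

/-- The memory holds `G` in registers and arrays `0` and `1`, with lists of total length at most
`M`. -/
structure HasGraph {n : ℕ} (G : SimpleGraph (Fin n)) (M : ℕ) (s : State) : Prop where
  n_eq : s.var 0 = n
  adj : ∀ u w : Fin n, G.Adj u w ↔ ∃ e, s.arr 0 u ≤ e ∧ e < s.arr 0 (u + 1) ∧ s.arr 1 e = w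
  range : ∀ u < n, ∀ e, s.arr 0 u ≤ e → e < s.arr 0 (u + 1) → s.arr 1 e < n
  total : ∑ u ∈ Finset.range n, (s.arr 0 (u + 1) - s.arr 0 u) ≤ M

theorem HasGraph.of_eq {n : ℕ} {G : SimpleGraph (Fin n)} {M : ℕ} {s s' : State}
    (h : HasGraph G M s) (hv : s'.var 0 = s.var 0) (h0 : s'.arr 0 = s.arr 0)
    (h1 : s'.arr 1 = s.arr 1) : HasGraph G M s' :=
  ⟨by rw [hv]; exact h.n_eq, by rw [h0, h1]; exact h.adj, by rw [h0, h1]; exact h.range,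
    by rw [h0]; exact h.total⟩

/-- The set of the vertices with a cell `1` in array `A`. -/
def maskSet {n : ℕ} (s : State) (A : ℕ) : Set (Fin n) := {v | s.arr A v = 1}

theorem mem_maskSet {n : ℕ} {s : State} {A : ℕ} {v : Fin n} :
    v ∈ (maskSet s A : Set (Fin n)) ↔ s.arr A v = 1 := Iff.rfl

/-- The state of a breadth-first search with queue `q`, head `h` and tail `t`; the edges that
satisfy `done` have been scanned. -/
structure QueueInv (n : ℕ) (E : ℕ → ℕ → Prop) (S A : ℕ → Prop) (q D P : ℕ → ℕ) (h t : ℕ)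
    (done : ℕ → ℕ → Prop) : Prop where
  lt : ∀ j < t, q j < n
  inj : ∀ i < t, ∀ j < t, q i = q j → i = j
  reached : ∀ w < n, D w ≠ 0 ↔ ∃ j < t, q j = w
  mono : ∀ i j, i ≤ j → j < t → D (q i) ≤ D (q j)
  le : h < t → ∀ j < t, D (q j) ≤ D (q h) + 1
  source : ∀ w < n, D w = 1 ↔ S w
  parent : ∀ w < n, 2 ≤ D w → A w ∧ P w < n ∧ E (P w) w ∧ D (P w) + 1 = D w
  step : ∀ u w, u < n → w < n → E u w → A w → done u w → D w ≠ 0 ∧ D w ≤ D u + 1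

namespace QueueInv

variable {n : ℕ} {E : ℕ → ℕ → Prop} {S A : ℕ → Prop} {q D P : ℕ → ℕ} {h t : ℕ}
  {done done' : ℕ → ℕ → Prop}

theorem weaken (hI : QueueInv n E S A q D P h t done)
    (hd : ∀ u w, u < n → w < n → E u w → done' u w → done u w) :
    QueueInv n E S A q D P h t done' :=
  ⟨hI.lt, hI.inj, hI.reached, hI.mono, hI.le, hI.source, hI.parent,
    fun u w hu hw he hA hd' => hI.step u w hu hw he hA (hd u w hu hw he hd')⟩

theorem next (hI : QueueInv n E S A q D P h t done) (hh : h < t) :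
    QueueInv n E S A q D P (h + 1) t done :=
  ⟨hI.lt, hI.inj, hI.reached, hI.mono, fun hht j hj => (hI.le hh j hj).trans
    (Nat.succ_le_succ (hI.mono h (h + 1) (by omega) hht)), hI.source, hI.parent, hI.step⟩

/-- A vertex that already has a label is in the queue, and no queued label exceeds that of the head
by more than one. -/
theorem scan_old (hI : QueueInv n E S A q D P h t done) (hh : h < t) {w : ℕ} (hw : w < n)
    (hold : ¬ (A w ∧ D w = 0)) :
    QueueInv n E S A q D P h t fun a b => done a b ∨ (a = q h ∧ b = w) := by
  refine { hI with step := ?_ }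
  rintro a b ha hb hE hAb (hd | ⟨rfl, rfl⟩)
  · exact hI.step a b ha hb hE hAb hd
  · have h0 : D b ≠ 0 := fun h0 => hold ⟨hAb, h0⟩
    obtain ⟨j, hj, rfl⟩ := (hI.reached b hb).1 h0
    exact ⟨h0, hI.le hh j hj⟩

/-- The new entry gets the largest label that the head permits, so the labels along the queue stay
sorted and keep their spread of at most one. -/
theorem scan_new (hI : QueueInv n E S A q D P h t done) (hh : h < t) {w : ℕ} (hw : w < n)
    (hE : E (q h) w) (hA : A w) (hD : D w = 0) :
    QueueInv n E S A (Function.update q t w) (Function.update D w (D (q h) + 1))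
      (Function.update P w (q h)) h (t + 1) fun a b => done a b ∨ (a = q h ∧ b = w) := by
  have hqne : ∀ j < t, q j ≠ w := by
    intro j hj he
    exact (hI.reached w hw).2 ⟨j, hj, he⟩ hD
  have hqt : ∀ j < t, Function.update q t w j = q j := fun j hj =>
    Function.update_of_ne (by omega) _ _
  have hDq : ∀ j < t, Function.update D w (D (q h) + 1) (q j) = D (q j) := fun j hj =>
    Function.update_of_ne (hqne j hj) _ _
  have hDne : ∀ b, b ≠ w → Function.update D w (D (q h) + 1) b = D b := fun b hb =>
    Function.update_of_ne hb _ _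
  have hqh : D (q h) ≠ 0 := (hI.reached _ (hI.lt h hh)).2 ⟨h, hh, rfl⟩
  refine ⟨?_, ?_, ?_, ?_, ?_, ?_, ?_, ?_⟩
  · intro j hj
    rcases Nat.lt_succ_iff_lt_or_eq.1 hj with h1 | rfl
    · rw [hqt j h1]; exact hI.lt j h1
    · simpa using hw
  · intro i hi j hj hij
    rcases Nat.lt_succ_iff_lt_or_eq.1 hi with h1 | rfl <;>
      rcases Nat.lt_succ_iff_lt_or_eq.1 hj with h2 | rfl
    · rw [hqt i h1, hqt j h2] at hij
      exact hI.inj i h1 j h2 hij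
    · rw [hqt i h1, Function.update_self] at hij
      exact absurd hij (hqne i h1)
    · rw [hqt j h2, Function.update_self] at hij
      exact absurd hij.symm (hqne j h2)
    · rfl
  · intro b hb
    rcases eq_or_ne b w with rfl | hbw
    · simp only [Function.update_self, ne_eq, Nat.add_eq_zero_iff, one_ne_zero, and_false,
        not_false_eq_true, true_iff]
      exact ⟨t, by omega, Function.update_self ..⟩
    · rw [hDne b hbw, hI.reached b hb]
      constructor
      · rintro ⟨j, hj, rfl⟩
        exact ⟨j, by omega, hqt j hj⟩
      · rintro ⟨j, hj, rfl⟩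
        rcases Nat.lt_succ_iff_lt_or_eq.1 hj with h1 | rfl
        · exact ⟨j, h1, (hqt j h1).symm⟩
        · simp at hbw
  · intro i j hij hj
    rcases Nat.lt_succ_iff_lt_or_eq.1 hj with h1 | rfl
    · rw [hqt i (by omega), hqt j h1, hDq i (by omega), hDq j h1]
      exact hI.mono i j hij h1
    · rw [Function.update_self, Function.update_self]
      rcases eq_or_lt_of_le hij with rfl | h1
      · simp
      · rw [hqt i h1, hDq i h1]
        exact hI.le hh i h1
  · intro _ j hj
    rw [hqt h hh, hDq h hh]
    rcases Nat.lt_succ_iff_lt_or_eq.1 hj with h1 | rfl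
    · rw [hqt j h1, hDq j h1]
      exact hI.le hh j h1
    · simp
  · intro b hb
    rcases eq_or_ne b w with rfl | hbw
    · rw [Function.update_self]
      have h1 := hI.source b hb
      rw [hD] at h1
      refine ⟨fun h2 => absurd h2 (by omega), fun h2 => absurd (h1.2 h2) (by omega)⟩
    · rw [hDne b hbw]
      exact hI.source b hb
  · intro b hb h2
    rcases eq_or_ne b w with rfl | hbw
    · rw [Function.update_self, Function.update_self, hDq h hh]
      exact ⟨hA, hI.lt h hh, hE, rfl⟩
    · rw [hDne b hbw] at h2 ⊢
      rw [Function.update_of_ne hbw]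
      obtain ⟨h3, h4, h5, h6⟩ := hI.parent b hb h2
      refine ⟨h3, h4, h5, ?_⟩
      rw [hDne _ ?_]
      · exact h6
      · intro he
        rw [he, hD] at h6
        omega
  · rintro a b ha hb hab hAb hd
    rcases eq_or_ne b w with rfl | hbw
    · rw [Function.update_self]
      refine ⟨by omega, ?_⟩
      rcases hd with hd | ⟨rfl, -⟩
      · exact absurd hD (hI.step a b ha hb hab hAb hd).1
      · rw [hDq h hh]
    · rw [hDne b hbw]
      rcases hd with hd | ⟨-, rfl⟩
      · have h1 := hI.step a b ha hb hab hAb hd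
        refine ⟨h1.1, h1.2.trans ?_⟩
        -- An edge scanned earlier may start at `w` itself; raising the label of `w` from 0 only
        -- weakens the bound to be shown.
        rcases eq_or_ne a w with rfl | haw
        · rw [hD]; simp
        · rw [hDne a haw]
      · exact absurd rfl hbw

end QueueInv

/-- Scan the edges of the vertex in register `13`. -/
def bfsScan (A D P : ℕ) : Program :=
  .loop (.lt (.var 14) (.var 16))
    (.seq (.assign 15 (.read 1 (.var 14)))
    (.seq (.branch (.and (.eq (.read A (.var 15)) (.const 1)) (.eq (.read D (.var 15)) (.const 0)))
        (.seq (.write D (.var 15) (.succ (.read D (.var 13))))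
        (.seq (.write P (.var 15) (.var 13))
        (.seq (.write 20 (.var 12) (.var 15))
          (.assign 12 (.succ (.var 12))))))
        .skip)
      (.assign 14 (.succ (.var 14)))))

/-- Breadth-first search from the vertices marked in `S` through the vertices marked in `A`, with
labels in `D` and parents in `P`. -/
def bfs (S A D P : ℕ) : Program :=
  .seq (.assign 12 (.const 0))
  (.seq (forN (.branch (.eq (.read S (.var 10)) (.const 1))
      (.seq (.write D (.var 10) (.const 1))
      (.seq (.write 20 (.var 12) (.var 10))
        (.assign 12 (.succ (.var 12)))))
      (.write D (.var 10) (.const 0))))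
  (.seq (.assign 11 (.const 0))
    (.loop (.lt (.var 11) (.var 12))
      (.seq (.assign 13 (.read 20 (.var 11)))
      (.seq (.assign 14 (.read 0 (.var 13)))
      (.seq (.assign 16 (.read 0 (.succ (.var 13))))
      (.seq (bfsScan A D P)
        (.assign 11 (.succ (.var 11))))))))))

theorem bfs_vars (S A D P : ℕ) : (bfs S A D P).vars =
    [12, 10, 12, 10, 11, 13, 14, 16, 15, 12, 14, 11] := rfl

theorem bfs_arrs (S A D P : ℕ) : (bfs S A D P).arrs = [D, 20, D, D, P, 20] := rfl

section

variable {n : ℕ} {E : ℕ → ℕ → Prop} {S A : ℕ → Prop} {a D P : ℕ}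

/-- The loop index is the number of list entries still to be read. An entry costs at most 32 steps,
whether or not it discovers a vertex. -/
theorem Runs.bfsScan {s₀ : State} {h : ℕ} {done : ℕ → ℕ → Prop}
    (hne : [0, 1, 20, a, D, P].Nodup)
    (hA : ∀ w < n, s₀.arr a w = 1 ↔ A w)
    (hq : s₀.var 13 = s₀.arr 20 h) (hh : h < s₀.var 12)
    (hrange : ∀ e, s₀.var 14 ≤ e → e < s₀.var 16 → s₀.arr 1 e < n ∧ E (s₀.arr 20 h) (s₀.arr 1 e))
    (hI : QueueInv n E S A (s₀.arr 20) (s₀.arr D) (s₀.arr P) h (s₀.var 12) done) :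
    Runs (bfsScan a D P) s₀ ((s₀.var 16 - s₀.var 14) * 32 + 3) fun s =>
      s₀.var 12 ≤ s.var 12 ∧ (∀ j < s₀.var 12, s.arr 20 j = s₀.arr 20 j) ∧
      QueueInv n E S A (s.arr 20) (s.arr D) (s.arr P) h (s.var 12) fun u w => done u w ∨
        (u = s₀.arr 20 h ∧ ∃ e, s₀.var 14 ≤ e ∧ e < s₀.var 16 ∧ s₀.arr 1 e = w) := by
  simp only [List.nodup_cons, List.mem_cons, List.not_mem_nil, or_false, not_or, not_false_eq_true,
    List.nodup_nil, and_true] at hne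
  obtain ⟨⟨-, -, h0a, h0D, h0P⟩, ⟨h120, h1a, h1D, h1P⟩, ⟨h20a, h20D, h20P⟩, ⟨haD, haP⟩, hDP⟩ := hne
  refine (Runs.loop_uniform (B := 29) (j := s₀.var 16 - s₀.var 14) (fun j s =>
    j = s₀.var 16 - s.var 14 ∧ s₀.var 14 ≤ s.var 14 ∧ s.var 16 = s₀.var 16 ∧
    s.var 13 = s₀.var 13 ∧ s.arr 1 = s₀.arr 1 ∧ s.arr a = s₀.arr a ∧
    s₀.var 12 ≤ s.var 12 ∧ (∀ j < s₀.var 12, s.arr 20 j = s₀.arr 20 j) ∧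
    QueueInv n E S A (s.arr 20) (s.arr D) (s.arr P) h (s.var 12) fun u w => done u w ∨
        (u = s₀.arr 20 h ∧ ∃ e, s₀.var 14 ≤ e ∧ e < s.var 14 ∧ s₀.arr 1 e = w)) ?_ ?_).mono
    (le_of_eq ?_) ?_
  · rintro j s ⟨rfl, h14, h16, h13, hs1, hsa, h12, h20, hIs⟩ hb
    simp only [Test.holds, Expr.eval] at hb
    obtain ⟨hw, hE⟩ := hrange (s.var 14) h14 (by omega)
    have hqh : s.arr 20 h = s₀.arr 20 h := h20 h hh
    have hhs : h < s.var 12 := by omega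
    have hdone : ∀ u w, (done u w ∨ (u = s₀.arr 20 h ∧
        ∃ e, s₀.var 14 ≤ e ∧ e < s.var 14 + 1 ∧ s₀.arr 1 e = w)) →
        (done u w ∨ (u = s₀.arr 20 h ∧ ∃ e, s₀.var 14 ≤ e ∧ e < s.var 14 ∧ s₀.arr 1 e = w)) ∨
        (u = s.arr 20 h ∧ w = s₀.arr 1 (s.var 14)) := by
      rintro u w (h1 | ⟨rfl, e, he1, he2, rfl⟩)
      · exact .inl (.inl h1)
      · rcases Nat.lt_succ_iff_lt_or_eq.1 he2 with h3 | rfl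
        · exact .inl (.inr ⟨rfl, e, he1, h3, rfl⟩)
        · exact .inr ⟨hqh.symm, rfl⟩
    refine (Runs.seq (B := 3) (B' := 26) (Runs.assign ?_)).mono le_rfl fun _ h => h
    refine Runs.seq (B := 23) (B' := 3) ?_
    refine Runs.branch (B := 14) (fun hh' => ?_) (fun hh' => ?_)
    · refine Runs.seq (B := 5) (B' := 9) (Runs.write ?_)
      refine Runs.seq (B := 3) (B' := 6) (Runs.write ?_)
      refine Runs.seq (B := 3) (B' := 3) (Runs.write ?_)
      refine Runs.assign (Runs.assign ?_)
      simp only [Test.holds, Expr.eval, Function.update_self, hs1, hsa, hA _ hw] at hh'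
      have hnew := (hIs.scan_new hhs hw (by rwa [hqh]) hh'.1 hh'.2).weaken
        (fun u w _ _ _ hd => hdone u w hd)
      refine ⟨s₀.var 16 - (s.var 14 + 1), by omega, ?_⟩
      simp only [Expr.eval, Function.update_self, Function.update_of_ne, ne_eq, Nat.reduceEqDiff,
        not_false_eq_true, h13, h16, hs1, hsa, h20D, h20P, h1P, h1D, h120,
        haD, haP, Ne.symm h20a, hDP, Ne.symm hDP, hq, Ne.symm h20D, Ne.symm h20P]
      rw [hqh] at hnew
      refine ⟨trivial, by omega, trivial, trivial, trivial, trivial, by omega, ?_, ?_⟩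
      · intro j hj
        rw [Function.update_of_ne (by omega)]
        exact h20 j hj
      · exact hnew
    · refine (Runs.skip ?_).mono (by omega) fun _ h => h
      refine Runs.assign ?_
      simp only [Test.holds, Expr.eval, Function.update_self, hs1, hsa, hA _ hw] at hh'
      have hnew := (hIs.scan_old hhs hw hh').weaken (fun u w _ _ _ hd => hdone u w hd)
      refine ⟨s₀.var 16 - (s.var 14 + 1), by omega, ?_⟩
      simp only [Expr.eval, Function.update_self, Function.update_of_ne, ne_eq, Nat.reduceEqDiff,
        not_false_eq_true, h13, h16, hs1, hsa]
      exact ⟨trivial, by omega, trivial, trivial, trivial, trivial, by omega, h20, hnew⟩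
  · refine ⟨rfl, le_rfl, rfl, rfl, rfl, rfl, le_rfl, fun _ _ => rfl, hI.weaken ?_⟩
    rintro u w _ _ _ (h1 | ⟨_, e, he1, he2, _⟩)
    · exact h1
    · omega
  · simp [Test.cost, Expr.cost]
  · rintro s ⟨⟨_, -, h14, h16, -, -, -, h12, h20, hIs⟩, hb⟩
    simp only [Test.holds, Expr.eval, not_lt] at hb
    refine ⟨h12, h20, hIs.weaken ?_⟩
    rintro u w _ _ _ (h1 | ⟨h1, e, he1, he2, h3⟩)
    · exact .inl h1
    · exact .inr ⟨h1, e, he1, by omega, h3⟩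

end

/-- The parents in array `P` belong to the labeling `d`. -/
def IsParent {n : ℕ} (G : SimpleGraph (Fin n)) (d : Fin n → ℕ) (P : ℕ → ℕ) : Prop :=
  ∀ w, 2 ≤ d w → ∃ u : Fin n, P w = u ∧ G.Adj u w ∧ d u + 1 = d w

-- The linear bound is amortized: each vertex that has not been dequeued holds 19 steps for the
-- round that will dequeue it and 32 for each entry of its list. The queue has no repetitions, so
-- each share is spent at most once.
set_option maxHeartbeats 2000000 in
open Classical in
theorem Runs.bfs {n : ℕ} {G : SimpleGraph (Fin n)} {M S A D P : ℕ} {s₀ : State}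
    (hG : HasGraph G M s₀) (hne : [0, 1, 20, A, D, P].Nodup) (hS : S ≠ D) (hS20 : S ≠ 20) :
    Runs (bfs S A D P) s₀ (40 * (n + M + 1)) fun s =>
      IsBfs G (maskSet s₀ S) (maskSet s₀ A) (fun v => s.arr D v) ∧
      IsParent G (fun v => s.arr D v) (s.arr P) := by
  have hne' := hne
  simp only [List.nodup_cons, List.mem_cons, List.not_mem_nil, or_false, not_or, not_false_eq_true,
    List.nodup_nil, and_true] at hne'
  obtain ⟨⟨-, h020, h0a, h0D, h0P⟩, ⟨h120, h1a, h1D, h1P⟩, ⟨h20a, h20D, h20P⟩, ⟨haD, haP⟩, hDP⟩ :=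
    hne'
  -- The memory holds natural numbers, so the adjacency relation is transported to them.
  set E : ℕ → ℕ → Prop := fun u w => ∃ (hu : u < n) (hw : w < n), G.Adj ⟨u, hu⟩ ⟨w, hw⟩ with hE
  set deg : ℕ → ℕ := fun u => s₀.arr 0 (u + 1) - s₀.arr 0 u with hdeg
  set Sp : ℕ → Prop := fun w => s₀.arr S w = 1 with hSp
  set Ap : ℕ → Prop := fun w => s₀.arr A w = 1 with hAp
  set rest : (ℕ → ℕ) → ℕ → Finset ℕ := fun q h =>
    (Finset.range n).filter fun u => ¬ ∃ j < h, q j = u with hrest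
  have hpot : ∑ u ∈ Finset.range n, (19 + 32 * deg u) ≤ 19 * n + 32 * M := by
    rw [Finset.sum_add_distrib, Finset.sum_const, Finset.card_range, smul_eq_mul, ← Finset.mul_sum]
    have : ∑ u ∈ Finset.range n, deg u ≤ M := hG.total
    omega
  refine (Runs.seq (B := 2) (B' := 38 * n + 32 * M + 10) (Runs.assign ?_)).mono (by omega)
    fun _ h => h
  refine (Runs.seq (B := n * 19 + 5) (B' := 19 * n + 32 * M + 5) ?_).mono (by omega) fun _ h => h
  -- Register `12` is the tail of the queue. All entries are below the counter `i`, so an appended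
  -- `i` is new.
  refine (Runs.forN (n := n) (B := 13) (fun i s =>
    (∀ j < s.var 12, s.arr 20 j < i ∧ Sp (s.arr 20 j)) ∧
    (∀ j < s.var 12, ∀ j' < s.var 12, s.arr 20 j = s.arr 20 j' → j = j') ∧
    (∀ w < i, Sp w → ∃ j < s.var 12, s.arr 20 j = w) ∧
    (∀ w < i, s.arr D w = if Sp w then 1 else 0)) ?_ ?_ ?_ ?_ ?_ ?_).frame.mono le_rfl ?_
  · simpa using hG.n_eq
  · simp [Program.vars]
  · simp [Program.vars]
  · intro i s x h
    simpa [Function.update_of_ne] using h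
  · simp [Expr.eval]
  · rintro i s hi h10 hv ha ⟨h1, h2, h3, h4⟩
    have haS : s.arr S = s₀.arr S := ha S (by simp [Program.arrs, hS, hS20])
    have hq20 : ∀ j < s.var 12, s.arr 20 j < i + 1 ∧ Sp (s.arr 20 j) :=
      fun j hj => ⟨by have := (h1 j hj).1; omega, (h1 j hj).2⟩
    refine (Runs.branch (B := 9) (fun hh => ?_) (fun hh => (Runs.write ?_).mono ?_
      fun _ h => h)).mono (by simp [Test.cost, Expr.cost]) fun _ h => h
    · simp only [Test.holds, Expr.eval, h10, haS] at hh
      refine Runs.seq (B := 3) (B' := 6) (Runs.write (Runs.seq (B := 3) (B' := 3)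
        (Runs.write (Runs.assign ?_))))
      simp only [Expr.eval, h10, Function.update_self, Function.update_of_ne h20D,
        Function.update_of_ne (Ne.symm h20D)]
      refine ⟨?_, ?_, ?_, ?_⟩
      · intro j hj
        rcases Nat.lt_succ_iff_lt_or_eq.1 hj with h5 | rfl
        · rw [Function.update_of_ne (by omega)]
          exact hq20 j h5
        · rw [Function.update_self]
          exact ⟨by omega, hh⟩
      · intro j hj j' hj' hjj
        rcases Nat.lt_succ_iff_lt_or_eq.1 hj with h5 | rfl <;>
          rcases Nat.lt_succ_iff_lt_or_eq.1 hj' with h6 | rfl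
        · rw [Function.update_of_ne (by omega), Function.update_of_ne (by omega)] at hjj
          exact h2 j h5 j' h6 hjj
        · rw [Function.update_of_ne (by omega), Function.update_self] at hjj
          have := (h1 j h5).1
          omega
        · rw [Function.update_self, Function.update_of_ne (by omega)] at hjj
          have := (h1 j' h6).1
          omega
        · rfl
      · intro w hw hSw
        rcases Nat.lt_succ_iff_lt_or_eq.1 hw with h5 | rfl
        · obtain ⟨j, hj, hjw⟩ := h3 w h5 hSw
          exact ⟨j, by omega, by rwa [Function.update_of_ne (by omega)]⟩
        · exact ⟨s.var 12, by omega, Function.update_self ..⟩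
      · intro w hw
        rcases eq_or_ne w i with rfl | hwi
        · rw [Function.update_self, if_pos hh]
        · rw [Function.update_of_ne hwi]
          exact h4 w (by omega)
    · simp only [Test.holds, Expr.eval, h10, haS] at hh
      simp only [Expr.eval, h10, Function.update_self, Function.update_of_ne h20D]
      refine ⟨hq20, h2, ?_, ?_⟩
      · intro w hw hSw
        rcases Nat.lt_succ_iff_lt_or_eq.1 hw with h5 | rfl
        · exact h3 w h5 hSw
        · exact absurd hSw hh
      · intro w hw
        rcases eq_or_ne w i with rfl | hwi
        · rw [Function.update_self, if_neg hh]
        · rw [Function.update_of_ne hwi]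
          exact h4 w (by omega)
    · simp [Expr.cost]
  rintro s₁ ⟨⟨h1, h2, h3, h4⟩, hv1, ha1⟩
  have hD1 : ∀ w < n, s₁.arr D w ≠ 0 ↔ Sp w := by
    intro w hw
    rw [h4 w hw]
    split <;> simp_all
  have hD1' : ∀ w < n, s₁.arr D w = 1 ↔ Sp w := by
    intro w hw
    rw [h4 w hw]
    split <;> simp_all
  have hf : ∀ B, B ≠ 20 → B ≠ D → s₁.arr B = s₀.arr B := fun B hB hB' =>
    ha1 B (by simp [PathEcc.forN, Program.arrs, hB, hB'])
  refine (Runs.seq (B := 2) (B' := 19 * n + 32 * M + 3) (Runs.assign ?_)).mono (by omega)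
    fun _ h => h
  refine (Runs.loop (j := ∑ u ∈ rest (s₁.arr 20) 0, (19 + 32 * deg u)) (fun j s =>
    j = ∑ u ∈ rest (s.arr 20) (s.var 11), (19 + 32 * deg u) ∧
    s.arr 0 = s₀.arr 0 ∧ s.arr 1 = s₀.arr 1 ∧ s.arr A = s₀.arr A ∧ s.var 11 ≤ s.var 12 ∧
    QueueInv n E Sp Ap (s.arr 20) (s.arr D) (s.arr P) (s.var 11) (s.var 12)
      fun u _ => ∃ j < s.var 11, s.arr 20 j = u) ?_ ?_).mono ?_ ?_
  · rintro j s ⟨rfl, hs0, hs1, hsA, hle, hI⟩ hb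
    simp only [Test.holds, Expr.eval] at hb
    have hu := hI.lt _ hb
    refine ⟨16 + 32 * deg (s.arr 20 (s.var 11)), ?_⟩
    refine (Runs.seq (B := 3) (B' := 13 + 32 * deg (s.arr 20 (s.var 11)))
      (Runs.assign ?_)).mono (by omega) fun _ h => h
    refine (Runs.seq (B := 3) (B' := 10 + 32 * deg (s.arr 20 (s.var 11)))
      (Runs.assign ?_)).mono (by omega) fun _ h => h
    refine (Runs.seq (B := 4) (B' := 6 + 32 * deg (s.arr 20 (s.var 11)))
      (Runs.assign ?_)).mono (by omega) fun _ h => h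
    refine (Runs.seq (B := 3 + 32 * deg (s.arr 20 (s.var 11))) (B' := 3) ?_).mono (by omega)
      fun _ h => h
    refine (Runs.bfsScan (n := n) (E := E) (S := Sp) (A := Ap) (h := s.var 11)
      (done := fun u _ => ∃ j < s.var 11, s.arr 20 j = u) hne ?_ ?_ ?_ ?_ ?_).frame.mono ?_ ?_
    · simp only [hsA]
      exact fun w _ => Iff.rfl
    · simp [Expr.eval]
    · simpa [Expr.eval] using hb
    · simp only [Expr.eval, Function.update_self, Function.update_of_ne, ne_eq, Nat.reduceEqDiff,
        not_false_eq_true, hs0, hs1]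
      intro e he1 he2
      have hr := hG.range _ hu e he1 he2
      exact ⟨hr, hu, hr, (hG.adj _ _).2 ⟨e, he1, he2, rfl⟩⟩
    · simpa [Expr.eval] using hI
    · simp only [Expr.eval, Function.update_self, Function.update_of_ne, ne_eq, Nat.reduceEqDiff,
        not_false_eq_true, hs0, hdeg]
      omega
    · simp only [Expr.eval, Function.update_self, Function.update_of_ne, ne_eq, Nat.reduceEqDiff,
        not_false_eq_true, hs0, hs1]
      rintro s' ⟨⟨h12, h20, hI'⟩, hv', ha'⟩
      have h11 : s'.var 11 = s.var 11 := by
        rw [hv' 11 (by simp [PathEcc.bfsScan, Program.vars])]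
        simp
      have hf' : ∀ B, B ≠ 20 → B ≠ D → B ≠ P → s'.arr B = s.arr B := fun B hB hB' hB'' => by
        rw [ha' B (by simp [PathEcc.bfsScan, Program.arrs, hB, hB', hB''])]
      refine Runs.assign ?_
      simp only [Expr.eval, Function.update_self, Function.update_of_ne, ne_eq, Nat.reduceEqDiff,
        not_false_eq_true, h11]
      -- Exactly the head vertex leaves the set of vertices that still hold a share, and this share
      -- pays for the round.
      have hset : rest (s'.arr 20) (s.var 11 + 1) =
          (rest (s.arr 20) (s.var 11)).erase (s.arr 20 (s.var 11)) := by
        ext u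
        simp only [hrest, Finset.mem_filter, Finset.mem_range, Finset.mem_erase]
        constructor
        · rintro ⟨hun, hno⟩
          refine ⟨fun he => hno ⟨s.var 11, by omega, ?_⟩, hun, fun ⟨j, hj, hju⟩ =>
            hno ⟨j, by omega, ?_⟩⟩
          · rw [h20 _ hb, he]
          · rw [h20 _ (by omega), hju]
        · rintro ⟨hne, hun, hno⟩
          refine ⟨hun, fun ⟨j, hj, hju⟩ => ?_⟩
          rw [h20 j (by omega)] at hju
          rcases Nat.lt_succ_iff_lt_or_eq.1 hj with h5 | rfl
          · exact hno ⟨j, h5, hju⟩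
          · exact hne hju.symm
      have hmem : s.arr 20 (s.var 11) ∈ rest (s.arr 20) (s.var 11) := by
        simp only [hrest, Finset.mem_filter, Finset.mem_range]
        refine ⟨hu, fun ⟨j, hj, hju⟩ => ?_⟩
        have := hI.inj j (by omega) _ hb hju
        omega
      refine ⟨_, ?_, rfl, ?_, ?_, ?_, by omega, ?_⟩
      · rw [hset, ← Finset.add_sum_erase _ _ hmem]
        simp only [Test.cost, Expr.cost]
        omega
      · rw [hf' 0 h020 h0D h0P, hs0]
      · rw [hf' 1 h120 h1D h1P, hs1]
      · rw [hf' A (Ne.symm h20a) haD haP, hsA]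
      · refine (hI'.next (by omega)).weaken ?_
        rintro u w hun hwn ⟨hun', hwn', huw⟩ ⟨j, hj, hju⟩
        rw [h20 j (by omega)] at hju
        rcases Nat.lt_succ_iff_lt_or_eq.1 hj with h5 | rfl
        · exact .inl ⟨j, h5, hju⟩
        · refine .inr ⟨hju.symm, ?_⟩
          obtain ⟨e, he1, he2, he3⟩ := (hG.adj _ _).1 huw
          simp only at he1 he2 he3
          exact ⟨e, by rwa [hju], by rwa [hju], he3⟩
  · refine ⟨?_, hf 0 h020 h0D, hf 1 h120 h1D, hf A (Ne.symm h20a) haD, by simp [Expr.eval], ?_⟩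
    · simp [Expr.eval]
    · simp only [Expr.eval, Function.update_self, Function.update_of_ne, ne_eq, Nat.reduceEqDiff,
        not_false_eq_true]
      have hD1q : ∀ j < s₁.var 12, s₁.arr D (s₁.arr 20 j) = 1 := fun j hj =>
        (hD1' _ (h1 j hj).1).2 (h1 j hj).2
      refine ⟨fun j hj => (h1 j hj).1, h2, ?_, ?_, ?_, hD1', ?_, ?_⟩
      · intro w hw
        rw [hD1 w hw]
        exact ⟨h3 w hw, fun ⟨j, hj, hjw⟩ => hjw ▸ (h1 j hj).2⟩
      · intro i j hij hj
        rw [hD1q i (by omega), hD1q j hj]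
      · intro h0 j hj
        rw [hD1q j hj]
        omega
      · intro w hw h5
        rw [h4 w hw] at h5
        split at h5 <;> omega
      · rintro u w _ _ _ _ ⟨j, hj, _⟩
        omega
  · have : ∑ u ∈ rest (s₁.arr 20) 0, (19 + 32 * deg u) ≤
        ∑ u ∈ Finset.range n, (19 + 32 * deg u) :=
      Finset.sum_le_sum_of_subset (Finset.filter_subset _ _)
    simp only [Test.cost, Expr.cost]
    omega
  · rintro s ⟨⟨_, -, -, -, -, hle, hI⟩, hb⟩
    simp only [Test.holds, Expr.eval, not_lt] at hb
    refine ⟨⟨fun w => hI.source w w.2, fun u w hu huw hw => ?_, fun w hw => ?_⟩, fun w hw => ?_⟩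
    · obtain ⟨j, hj, hju⟩ := (hI.reached u u.2).1 hu
      exact hI.step u w u.2 w.2 ⟨u.2, w.2, huw⟩ hw ⟨j, by omega, hju⟩
    · obtain ⟨h5, h6, ⟨_, _, h7⟩, h8⟩ := hI.parent w w.2 hw
      exact ⟨h5, ⟨_, h6⟩, h7, h8⟩
    · obtain ⟨h5, h6, ⟨_, _, h7⟩, h8⟩ := hI.parent w w.2 hw
      exact ⟨⟨_, h6⟩, rfl, h7, h8⟩

end PathEcc

/-! ### One round of the search: what happens to the invariant -/

namespace PathEcc

section

variable {V : Type*} {G : SimpleGraph V}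

/-- The situation of one round of the search in which no obstruction shows up: `F` labels the
unvisited vertices by their distance from the neighbors of `a`, `w₀` is a vertex with a label as
large as possible (if some label exceeds `k`), and `v` is a neighbor of `a` farthest from `w₀`. -/
structure Round (G : SimpleGraph V) (k : ℕ) (Q C : Set V) (a : V) (leg : ℕ → V) (N : Set V)
    (w₀ v : V) (F W H D : V → ℕ) : Prop where
  conn : G.Connected
  inv : Inv G k Q C a leg
  mem_N : ∀ x, x ∈ N ↔ x ∈ C ∧ G.Adj a x
  bfsF : IsBfs G N C F
  pick : (w₀ ∈ C ∧ k < F w₀) ∨ (w₀ ∈ N ∧ ∀ x ∈ C, F x ≤ k)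
  bfsW : IsBfs G {w₀} (C \ N) W
  deep : ∀ y ∈ C, k < F y → W y ≠ 0
  bfsH : IsBfs G {w₀} C H
  mem_v : v ∈ N
  max_v : ∀ x ∈ N, H x ≤ H v
  bfsD : IsBfs G {w₀} (C \ {v}) D

/-- The next set of unvisited vertices. -/
def Round.next (D : V → ℕ) (v : V) : Set V := {x | D x ≠ 0 ∧ x ≠ v}

namespace Round

variable {k : ℕ} {Q C : Set V} {a : V} {leg : ℕ → V} {N : Set V} {w₀ v : V} {F W H D : V → ℕ}

theorem v_mem (h : Round G k Q C a leg N w₀ v F W H D) : v ∈ C := ((h.mem_N v).1 h.mem_v).1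

theorem adj_v (h : Round G k Q C a leg N w₀ v F W H D) : G.Adj a v := ((h.mem_N v).1 h.mem_v).2

theorem w₀_mem (h : Round G k Q C a leg N w₀ v F W H D) : w₀ ∈ C := by
  rcases h.pick with h1 | h1
  · exact h1.1
  · exact ((h.mem_N _).1 h1.1).1

theorem N_sub (h : Round G k Q C a leg N w₀ v F W H D) : N ⊆ C :=
  fun x hx => ((h.mem_N x).1 hx).1

theorem F_ne_zero (h : Round G k Q C a leg N w₀ v F W H D) {x : V} (hx : x ∈ C) : F x ≠ 0 :=
  h.bfsF.reach_of_chain subset_rfl (h.bfsF.source_ne_zero h.mem_v)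
    (h.inv.linked v h.v_mem x hx)

theorem H_ne_zero (h : Round G k Q C a leg N w₀ v F W H D) {x : V} (hx : x ∈ C) : H x ≠ 0 :=
  h.bfsH.reach_of_chain subset_rfl (h.bfsH.source_ne_zero rfl)
    (h.inv.linked w₀ h.w₀_mem x hx)

theorem D_sub (h : Round G k Q C a leg N w₀ v F W H D) {x : V} (hx : D x ≠ 0) : x ∈ C := by
  rcases h.bfsD.mem_or_mem hx with h1 | h1
  · exact h1 ▸ h.w₀_mem
  · exact h1.1

theorem next_sub (h : Round G k Q C a leg N w₀ v F W H D) : next D v ⊆ C :=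
  fun _ hx => h.D_sub hx.1

/-- A vertex of `C` lost with `v` is cut off from `w₀` by `v`. So it is farther from `w₀` than `v`
and, by the choice of `v`, not in `N`; its shortest way to `N` then runs through `v`. It is not
deep, because deep vertices are reached from `w₀` outside `N` and hence without `v`. -/
theorem dist_lt (h : Round G k Q C a leg N w₀ v F W H D) (hw : w₀ ≠ v) {x : V} (hx : x ∈ C)
    (hx0 : D x = 0) : G.dist v x < k := by
  have hnext : ∀ y ∈ C, y ≠ v → ∀ u, G.Adj u y → D y = 0 → D u = 0 := by
    intro y hy hyv u hu hy0
    by_contra hu0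
    exact h.bfsD.reach_of_adj hu0 hu ⟨hy, hyv⟩ hy0
  by_cases hxv : x = v
  · subst hxv
    -- For `k = 0` every vertex of `C` would be deep, and `v`, which is in `N`, would be reached
    -- through `C \ N`.
    have : k ≠ 0 := by
      rintro rfl
      rcases h.pick with h1 | h1
      · have hW := h.deep x hx (by have := h.F_ne_zero hx; omega)
        rcases h.bfsW.mem_or_mem hW with h2 | h2
        · exact hw h2.symm
        · exact h2.2 h.mem_v
      · have := h1.2 x hx
        have := h.F_ne_zero hx
        omega
    simp only [SimpleGraph.dist_self]
    omega
  -- The predecessor of a lost vertex in the search from `w₀` is lost or is `v`; descending, the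
  -- chain must end in `v`.
  have hH : ∀ m, ∀ y ∈ C, y ≠ v → D y = 0 → H y = m → H v < H y := by
    intro m
    induction m using Nat.strong_induction_on with
    | _ m ih =>
      intro y hy hyv hy0 hm
      have hne := h.H_ne_zero hy
      have hne1 : H y ≠ 1 := by
        intro h1
        have h2 : y = w₀ := (h.bfsH.source y).1 h1
        have h3 : D y = 1 := (h.bfsD.source y).2 h2
        omega
      obtain ⟨-, u, hu, hdu⟩ := h.bfsH.parent y (by omega)
      by_cases huv : u = v
      · subst huv; omega
      have hu0 := hnext y hy hyv u hu hy0
      have huC : u ∈ C := by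
        rcases h.bfsH.mem_or_mem (w := u) (by omega) with h1 | h1
        · exact h1 ▸ h.w₀_mem
        · exact h1
      have := ih (H u) (by omega) u huC huv hu0 rfl
      omega
  have hN : ∀ y ∈ C, y ≠ v → D y = 0 → y ∉ N := by
    intro y hy hyv hy0 hyN
    have := hH _ y hy hyv hy0 rfl
    have := h.max_v y hyN
    omega
  -- A search that avoids `N` avoids `v` in particular.
  have hWD : ∀ m y, W y ≠ 0 → W y = m → D y ≠ 0 := by
    intro m
    induction m using Nat.strong_induction_on with
    | _ m ih =>
      intro y hy hm
      by_cases h1 : W y = 1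
      · exact h.bfsD.source_ne_zero ((h.bfsW.source y).1 h1)
      · obtain ⟨hyA, u, hu, hdu⟩ := h.bfsW.parent y (by omega)
        refine h.bfsD.reach_of_adj (ih (W u) (by omega) u (by omega) rfl) hu ⟨hyA.1, ?_⟩
        rintro rfl
        exact hyA.2 h.mem_v
  -- The same descent along the search from `N`: it cannot stop at a source, as lost vertices other
  -- than `v` are not in `N`, so it reaches `v`.
  have hF : ∀ m, ∀ y ∈ C, y ≠ v → D y = 0 → F y = m → G.dist v y < F y := by
    intro m
    induction m using Nat.strong_induction_on with
    | _ m ih =>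
      intro y hy hyv hy0 hm
      have hne := h.F_ne_zero hy
      have hne1 : F y ≠ 1 := fun h1 => hN y hy hyv hy0 ((h.bfsF.source y).1 h1)
      obtain ⟨-, u, hu, hdu⟩ := h.bfsF.parent y (by omega)
      have hadj : G.dist u y = 1 := SimpleGraph.dist_eq_one_iff_adj.2 hu
      by_cases huv : u = v
      · subst huv; omega
      have hu0 := hnext y hy hyv u hu hy0
      have huC : u ∈ C := by
        rcases h.bfsF.mem_or_mem (w := u) (by omega) with h1 | h1
        · exact h.N_sub h1
        · exact h1
      have := ih (F u) (by omega) u huC huv hu0 rfl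
      have := h.conn.dist_triangle (u := v) (v := u) (w := y)
      omega
  have h1 := hF _ x hx hxv hx0 rfl
  have h2 : ¬ k < F x := fun h2 => hWD _ x (h.deep x hx h2) rfl hx0
  omega

/-- If `w₀ = v`, then all is covered after the next step. -/
theorem not_far_of_eq (h : Round G k Q C a leg N w₀ v F W H D) (hw : w₀ = v) (hk : 1 ≤ k) (x : V) :
    ¬ Far G k (insert v Q) x := by
  intro hx
  have hxC : x ∈ C := h.inv.far x fun s hs => hx s (Set.mem_insert_of_mem _ hs)
  have hv := hx v (Set.mem_insert _ _)
  have hFv : F v = 1 := (h.bfsF.source v).2 h.mem_v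
  -- Here the maximum of `H` over `N` is attained at the source `w₀ = v`, where it is 1; so `N`
  -- consists of `v` only.
  have hN : ∀ y ∈ N, y = v := by
    intro y hy
    have h1 := h.max_v y hy
    have h2 : H v = 1 := (h.bfsH.source v).2 hw.symm
    have h3 := h.H_ne_zero (h.N_sub hy)
    have h4 : y = w₀ := (h.bfsH.source y).1 (by omega)
    rw [h4, hw]
  rcases h.pick with h1 | h1
  · rw [hw] at h1
    omega
  · have h2 := h1.2 x hxC
    obtain ⟨s, hs, hlt⟩ := h.bfsF.exists_dist_lt h.conn (h.F_ne_zero hxC)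
    rw [hN s hs] at hlt
    omega

theorem far_mem_next (h : Round G k Q C a leg N w₀ v F W H D) (hk : 1 ≤ k) (x : V)
    (hx : Far G k (insert v Q) x) : x ∈ next D v := by
  have hxC : x ∈ C := h.inv.far x fun s hs => hx s (Set.mem_insert_of_mem _ hs)
  have hv := hx v (Set.mem_insert _ _)
  have hw : w₀ ≠ v := fun hw => h.not_far_of_eq hw hk x hx
  refine ⟨fun h0 => ?_, ?_⟩
  · have := h.dist_lt hw hxC h0
    omega
  · rintro rfl
    simp only [SimpleGraph.dist_self] at hv
    omega

theorem D_v (h : Round G k Q C a leg N w₀ v F W H D) (hw : w₀ ≠ v) : D v = 0 := by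
  by_contra h0
  rcases h.bfsD.mem_or_mem h0 with h1 | h1
  · exact hw h1.symm
  · exact h1.2 rfl

theorem linked_next (h : Round G k Q C a leg N w₀ v F W H D) (hw : w₀ ≠ v) :
    Linked G (next D v) := by
  have : next D v = {x | D x ≠ 0} := by
    ext x
    refine ⟨fun hx => hx.1, fun hx => ⟨hx, ?_⟩⟩
    rintro rfl
    exact hx (h.D_v hw)
  rw [this]
  exact h.bfsD.linked (linked_singleton _)

/-- On a chain in `C` from `w₀` to `v`, the vertex before the first occurrence of `v` is reached
without `v`. -/
theorem nbr_next (h : Round G k Q C a leg N w₀ v F W H D) (hw : w₀ ≠ v) :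
    ∃ u ∈ next D v, G.Adj v u := by
  have hch := h.inv.linked w₀ h.w₀_mem v h.v_mem
  have : ∀ y, Relation.ReflTransGen (fun u w => G.Adj u w ∧ u ∈ C ∧ w ∈ C) w₀ y →
      (D y ≠ 0 ∧ y ≠ v) ∨ ∃ u ∈ next D v, G.Adj v u := by
    intro y hy
    induction hy with
    | refl => exact .inl ⟨h.bfsD.source_ne_zero rfl, hw⟩
    | @tail b c _ hbc ih =>
      rcases ih with ih | ih
      · by_cases hc : c = v
        · subst hc
          exact .inr ⟨b, ih, hbc.1.symm⟩
        · exact .inl ⟨h.bfsD.reach_of_adj ih.1 hbc.1 ⟨hbc.2.2, hc⟩, hc⟩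
      · exact .inr ih
  rcases this v hch with h1 | h1
  · exact absurd rfl h1.2
  · exact h1

theorem bd_next (h : Round G k Q C a leg N w₀ v F W H D) {c : V} (hc : c ∈ next D v) {z : V}
    (hz : z ∉ next D v) (hcz : G.Adj c z) : z = v ∨ ∃ q ∈ Q, q = z ∨ G.Adj q z := by
  by_cases hzv : z = v
  · exact .inl hzv
  refine .inr (h.inv.bd c (h.next_sub hc) z (fun hzC => hz ⟨?_, hzv⟩) hcz)
  exact h.bfsD.reach_of_adj hc.1 hcz ⟨hzC, hzv⟩

theorem card_next_lt [Finite V] (h : Round G k Q C a leg N w₀ v F W H D) :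
    (next D v).ncard < C.ncard := by
  refine Set.ncard_lt_ncard ⟨h.next_sub, fun hsub => ?_⟩ (Set.toFinite _)
  exact (hsub h.v_mem).2 rfl

/-- The search proceeds to `v`, given an induced path that leaves `v`. -/
theorem inv_move (h : Round G k Q C a leg N w₀ v F W H D) (hk : 1 ≤ k) (hw : w₀ ≠ v)
    {leg' : ℕ → V} (h0 : leg' 0 = v) (hp : IsIndPath G k leg')
    (hn : ∀ i < k, leg' i ∉ next D v)
    (hna : ∀ i, 1 ≤ i → i < k → ∀ c ∈ next D v, ¬ G.Adj (leg' i) c) :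
    Inv G k (insert v Q) (next D v) v leg' := by
  refine ⟨Set.mem_insert _ _, ?_, h.nbr_next hw, h.linked_next hw, h.far_mem_next hk, ?_, h0, hp,
    hn, hna⟩
  · rintro x hx (rfl | hxQ)
    · exact hx.2 rfl
    · exact h.inv.disj x (h.next_sub hx) hxQ
  · intro c hc z hz hcz
    rcases h.bd_next hc hz hcz with rfl | ⟨q, hq, h1⟩
    · exact ⟨z, Set.mem_insert _ _, .inl rfl⟩
    · exact ⟨q, Set.mem_insert_of_mem _ hq, h1⟩

/-- The path that leaves `v` can be the previous one, with `v` put in front. -/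
theorem inv_shift (h : Round G k Q C a leg N w₀ v F W H D) (hk : 1 ≤ k) (hw : w₀ ≠ v)
    (ha : ∀ x ∈ N, x ∉ next D v) {leg' : ℕ → V} (h0 : leg' 0 = v)
    (hs : ∀ i, i + 1 < k → leg' (i + 1) = leg i) :
    Inv G k (insert v Q) (next D v) v leg' := by
  have hv := h.v_mem
  have hcross : ∀ j, j + 1 < k → (G.Adj v (leg j) ↔ j = 0) := by
    intro j hj
    constructor
    · intro hadj
      by_contra hj0
      exact h.inv.leg_nadj j (by omega) (by omega) v hv hadj.symm
    · rintro rfl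
      rw [h.inv.leg_zero]
      exact h.adj_v.symm
  have hne : ∀ j, j + 1 < k → leg j ≠ v := by
    intro j hj he
    exact h.inv.leg_notMem j (by omega) (he ▸ hv)
  refine h.inv_move hk hw h0 ⟨?_, ?_⟩ ?_ ?_
  · intro i hi j hj hij
    rcases i with _ | i <;> rcases j with _ | j
    · rfl
    · rw [h0, hs j hj] at hij
      exact absurd hij.symm (hne j hj)
    · rw [h0, hs i hi] at hij
      exact absurd hij (hne i hi)
    · rw [hs i hi, hs j hj] at hij
      rw [h.inv.leg_path.inj i (by omega) j (by omega) hij]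
  · intro i hi j hj
    rcases i with _ | i <;> rcases j with _ | j
    · simp
    · rw [h0, hs j hj, hcross j hj]
      omega
    · rw [h0, hs i hi, G.adj_comm, hcross i hi]
      omega
    · rw [hs i hi, hs j hj, h.inv.leg_path.adj i (by omega) j (by omega)]
      omega
  · intro i hi
    rcases i with _ | i
    · rw [h0]; exact fun hx => hx.2 rfl
    · rw [hs i hi]
      exact fun hx => h.inv.leg_notMem i (by omega) (h.next_sub hx)
  · intro i hi1 hi c hc
    obtain ⟨i, rfl⟩ : ∃ j, i = j + 1 := ⟨i - 1, by omega⟩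
    rw [hs i hi]
    rcases i with _ | i
    · rw [h.inv.leg_zero]
      exact fun hadj => ha c ((h.mem_N c).2 ⟨h.next_sub hc, hadj⟩) hc
    · exact h.inv.leg_nadj _ (by omega) (by omega) c (h.next_sub hc)

/-- The path that leaves `v` can be a shortest path to a vertex far from the unvisited ones. -/
theorem inv_newLeg (h : Round G k Q C a leg N w₀ v F W H D) (hk : 1 ≤ k) (hw : w₀ ≠ v)
    {y : V} (hy : Far G k (next D v) y) {leg' : ℕ → V} (h0 : leg' 0 = v) (hlast : leg' (k - 1) = y)
    (hd : ∀ i < k, G.dist v (leg' i) = i)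
    (hadj : ∀ i, i + 1 < k → G.Adj (leg' i) (leg' (i + 1))) :
    Inv G k (insert v Q) (next D v) v leg' := by
  have hly : ∀ j < k, G.dist (leg' (k - 1 - j)) y ≤ j := by
    intro j
    induction j with
    | zero => intro _; simp [hlast]
    | succ j ih =>
      intro hj
      have h1 := ih (by omega)
      have h2 := hadj (k - 1 - (j + 1)) (by omega)
      rw [show k - 1 - (j + 1) + 1 = k - 1 - j by omega] at h2
      have h3 : G.dist (leg' (k - 1 - (j + 1))) (leg' (k - 1 - j)) = 1 :=
        SimpleGraph.dist_eq_one_iff_adj.2 h2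
      have := h.conn.dist_triangle (u := leg' (k - 1 - (j + 1))) (v := leg' (k - 1 - j)) (w := y)
      omega
  -- The vertex `leg' i` is within `k - 1 - i` of `y`, which is at least `k` away from the new set.
  -- The resulting distance `i + 1` gives both disjointness (`i = 0` included) and, for `i ≥ 1`,
  -- nonadjacency.
  have hfar : ∀ i < k, ∀ c ∈ next D v, i + 1 ≤ G.dist c (leg' i) := by
    intro i hi c hc
    have h1 := hly (k - 1 - i) (by omega)
    rw [show k - 1 - (k - 1 - i) = i by omega] at h1
    have h2 := hy c hc
    have := h.conn.dist_triangle (u := c) (v := leg' i) (w := y)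
    omega
  refine h.inv_move hk hw h0 ⟨?_, ?_⟩ ?_ ?_
  · intro i hi j hj hij
    have h1 := hd i hi
    have h2 := hd j hj
    rw [hij] at h1
    omega
  · intro i hi j hj
    constructor
    · intro hij
      have h1 := hd i hi
      have h2 := hd j hj
      have h3 := h.conn.dist_triangle (u := v) (v := leg' i) (w := leg' j)
      have h4 := h.conn.dist_triangle (u := v) (v := leg' j) (w := leg' i)
      have h5 : G.dist (leg' i) (leg' j) = 1 := SimpleGraph.dist_eq_one_iff_adj.2 hij
      have h6 : G.dist (leg' j) (leg' i) = 1 := SimpleGraph.dist_eq_one_iff_adj.2 hij.symm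
      have h7 : i ≠ j := by rintro rfl; exact hij.ne rfl
      omega
    · rintro (rfl | rfl)
      · exact hadj i hj
      · exact (hadj j hi).symm
  · intro i hi hmem
    have := hfar i hi _ hmem
    simp at this
  · intro i hi1 hi c hc hic
    have h1 := hfar i hi c hc
    have h2 : G.dist c (leg' i) = 1 := SimpleGraph.dist_eq_one_iff_adj.2 hic.symm
    omega

/-- If no path can leave `v` for a shortest path, then `v` need not be visited. -/
theorem inv_delete (h : Round G k Q C a leg N w₀ v F W H D) (hk : 1 ≤ k)
    (ha : ∃ x ∈ N, x ∈ next D v)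
    (hno : ∀ y, G.dist v y + 1 = k → ¬ Far G k (next D v) y) :
    Inv G k Q (next D v) a leg := by
  have hw : w₀ ≠ v := by
    -- If `w₀ = v`, then `v` would be the only vertex of `N`, and `a` would have no neighbor left.
    intro hw
    obtain ⟨x, hx, hx'⟩ := ha
    have h1 := h.max_v x hx
    have h2 : H v = 1 := (h.bfsH.source v).2 hw.symm
    have h3 := h.H_ne_zero (h.N_sub hx)
    have h4 : x = w₀ := (h.bfsH.source x).1 (by omega)
    exact hx'.2 (h4.trans hw)
  have hav : G.dist a v = 1 := SimpleGraph.dist_eq_one_iff_adj.2 h.adj_v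
  refine ⟨h.inv.mem, fun x hx => h.inv.disj x (h.next_sub hx), ?_, h.linked_next hw, ?_, ?_,
    h.inv.leg_zero, h.inv.leg_path, fun i hi hx => h.inv.leg_notMem i hi (h.next_sub hx),
    fun i h1 hi c hc => h.inv.leg_nadj i h1 hi c (h.next_sub hc)⟩
  · obtain ⟨x, hx, hx'⟩ := ha
    exact ⟨x, hx', ((h.mem_N x).1 hx).2⟩
  · intro x hx
    by_contra hxn
    have hxC := h.inv.far x hx
    have hax := hx a h.inv.mem
    by_cases hxv : x = v
    · subst hxv
      refine hno x (by simp; omega) fun c hc => ?_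
      have : c ≠ x := hc.2
      have := h.conn.pos_dist_of_ne this
      omega
    · have hx0 : D x = 0 := by
        by_contra h0
        exact hxn ⟨h0, hxv⟩
      have h1 := h.dist_lt hw hxC hx0
      have h2 := h.conn.dist_triangle (u := a) (v := v) (w := x)
      -- Since `x` is at least `k` away from `a` and less than `k` away from `v`, it is exactly `k -
      -- 1` away from `v`. It remains to see that `x` is far from the new set, which `hno` forbids.
      refine hno x (by omega) fun c hc => ?_
      obtain ⟨u, ⟨huC, huv, hu0⟩, z, hz, huz, hsum⟩ :=
        exists_exit h.conn (A := {y | y ∈ C ∧ y ≠ v ∧ D y = 0}) (x := x) (c := c)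
          ⟨hxC, hxv, hx0⟩ (fun hcA => hc.1 hcA.2.2)
      have hz' : z ∉ next D v := by
        intro hzn
        exact h.bfsD.reach_of_adj hzn.1 huz.symm ⟨huC, huv⟩ hu0
      have hzc : z ≠ c := by rintro rfl; exact hz' hc
      have hpos := h.conn.pos_dist_of_ne hzc
      -- A shortest path from `x` to `c` leaves the lost vertices at `z`, which is `v` or outside
      -- `C`, hence on or next to `Q`. So `x` is at least `k - 1` away from `z`, and the rest of the
      -- path to `c` adds at least one.
      have hq : ∃ q ∈ Q, G.dist q z ≤ 1 := by
        by_cases hzv : z = v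
        · subst hzv
          exact ⟨a, h.inv.mem, hav.le⟩
        · have hzC : z ∉ C := by
            intro hzC
            refine hz ⟨hzC, hzv, ?_⟩
            by_contra h0
            exact hz' ⟨h0, hzv⟩
          obtain ⟨q, hq, rfl | hqz⟩ := h.inv.bd u huC z hzC huz
          · exact ⟨q, hq, by simp⟩
          · exact ⟨q, hq, (SimpleGraph.dist_eq_one_iff_adj.2 hqz).le⟩
      obtain ⟨q, hq, hqz⟩ := hq
      have h3 := hx q hq
      have h4 := h.conn.dist_triangle (u := q) (v := z) (w := x)
      have h5 : G.dist z x = G.dist x z := SimpleGraph.dist_comm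
      have h6 : G.dist c x = G.dist x c := SimpleGraph.dist_comm
      omega
  · intro c hc z hz hcz
    rcases h.bd_next hc hz hcz with rfl | h1
    · exact ⟨a, h.inv.mem, .inr h.adj_v⟩
    · exact h1

end Round

/-- A shortest path in `C` between two deep vertices that are separated by the neighbors of `a`. -/
theorem obstruction_of_deep {k : ℕ} {Q C : Set V} {a : V} {leg : ℕ → V}
    (hinv : Inv G k Q C a leg) {N : Set V} (hN : ∀ x, x ∈ N ↔ x ∈ C ∧ G.Adj a x)
    {F W L : V → ℕ} (hF : IsBfs G N C F) {w₀ y : V} (hw₀F : k < F w₀)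
    (hW : IsBfs G {w₀} (C \ N) W) (hy : y ∈ C) (hyF : k < F y) (hyW : W y = 0)
    (hL : IsBfs G {y} C L) {m : ℕ} {w : ℕ → V} (hw0 : w 0 = w₀)
    (hd : ∀ j < m, L (w j) = m - j) (hadj : ∀ j, j + 1 < m → G.Adj (w j) (w (j + 1)))
    (hm : 1 ≤ m) :
    IsIndPath G m w ∧ (∀ j < m, w j ∈ C) ∧ (∃ j < m, w j ∈ N) ∧
      ∀ j < m, w j ∈ N → k ≤ j ∧ j + k < m := by
  have hsub : ∀ j < m, w j ∈ C := by
    intro j hj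
    rcases hL.mem_or_mem (w := w j) (by have := hd j hj; omega) with h1 | h1
    · rw [h1]; exact hy
    · exact h1
  have hlast : w (m - 1) = y := (hL.source _).1 (by have := hd (m - 1) (by omega); omega)
  have hFne : ∀ x ∈ C, F x ≠ 0 := by
    intro x hx
    obtain ⟨v, hv, hav⟩ := hinv.nbr
    exact hF.reach_of_chain subset_rfl (hF.source_ne_zero ((hN v).2 ⟨hv, hav⟩))
      (hinv.linked v hv x hx)
  have hpath : IsIndPath G m w := by
    -- Labels count from `y`, so the path has to be read backwards to have labels 1, 2, 3, ….
    have h1 : IsIndPath G m (fun i => w (m - 1 - i)) := by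
      refine isIndPath_of_chain hL (fun i hi => .inl (hsub _ (by omega))) (fun i hi => ?_)
        fun i hi => ?_
      · rw [hd _ (by omega)]; omega
      · have := hadj (m - 1 - (i + 1)) (by omega)
        rw [show m - 1 - (i + 1) + 1 = m - 1 - i by omega] at this
        exact this.symm
    have h2 := h1.reverse
    refine ⟨fun i hi j hj hij => ?_, fun i hi j hj => ?_⟩
    · refine h2.inj i hi j hj ?_
      simpa only [show m - 1 - (m - 1 - i) = i by omega, show m - 1 - (m - 1 - j) = j by omega]
        using hij
    · have := h2.adj i hi j hj
      simpa only [show m - 1 - (m - 1 - i) = i by omega, show m - 1 - (m - 1 - j) = j by omega]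
        using this
  -- The label `F` drops by at most one per edge and is 1 on `N`, so a path that starts above `k`
  -- needs at least `k` edges to get into `N`; `hback` is the same from the other end.
  have hfront : ∀ j < m, k < F (w j) + j := by
    intro j
    induction j with
    | zero => intro _; simpa [hw0] using hw₀F
    | succ j ih =>
      intro hj
      have h1 := ih (by omega)
      have h2 := (hF.step _ _ (hFne _ (hsub (j + 1) hj)) (hadj j hj).symm (hsub j (by omega))).2
      omega
  have hback : ∀ j < m, k < F (w (m - 1 - j)) + j := by
    intro j
    induction j with
    | zero => intro _; simpa [hlast] using hyF
    | succ j ih =>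
      intro hj
      have h1 := ih (by omega)
      have h3 := hadj (m - 1 - (j + 1)) (by omega)
      rw [show m - 1 - (j + 1) + 1 = m - 1 - j by omega] at h3
      have h2 := (hF.step _ _ (hFne _ (hsub (m - 1 - (j + 1)) (by omega))) h3
        (hsub _ (by omega))).2
      omega
  refine ⟨hpath, hsub, ?_, ?_⟩
  · by_contra hno
    push Not at hno
    -- A path that avoids `N` would let the search from `w₀` in `C \ N` reach `y`.
    have : ∀ j < m, W (w j) ≠ 0 := by
      intro j
      induction j with
      | zero => intro _; rw [hw0]; exact hW.source_ne_zero rfl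
      | succ j ih =>
        intro hj
        exact hW.reach_of_adj (ih (by omega)) (hadj j hj) ⟨hsub _ hj, hno _ hj⟩
    exact this (m - 1) (by omega) (hlast ▸ hyW)
  · intro j hj hjN
    have h1 := (hF.source _).2 hjN
    have h2 := hfront j hj
    have h3 := hback (m - 1 - j) (by omega)
    rw [show m - 1 - (m - 1 - j) = j by omega] at h3
    omega

end

end PathEcc

/-! ### Recognizing the obstructions in a path with an attached leg -/

namespace PathEcc

section

variable {V : Type*} {G : SimpleGraph V}

theorem nonempty_induce_iso {W : Type*} {H : SimpleGraph W} {S : Set V} (f : W → V)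
    (hf : Function.Injective f) (hS : ∀ v, v ∈ S ↔ ∃ x, f x = v)
    (hadj : ∀ x y, G.Adj (f x) (f y) ↔ H.Adj x y) : Nonempty (G.induce S ≃g H) := by
  let g : W → S := fun x => ⟨f x, (hS _).2 ⟨x, rfl⟩⟩
  have hg : Function.Bijective g := by
    refine ⟨fun x y hxy => hf (congrArg Subtype.val hxy), fun ⟨v, hv⟩ => ?_⟩
    obtain ⟨x, rfl⟩ := (hS v).1 hv
    exact ⟨x, rfl⟩
  refine ⟨SimpleGraph.Iso.symm ⟨Equiv.ofBijective g hg, ?_⟩⟩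
  intro x y
  exact hadj x y

/-- An induced path `w` with `e + 2 * k + 1` vertices, an induced path `leg` with `k` vertices
disjoint from it, and edges between the two that join `leg 0` to vertices among
`w k, …, w (k + e)` only, including these two. -/
structure IsTripod (G : SimpleGraph V) (k e : ℕ) (w leg : ℕ → V) : Prop where
  path : IsIndPath G (e + 2 * k + 1) w
  leg_path : IsIndPath G k leg
  ne : ∀ i < e + 2 * k + 1, ∀ j < k, w i ≠ leg j
  nadj : ∀ i < e + 2 * k + 1, ∀ j, 1 ≤ j → j < k → ¬ G.Adj (leg j) (w i)
  adj_first : G.Adj (leg 0) (w k)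
  adj_last : G.Adj (leg 0) (w (k + e))
  range : ∀ i < e + 2 * k + 1, G.Adj (leg 0) (w i) → k ≤ i ∧ i ≤ k + e

namespace IsTripod

variable {k e : ℕ} {w leg : ℕ → V}

/-- The vertices of a tripod. -/
def verts (k e : ℕ) (w leg : ℕ → V) : Set V :=
  {v | (∃ i < e + 2 * k + 1, w i = v) ∨ ∃ j < k, leg j = v}

/-- With `e = 0` the leg is attached at `w k` only. This is the center, and its three legs are the
two halves of `w` and `leg`. -/
theorem claw (h : IsTripod G k 0 w leg) :
    Nonempty (G.induce (verts k 0 w leg) ≃g subdividedClaw k) := by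
  have hleg : ∀ i < 2 * k + 1, ∀ j < k, G.Adj (leg j) (w i) ↔ j = 0 ∧ i = k := by
    intro i hi j hj
    constructor
    · intro hadj
      have hj0 : j = 0 := by
        by_contra h0
        exact h.nadj i (by omega) j (by omega) hj hadj
      subst hj0
      have := h.range i (by omega) hadj
      omega
    · rintro ⟨rfl, rfl⟩
      exact h.adj_first
  let f : Option (Fin 3 × Fin k) → V := fun x =>
    match x with
    | none => w k
    | some (i, j) => if i = 0 then w (k - 1 - j) else if i = 1 then w (k + 1 + j) else leg j
  have hi3 : ∀ i : Fin 3, i = 0 ∨ i = 1 ∨ i = 2 := by decide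
  have hadj : ∀ x y, (f x = f y → x = y) ∧ (G.Adj (f x) (f y) ↔ (subdividedClaw k).Adj x y) := by
    have hp := h.path
    have hl := h.leg_path
    have hne := h.ne
    simp only [Nat.zero_add] at hp hne
    have hne' : ∀ i < 2 * k + 1, ∀ j < k, leg j ≠ w i := fun i hi j hj => (hne i hi j hj).symm
    have hleg' : ∀ i < 2 * k + 1, ∀ j < k, G.Adj (w i) (leg j) ↔ j = 0 ∧ i = k :=
      fun i hi j hj => by rw [G.adj_comm, hleg i hi j hj]
    rintro (_ | ⟨i, j⟩) (_ | ⟨i', j'⟩)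
    · simp [f]
    · have hj' := j'.2
      rcases hi3 i' with rfl | rfl | rfl <;>
        simp (disch := omega) only [f, subdividedClaw, SimpleGraph.fromRel_adj, hp.adj, hleg',
          Fin.isValue, reduceCtorEq, if_true, if_false, one_ne_zero, Fin.reduceEq, ne_eq,
          not_false_eq_true, true_and, or_false]
      · refine ⟨fun h' => ?_, by omega⟩
        have := hp.inj _ (by omega) _ (by omega) h'
        omega
      · refine ⟨fun h' => ?_, by omega⟩
        have := hp.inj _ (by omega) _ (by omega) h'
        omega
      · refine ⟨fun h' => ?_, by simp⟩
        exact hne _ (by omega) _ (by omega) h'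
    · have hj := j.2
      rcases hi3 i with rfl | rfl | rfl <;>
        simp (disch := omega) only [f, subdividedClaw, SimpleGraph.fromRel_adj, hp.adj, hleg,
          hne', Fin.isValue, reduceCtorEq, if_true, if_false, one_ne_zero, Fin.reduceEq, ne_eq,
          not_false_eq_true, true_and, false_or]
      · refine ⟨fun h' => ?_, by omega⟩
        have := hp.inj _ (by omega) _ (by omega) h'
        omega
      · refine ⟨fun h' => ?_, by omega⟩
        have := hp.inj _ (by omega) _ (by omega) h'
        omega
      · simp
    · have hj := j.2
      have hj' := j'.2
      have hjj : (j : ℕ) = j' ↔ j = j' := Fin.ext_iff.symm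
      rcases hi3 i with rfl | rfl | rfl <;> rcases hi3 i' with rfl | rfl | rfl <;>
        simp (disch := omega) only [f, subdividedClaw, SimpleGraph.fromRel_adj, hp.adj, hleg, hleg',
          hl.adj, hne, hne', Fin.isValue, if_true, if_false, one_ne_zero,
          Fin.reduceEq, ne_eq, not_false_eq_true, true_and, Option.some.injEq,
          Prod.mk.injEq, false_and, or_false, and_false, zero_ne_one, iff_false,
          ← hjj, IsEmpty.forall_iff] <;>
        first
        | omega
        | (refine ⟨fun h' => ?_, by omega⟩
           first
           | (have := hp.inj _ (by omega) _ (by omega) h'; omega)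
           | (have := hl.inj _ (by omega) _ (by omega) h'; omega))
  refine nonempty_induce_iso f (fun x y => (hadj x y).1) (fun v => ?_) fun x y => (hadj x y).2
  constructor
  · rintro (⟨i, hi, rfl⟩ | ⟨j, hj, rfl⟩)
    · rcases lt_trichotomy i k with h1 | rfl | h1
      · refine ⟨some (0, ⟨k - 1 - i, by omega⟩), ?_⟩
        simp only [f, if_true]
        congr 1
        omega
      · exact ⟨none, rfl⟩
      · refine ⟨some (1, ⟨i - k - 1, by omega⟩), ?_⟩
        simp only [f, if_true, one_ne_zero, if_false]
        congr 1
        omega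
    · exact ⟨some (2, ⟨j, hj⟩), by simp [f]⟩
  · rintro ⟨_ | ⟨i, j⟩, rfl⟩
    · exact .inl ⟨k, by omega, rfl⟩
    · have hj := j.2
      rcases hi3 i with rfl | rfl | rfl
      · exact .inl ⟨k - 1 - j, by omega, by simp [f]⟩
      · exact .inl ⟨k + 1 + j, by omega, by simp [f]⟩
      · exact .inr ⟨j, by omega, by simp [f]⟩

end IsTripod

theorem pathWithCenter_adj_some {p : ℕ} {A : Finset (Fin p)} {i j : Fin p} :
    (pathWithCenter p A).Adj (some i) (some j) ↔ ((i : ℕ) + 1 = j ∨ (j : ℕ) + 1 = i) := by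
  simp only [pathWithCenter, SimpleGraph.fromRel_adj, ne_eq, Option.some.injEq, Fin.ext_iff]
  omega

theorem pathWithCenter_adj_none {p : ℕ} {A : Finset (Fin p)} {j : Fin p} :
    (pathWithCenter p A).Adj none (some j) ↔ j ∈ A := by
  simp [pathWithCenter, SimpleGraph.fromRel_adj]

/-- An inner vertex of the path has two neighbors on the path already. An endpoint has one, and the
center is not adjacent to it. Two vertices of the path cannot coincide as endpoints, since a
neighbor of the center lies strictly between them. -/
theorem mem_extremities {p : ℕ} {A : Finset (Fin p)} (hA : IsM p A) (i : Fin p) :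
    some i ∈ extremities p A ↔ (i : ℕ) = 0 ∨ (i : ℕ) + 1 = p := by
  have hp : 3 ≤ p := by
    obtain ⟨j, hj⟩ := Finset.card_pos.1 (show 0 < A.card by have := hA.1; omega)
    have := hA.2 j hj
    have := j.2
    omega
  have hi := i.2
  simp only [extremities, Set.mem_ofPred_eq, reduceCtorEq, false_or]
  constructor
  · intro h1
    by_contra h2
    obtain ⟨x, hx⟩ := Set.ncard_eq_one.1 h1
    have h3 : some (⟨i - 1, by omega⟩ : Fin p) ∈ (pathWithCenter p A).neighborSet (some i) :=
      by
      refine (pathWithCenter_adj_some (A := A)).2 (.inr ?_)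
      simp only
      omega
    have h4 : some (⟨i + 1, by omega⟩ : Fin p) ∈ (pathWithCenter p A).neighborSet (some i) :=
      by
      exact (pathWithCenter_adj_some (A := A)).2 (.inl rfl)
    rw [hx, Set.mem_singleton_iff] at h3 h4
    have h5 := h3.trans h4.symm
    simp only [Option.some.injEq, Fin.mk.injEq] at h5
    omega
  · intro h1
    have hiA : i ∉ A := fun h => by have := hA.2 i h; omega
    rw [Set.ncard_eq_one]
    refine ⟨some ⟨if (i : ℕ) = 0 then 1 else i - 1, by split <;> omega⟩, ?_⟩
    ext x
    rcases x with _ | x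
    · simp only [SimpleGraph.mem_neighborSet, Set.mem_singleton_iff, reduceCtorEq, iff_false]
      rw [SimpleGraph.adj_comm, pathWithCenter_adj_none]
      exact hiA
    · have hx := x.2
      simp only [SimpleGraph.mem_neighborSet, Set.mem_singleton_iff, pathWithCenter_adj_some,
        Option.some.injEq, Fin.ext_iff]
      split <;> omega

namespace IsTripod

variable {k e : ℕ} {w leg : ℕ → V}

-- The underlying member of `M` has path `w (k - 1), …, w (k + e + 1)`, one vertex beyond the
-- extreme neighbors of `leg 0` on either side, and center `leg 0`. As `e ≥ 1`, the extreme
-- neighbors are distinct. The remaining `k - 1` vertices on each side and of the leg are the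
-- attached paths.
set_option maxHeartbeats 1000000 in
open Classical in
theorem isMk (h : IsTripod G k e w leg) (hk : 1 ≤ k) (he : 1 ≤ e) :
    IsMk k (G.induce (verts k e w leg)) := by
  let A : Finset (Fin (e + 3)) := Finset.univ.filter fun i => G.Adj (leg 0) (w (k - 1 + i))
  have hmemA : ∀ i, i ∈ A ↔ G.Adj (leg 0) (w (k - 1 + i)) := by simp [A]
  have hA : IsM (e + 3) A := by
    constructor
    · rw [← Nat.lt_iff_add_one_le, Finset.one_lt_card]
      refine ⟨⟨1, by omega⟩, (hmemA _).2 ?_, ⟨e + 1, by omega⟩, (hmemA _).2 ?_, ?_⟩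
      · simpa [Nat.sub_add_cancel hk] using h.adj_first
      · have := h.adj_last
        rwa [show k + e = k - 1 + (e + 1) by omega] at this
      · simp only [ne_eq, Fin.mk.injEq]
        omega
    · intro i hi
      have h1 := h.range (k - 1 + i) (by have := i.2; omega) ((hmemA i).1 hi)
      omega
  refine ⟨e + 3, A, hA, ?_⟩
  -- The path attached to the first endpoint runs down to `w 0`, the one attached to the last runs
  -- up; other path vertices occur with `j = 0` only.
  let pos : Fin (e + 3) → ℕ → ℕ := fun i j => if (i : ℕ) = 0 then k - 1 - j else k - 1 + i + j
  have hpos : ∀ i j, pos i j = if (i : ℕ) = 0 then k - 1 - j else k - 1 + i + j := fun _ _ => rfl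
  let f : {x : Option (Fin (e + 3)) × ℕ // x.2 = 0 ∨ (x.1 ∈ extremities (e + 3) A ∧ x.2 < k)} →
      V := fun x =>
    match x with
    | ⟨(none, j), _⟩ => leg j
    | ⟨(some i, j), _⟩ => w (pos i j)
  have hsome : ∀ (i : Fin (e + 3)) (j : ℕ),
      (j = 0 ∨ (some i ∈ extremities (e + 3) A ∧ j < k)) ↔
        (j = 0 ∨ (((i : ℕ) = 0 ∨ (i : ℕ) = e + 2) ∧ j < k)) := by
    intro i j
    rw [mem_extremities hA]
    omega
  have hnone : ∀ j : ℕ, (j = 0 ∨ (none ∈ extremities (e + 3) A ∧ j < k)) ↔ j < k := by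
    intro j
    simp only [extremities, Set.mem_ofPred_eq, true_or, true_and]
    omega
  have hp := h.path
  have hl := h.leg_path
  have hleg : ∀ i < e + 2 * k + 1, ∀ j < k, G.Adj (leg j) (w i) → j = 0 := by
    intro i hi j hj hadj
    by_contra h0
    exact h.nadj i (by omega) j (by omega) hj hadj
  have hcross : ∀ (i : Fin (e + 3)) (j j' : ℕ),
      (j = 0 ∨ (((i : ℕ) = 0 ∨ (i : ℕ) = e + 2) ∧ j < k)) → j' < k →
        (G.Adj (leg j') (w (pos i j)) ↔ j' = 0 ∧ j = 0 ∧ i ∈ A) := by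
    intro i j j' hj hj'
    have hi := i.2
    have hlt : pos i j < e + 2 * k + 1 := by rw [hpos]; split <;> omega
    constructor
    · intro hadj
      have h0 := hleg _ hlt _ hj' hadj
      subst h0
      have h1 := h.range _ hlt hadj
      rw [hpos] at h1 hadj
      have hi0 : (i : ℕ) ≠ 0 := by
        intro h0
        rw [if_pos h0] at h1
        omega
      rw [if_neg hi0] at h1 hadj
      have hj0 : j = 0 := by omega
      subst hj0
      exact ⟨rfl, rfl, (hmemA i).2 hadj⟩
    · rintro ⟨rfl, rfl, hiA⟩
      have h1 := (hmemA i).1 hiA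
      have h2 := hA.2 i hiA
      rw [hpos, if_neg h2.1]
      exact h1
  have hmain : ∀ x y : {x : Option (Fin (e + 3)) × ℕ // x.2 = 0 ∨ (x.1 ∈ extremities (e + 3) A ∧ x.2 < k)},
      (f x = f y → x = y) ∧
      (G.Adj (f x) (f y) ↔ (attachPaths (pathWithCenter (e + 3) A) (extremities (e + 3) A) k).Adj
        x y) := by
    rintro ⟨⟨_ | i, j⟩, hx⟩ ⟨⟨_ | i', j'⟩, hy⟩
    · have hj := (hnone j).1 hx
      have hj' := (hnone j').1 hy
      simp only [f, attachPaths, SimpleGraph.fromRel_adj, ne_eq, Subtype.mk.injEq, Prod.mk.injEq,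
        true_and, SimpleGraph.irrefl, and_false, false_or, hl.adj j hj j' hj']
      exact ⟨fun h' => hl.inj _ hj _ hj' h', by omega⟩
    · have hj := (hnone j).1 hx
      have hy' := (hsome i' j').1 hy
      have hi' := i'.2
      have hlt : pos i' j' < e + 2 * k + 1 := by rw [hpos]; split <;> omega
      refine ⟨fun h' => absurd h'.symm (h.ne _ hlt _ hj), ?_⟩
      simp only [f, attachPaths, SimpleGraph.fromRel_adj, ne_eq, Subtype.mk.injEq, Prod.mk.injEq,
        reduceCtorEq, false_and, not_false_eq_true, true_and, or_false, hcross i' j' j hy' hj,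
        pathWithCenter_adj_none, (pathWithCenter (e + 3) A).adj_comm (some i') none]
      tauto
    · have hj' := (hnone j').1 hy
      have hx' := (hsome i j).1 hx
      have hi := i.2
      have hlt : pos i j < e + 2 * k + 1 := by rw [hpos]; split <;> omega
      refine ⟨fun h' => absurd h' (h.ne _ hlt _ hj'), ?_⟩
      rw [G.adj_comm]
      simp only [f, attachPaths, SimpleGraph.fromRel_adj, ne_eq, Subtype.mk.injEq, Prod.mk.injEq,
        reduceCtorEq, false_and, not_false_eq_true, true_and, or_false, hcross i j j' hx' hj',
        pathWithCenter_adj_none, (pathWithCenter (e + 3) A).adj_comm (some i) none]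
      tauto
    · have hx' := (hsome i j).1 hx
      have hy' := (hsome i' j').1 hy
      have hi := i.2
      have hi' := i'.2
      have hlt : pos i j < e + 2 * k + 1 := by rw [hpos]; split <;> omega
      have hlt' : pos i' j' < e + 2 * k + 1 := by rw [hpos]; split <;> omega
      simp only [f, attachPaths, SimpleGraph.fromRel_adj, ne_eq, Subtype.mk.injEq, Prod.mk.injEq,
        Option.some.injEq, Fin.ext_iff, hp.adj _ hlt _ hlt', pathWithCenter_adj_some]
      refine ⟨fun h' => ?_, ?_⟩
      · have h1 := hp.inj _ hlt _ hlt' h'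
        rw [hpos, hpos] at h1
        split at h1 <;> split at h1 <;> omega
      · rw [hpos, hpos]
        split <;> split <;> omega
  refine nonempty_induce_iso f (fun x y => (hmain x y).1) (fun v => ?_) fun x y => (hmain x y).2
  constructor
  · rintro (⟨i, hi, rfl⟩ | ⟨j, hj, rfl⟩)
    · by_cases h1 : i < k
      · refine ⟨⟨(some ⟨0, by omega⟩, k - 1 - i), (hsome _ _).2 (.inr ⟨.inl rfl, by omega⟩)⟩, ?_⟩
        simp only [f, hpos, if_true]
        congr 1
        omega
      · by_cases h2 : i < k + e + 1
        · refine ⟨⟨(some ⟨i - (k - 1), by omega⟩, 0), .inl rfl⟩, ?_⟩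
          simp only [f, hpos]
          rw [if_neg (by omega)]
          congr 1
          omega
        · refine ⟨⟨(some ⟨e + 2, by omega⟩, i - (k + e + 1)),
            (hsome _ _).2 (.inr ⟨.inr rfl, by omega⟩)⟩, ?_⟩
          simp only [f, hpos]
          rw [if_neg (by omega)]
          congr 1
          omega
    · exact ⟨⟨(none, j), (hnone j).2 hj⟩, rfl⟩
  · rintro ⟨⟨⟨_ | i, j⟩, hx⟩, rfl⟩
    · exact .inr ⟨j, (hnone j).1 hx, rfl⟩
    · have hx' := (hsome i j).1 hx
      have hi := i.2
      refine .inl ⟨pos i j, ?_, rfl⟩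
      rw [hpos]
      split <;> omega

end IsTripod

end

end PathEcc

namespace PathEcc

/-! ### Straight-line composition of the building blocks -/

/-- The memory `s` with the number `i` in register `10`. -/
def State.at (s : State) (i : ℕ) : State := { s with var := Function.update s.var 10 i }

theorem State.at_var_self (s : State) (i : ℕ) : (s.at i).var 10 = i := by simp [State.at]

theorem State.at_var {x : ℕ} (s : State) (i : ℕ) (hx : x ≠ 10) : (s.at i).var x = s.var x := by
  simp [State.at, Function.update_of_ne hx]

theorem State.at_arr (s : State) (i : ℕ) : (s.at i).arr = s.arr := rfl

/-- The arrays that an expression reads. -/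
def Expr.arrs : Expr → List ℕ
  | .const _ => []
  | .var _ => []
  | .read a i => a :: i.arrs
  | .succ e => e.arrs
  | .pred e => e.arrs

/-- The registers that an expression reads. -/
def Expr.vars : Expr → List ℕ
  | .const _ => []
  | .var x => [x]
  | .read _ i => i.vars
  | .succ e => e.vars
  | .pred e => e.vars

/-- The arrays that a test reads. -/
def Test.arrs : Test → List ℕ
  | .lt e f => e.arrs ++ f.arrs
  | .eq e f => e.arrs ++ f.arrs
  | .not b => b.arrs
  | .and b c => b.arrs ++ c.arrs

/-- The registers that a test reads. -/
def Test.vars : Test → List ℕ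
  | .lt e f => e.vars ++ f.vars
  | .eq e f => e.vars ++ f.vars
  | .not b => b.vars
  | .and b c => b.vars ++ c.vars

theorem Expr.eval_congr {s s' : State} (e : Expr) (hv : ∀ x ∈ e.vars, s.var x = s'.var x)
    (ha : ∀ A ∈ e.arrs, s.arr A = s'.arr A) : e.eval s = e.eval s' := by
  induction e with
  | const => rfl
  | var x => exact hv x (by simp [Expr.vars])
  | read a i ih =>
    simp only [Expr.eval]
    rw [ih hv fun A hA => ha A (List.mem_cons_of_mem _ hA), ha a (by simp [Expr.arrs])]
  | succ e ih => simp only [Expr.eval, ih hv ha]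
  | pred e ih => simp only [Expr.eval, ih hv ha]

theorem Test.holds_congr {s s' : State} (b : Test) (hv : ∀ x ∈ b.vars, s.var x = s'.var x)
    (ha : ∀ A ∈ b.arrs, s.arr A = s'.arr A) : b.holds s ↔ b.holds s' := by
  induction b with
  | lt e f =>
    simp only [Test.vars, Test.arrs, List.mem_append] at hv ha
    simp only [Test.holds]
    rw [e.eval_congr (fun x hx => hv x (.inl hx)) fun A hA => ha A (.inl hA),
      f.eval_congr (fun x hx => hv x (.inr hx)) fun A hA => ha A (.inr hA)]
  | eq e f =>
    simp only [Test.vars, Test.arrs, List.mem_append] at hv ha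
    simp only [Test.holds]
    rw [e.eval_congr (fun x hx => hv x (.inl hx)) fun A hA => ha A (.inl hA),
      f.eval_congr (fun x hx => hv x (.inr hx)) fun A hA => ha A (.inr hA)]
  | not b ih => simp only [Test.holds, ih hv ha]
  | and b c ihb ihc =>
    simp only [Test.vars, Test.arrs, List.mem_append] at hv ha
    simp only [Test.holds]
    rw [ihb (fun x hx => hv x (.inl hx)) fun A hA => ha A (.inl hA),
      ihc (fun x hx => hv x (.inr hx)) fun A hA => ha A (.inr hA)]

/-- Each building block takes at most so many steps. -/
def unit (n M : ℕ) : ℕ := 40 * (n + M + 1)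

/-- The input is in place, and array `22` marks all vertices. -/
structure Ready {n : ℕ} (G : SimpleGraph (Fin n)) (M k : ℕ) (s : State) : Prop where
  graph : HasGraph G M s
  k_eq : s.var 1 = k
  all : ∀ v : Fin n, s.arr 22 v = 1

/-- The memories differ at most in the registers `X` and the arrays `Y`. -/
structure Same (X Y : List ℕ) (s s' : State) : Prop where
  var : ∀ x, x ∉ X → s'.var x = s.var x
  arr : ∀ A, A ∉ Y → s'.arr A = s.arr A

namespace Ready

variable {n : ℕ} {G : SimpleGraph (Fin n)} {M k B : ℕ} {s s' : State} {Q : Program}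
  {post : State → Prop}

theorem of_same (h : Ready G M k s) {X Y : List ℕ} (hs : Same X Y s s')
    (hX : 0 ∉ X ∧ 1 ∉ X) (hY : 0 ∉ Y ∧ 1 ∉ Y ∧ 22 ∉ Y) : Ready G M k s' :=
  ⟨h.graph.of_eq (hs.var 0 hX.1) (hs.arr 0 hY.1) (hs.arr 1 hY.2.1),
    by rw [hs.var 1 hX.2]; exact h.k_eq, by rw [hs.arr 22 hY.2.2]; exact h.all⟩

theorem maskSet_all (h : Ready G M k s) : (maskSet s 22 : Set (Fin n)) = Set.univ :=
  Set.eq_univ_of_forall h.all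

/-- The rules `then_…` are in continuation form. Each building block is charged the flat price `unit
n M`, so that a bound for straight-line code amounts to counting blocks; the record `Same` carries
over all that a block does not touch. -/
theorem then_assign (h : Ready G M k s) {x : ℕ} {e : Expr} (he : e.cost ≤ 20)
    (hx : 0 ∉ [x] ∧ 1 ∉ [x])
    (hQ : ∀ s', Ready G M k s' → Same [x] [] s s' → s'.var x = e.eval s → Runs Q s' B post) :
    Runs (.seq (.assign x e) Q) s (unit n M + B) post := by
  refine (Runs.seq (B := e.cost + 1) (B' := B) (Runs.assign ?_)).mono ?_ fun _ h => h
  · have hs : Same [x] [] s { s with var := Function.update s.var x (e.eval s) } :=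
      ⟨fun y hy => Function.update_of_ne (by simpa using hy) _ _, fun _ _ => rfl⟩
    exact hQ _ (h.of_same hs hx (by decide)) hs (Function.update_self ..)
  · unfold unit
    omega

theorem then_write (h : Ready G M k s) {a : ℕ} {i e : Expr} (he : i.cost + e.cost ≤ 20)
    (ha : 0 ∉ [a] ∧ 1 ∉ [a] ∧ 22 ∉ [a])
    (hQ : ∀ s', Ready G M k s' → Same [] [a] s s' → s'.arr a (i.eval s) = e.eval s →
      (∀ j, j ≠ i.eval s → s'.arr a j = s.arr a j) → Runs Q s' B post) :
    Runs (.seq (.write a i e) Q) s (unit n M + B) post := by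
  refine (Runs.seq (B := i.cost + e.cost + 1) (B' := B) (Runs.write ?_)).mono ?_ fun _ h => h
  · have hs : Same [] [a] s ⟨s.var, Function.update s.arr a
          (Function.update (s.arr a) (i.eval s) (e.eval s))⟩ :=
      ⟨fun _ _ => rfl, fun y hy => Function.update_of_ne (by simpa using hy) _ _⟩
    refine hQ _ (h.of_same hs (by decide) ha) hs ?_ ?_
    · simp
    · intro j hj
      simp [Function.update_of_ne hj]
  · unfold unit
    omega

theorem then_mapMask (h : Ready G M k s) {dst : ℕ} {b : Test} (hb : b.cost ≤ 20)
    (hd : 0 ∉ [dst] ∧ 1 ∉ [dst] ∧ 22 ∉ [dst]) (hdb : dst ∉ b.arrs)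
    (hQ : ∀ s', Ready G M k s' → Same [10] [dst] s s' →
      (∀ v : Fin n, v ∈ (maskSet s' dst : Set (Fin n)) ↔ b.holds (s.at v)) → Runs Q s' B post) :
    Runs (.seq (mapMask dst b) Q) s (unit n M + B) post := by
  refine (Runs.seq (B := n * (b.cost + 9) + 5) (B' := B) ?_).mono ?_ fun _ h => h
  · refine (Runs.mapMask (fun i => b.holds (s.at i)) h.graph.n_eq ?_).frame.mono le_rfl ?_
    · intro i t _ h10 hv ha _
      refine b.holds_congr (fun x hx => ?_) fun A hA => ?_
      · by_cases h' : x = 10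
        · subst h'; rw [h10, State.at_var_self]
        · rw [hv x h', State.at_var _ _ h']
      · rw [ha A (by rintro rfl; exact hdb hA), State.at_arr]
    · rintro s' ⟨hp, hv, ha⟩
      have hs : Same [10] [dst] s s' :=
        ⟨fun x hx => hv x (by simpa [PathEcc.mapMask, forN, Program.vars] using hx),
          fun A hA => ha A (by simpa [PathEcc.mapMask, forN, Program.arrs] using hA)⟩
      exact hQ s' (h.of_same hs (by decide) hd) hs fun v => hp v v.2
  · unfold unit
    have : n * (b.cost + 9) ≤ n * 29 := Nat.mul_le_mul_left _ (by omega)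
    omega

theorem then_find (h : Ready G M k s) {x : ℕ} {b : Test} (hb : b.cost ≤ 20)
    (hx : 0 ∉ [10, x] ∧ 1 ∉ [10, x] ∧ x ≠ 10) (hxb : x ∉ b.vars)
    (hQ : ∀ s', Ready G M k s' → Same [10, x] [] s s' →
      ((∃ v : Fin n, s'.var x = v ∧ b.holds (s.at v)) ∨
        (s'.var x = n ∧ ∀ v : Fin n, ¬ b.holds (s.at v))) → Runs Q s' B post) :
    Runs (.seq (find x b) Q) s (unit n M + B) post := by
  refine (Runs.seq (B := n * (b.cost + 8) + 7) (B' := B) ?_).mono ?_ fun _ h => h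
  · refine (Runs.find (fun i => b.holds (s.at i)) h.graph.n_eq hx.2.2 ?_ ?_).frame.mono le_rfl ?_
    · rintro rfl; exact absurd hx.1 (by simp)
    · intro i t _ h10 hv ha
      refine b.holds_congr (fun y hy => ?_) fun A hA => ?_
      · by_cases h' : y = 10
        · subst h'; rw [h10, State.at_var_self]
        · rw [hv y h' (by rintro rfl; exact hxb hy), State.at_var _ _ h']
      · rw [ha, State.at_arr]
    · rintro s' ⟨hp, hv, ha⟩
      have hs : Same [10, x] [] s s' :=
        ⟨fun y hy => hv y (by
          simp only [List.mem_cons, List.not_mem_nil, or_false, not_or] at hy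
          simp [PathEcc.find, forN, Program.vars, hy]),
          fun A hA => ha A (by simp [PathEcc.find, forN, Program.arrs])⟩
      refine hQ s' (h.of_same hs ⟨hx.1, hx.2.1⟩ (by decide)) hs ?_
      rcases hp with ⟨h1, h2⟩ | ⟨h1, h2⟩
      · exact .inl ⟨⟨s'.var x, h1⟩, rfl, h2⟩
      · exact .inr ⟨h1, fun v => h2 v v.2⟩
  · unfold unit
    have : n * (b.cost + 8) ≤ n * 28 := Nat.mul_le_mul_left _ (by omega)
    omega

theorem then_copy (h : Ready G M k s) {dst src : ℕ} (hd : 0 ∉ [dst] ∧ 1 ∉ [dst] ∧ 22 ∉ [dst])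
    (hne : src ≠ dst)
    (hQ : ∀ s', Ready G M k s' → Same [10] [dst] s s' →
      (∀ i < n, s'.arr dst i = s.arr src i) → Runs Q s' B post) :
    Runs (.seq (copy dst src) Q) s (unit n M + B) post := by
  refine (Runs.seq (B := n * 10 + 5) (B' := B) ?_).mono ?_ fun _ h => h
  · refine (Runs.copy h.graph.n_eq hne).frame.mono le_rfl ?_
    rintro s' ⟨hp, hv, ha⟩
    have hs : Same [10] [dst] s s' :=
      ⟨fun x hx => hv x (by simpa [PathEcc.copy, forN, Program.vars] using hx),
        fun A hA => ha A (by simpa [PathEcc.copy, forN, Program.arrs] using hA)⟩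
    exact hQ s' (h.of_same hs (by decide) hd) hs hp
  · unfold unit
    omega

theorem then_argmax (h : Ready G M k s) {x A D : ℕ} (hx : 0 ∉ [10, x] ∧ 1 ∉ [10, x] ∧ x ≠ 10)
    {v₀ : Fin n} (hv₀ : s.var x = v₀) (hA : v₀ ∈ (maskSet s A : Set (Fin n)))
    (hQ : ∀ s', Ready G M k s' → Same [10, x] [] s s' → ∀ v : Fin n, s'.var x = v →
      v ∈ (maskSet s A : Set (Fin n)) →
      (∀ u ∈ (maskSet s A : Set (Fin n)), s.arr D u ≤ s.arr D v) → Runs Q s' B post) :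
    Runs (.seq (argmax x A D) Q) s (unit n M + B) post := by
  refine (Runs.seq (B := n * 18 + 5) (B' := B) ?_).mono ?_ fun _ h => h
  · refine (Runs.argmax h.graph.n_eq hx.2.2 ?_ (hv₀ ▸ v₀.2)
      (by rw [hv₀]; exact hA)).frame.mono le_rfl ?_
    · rintro rfl; exact absurd hx.1 (by simp)
    · rintro s' ⟨⟨h1, h2, h3⟩, hv, ha⟩
      have hs : Same [10, x] [] s s' :=
        ⟨fun y hy => hv y (by
          simp only [List.mem_cons, List.not_mem_nil, or_false, not_or] at hy
          simp [PathEcc.argmax, forN, Program.vars, hy]),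
          fun A hA => ha A (by simp [PathEcc.argmax, forN, Program.arrs])⟩
      exact hQ s' (h.of_same hs ⟨hx.1, hx.2.1⟩ (by decide)) hs ⟨_, h1⟩ rfl h2 fun u hu =>
        h3 u u.2 hu
  · unfold unit
    omega

theorem then_bfs (h : Ready G M k s) {S A D P : ℕ} (hne : [0, 1, 20, A, D, P].Nodup)
    (hS : S ≠ D ∧ S ≠ 20) (hY : 0 ∉ [20, D, P] ∧ 1 ∉ [20, D, P] ∧ 22 ∉ [20, D, P])
    (hQ : ∀ s', Ready G M k s' → Same [10, 11, 12, 13, 14, 15, 16] [20, D, P] s s' →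
      IsBfs G (maskSet s S) (maskSet s A) (fun v => s'.arr D v) →
      IsParent G (fun v => s'.arr D v) (s'.arr P) → Runs Q s' B post) :
    Runs (.seq (bfs S A D P) Q) s (unit n M + B) post := by
  refine Runs.seq ((Runs.bfs h.graph hne hS.1 hS.2).frame.mono le_rfl ?_)
  rintro s' ⟨⟨h1, h2⟩, hv, ha⟩
  have hs : Same [10, 11, 12, 13, 14, 15, 16] [20, D, P] s s' := by
    refine ⟨fun x hx => hv x ?_, fun A hA => ha A ?_⟩
    · rw [bfs_vars]
      simp only [List.mem_cons, List.not_mem_nil, or_false] at hx ⊢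
      tauto
    · rw [bfs_arrs]
      simp only [List.mem_cons, List.not_mem_nil, or_false] at hA ⊢
      tauto
  exact hQ s' (h.of_same hs (by decide) hY) hs h1 h2

/-- Forget the part of the bound that is not needed. -/
theorem _root_.PathEcc.Runs.le {P : Program} (h : Runs P s B post) {B' : ℕ} (hB : B ≤ B') :
    Runs P s B' post := h.mono hB fun _ h => h

theorem then_branch (_h : Ready G M k s) {b : Test} {P P' : Program} (hb : b.cost ≤ 20)
    (h1 : b.holds s → Runs P s B post) (h2 : ¬ b.holds s → Runs P' s B post) :
    Runs (.branch b P P') s (unit n M + B) post := by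
  refine (Runs.branch h1 h2).le ?_
  unfold unit
  omega

end Ready

/-! ### Following parents -/

/-- Append the vertex in register `17` to the list in array `A`, the length of which is in register
`r`, and mark it in `Mk`. -/
def push (A r Mk : ℕ) : Program :=
  .seq (.write A (.var r) (.var 17))
    (.seq (.assign r (.succ (.var r))) (.write Mk (.var 17) (.const 1)))

/-- Append the path of parents of the vertex in register `17`. -/
def walk (D P A r Mk : ℕ) : Program :=
  .seq (push A r Mk)
    (.loop (.not (.eq (.read D (.var 17)) (.const 1)))
      (.seq (.assign 17 (.read P (.var 17))) (push A r Mk)))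

theorem Runs.push {A r Mk : ℕ} (hA : A ≠ Mk) (hr : r ≠ 17) {s : State} :
    Runs (push A r Mk) s 9 fun s' =>
      s'.var = Function.update s.var r (s.var r + 1) ∧
      s'.arr A = Function.update (s.arr A) (s.var r) (s.var 17) ∧
      s'.arr Mk = Function.update (s.arr Mk) (s.var 17) 1 ∧
      ∀ B, B ≠ A → B ≠ Mk → s'.arr B = s.arr B := by
  refine Runs.seq (B := 3) (B' := 6) (Runs.write (Runs.seq (B := 3) (B' := 3)
    (Runs.assign (Runs.write ?_))))
  simp only [Expr.eval, Function.update_self, Function.update_of_ne hr.symm,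
    Function.update_of_ne hA.symm, Function.update_of_ne hA, true_and]
  intro B hBA hBM
  rw [Function.update_of_ne hBM, Function.update_of_ne hBA]

/-- The path of parents in a breadth-first labeling. -/
structure IsChain {n : ℕ} (G : SimpleGraph (Fin n)) (d : Fin n → ℕ) (m : ℕ) (w : ℕ → Fin n) :
    Prop where
  label : ∀ j < m, d (w j) = m - j
  adj : ∀ j, j + 1 < m → G.Adj (w j) (w (j + 1))

theorem IsChain.le_card {n : ℕ} {G : SimpleGraph (Fin n)} {d : Fin n → ℕ} {m : ℕ} {w : ℕ → Fin n}
    (h : IsChain G d m w) : m ≤ n := by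
  have : Function.Injective fun i : Fin m => w i := by
    intro i j hij
    have h1 := h.label i i.2
    have h2 := h.label j j.2
    simp only at hij
    rw [hij] at h1
    have := i.2
    have := j.2
    exact Fin.ext (by omega)
  simpa using Fintype.card_le_of_injective _ this

/-- The label of the vertex in register `17` falls by one per round until it is 1, so the walk
writes `d u` vertices and ends at a source. -/
theorem Runs.walk {n : ℕ} {G : SimpleGraph (Fin n)} {D P A r Mk : ℕ} {s : State}
    {d : Fin n → ℕ} (hd : ∀ v : Fin n, s.arr D v = d v) (hP : IsParent G d (s.arr P))
    (hne : A ≠ Mk ∧ D ≠ A ∧ D ≠ Mk ∧ P ≠ A ∧ P ≠ Mk) (hr : r ≠ 17)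
    {u : Fin n} (hu : s.var 17 = u) (hu0 : d u ≠ 0) :
    Runs (walk D P A r Mk) s (17 * n + 14) fun s' => ∃ w : ℕ → Fin n,
      w 0 = u ∧ IsChain G d (d u) w ∧ s'.var r = s.var r + d u ∧
      (∀ j < d u, s'.arr A (s.var r + j) = w j) ∧
      (∀ i < s.var r, s'.arr A i = s.arr A i) ∧
      ∀ v : Fin n, s'.arr Mk v = 1 ↔ s.arr Mk v = 1 ∨ ∃ j < d u, w j = v := by
  obtain ⟨hAM, hDA, hDM, hPA, hPM⟩ := hne
  set m := d u with hm
  -- The index `i` is the label of the current vertex; `m + 1 - i` vertices have been written.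
  set I : ℕ → State → Prop := fun i s' => 1 ≤ i ∧ i ≤ m ∧ s'.arr D = s.arr D ∧
    s'.arr P = s.arr P ∧ ∃ w : ℕ → Fin n,
      w 0 = u ∧ (∀ j < m + 1 - i, d (w j) = m - j) ∧
      (∀ j, j + 1 < m + 1 - i → G.Adj (w j) (w (j + 1))) ∧ s'.var 17 = w (m - i) ∧
      s'.var r = s.var r + (m + 1 - i) ∧
      (∀ j < m + 1 - i, s'.arr A (s.var r + j) = w j) ∧
      (∀ i < s.var r, s'.arr A i = s.arr A i) ∧
      ∀ v : Fin n, s'.arr Mk v = 1 ↔ s.arr Mk v = 1 ∨ ∃ j < m + 1 - i, w j = v with hI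
  have hfirst : Runs (PathEcc.push A r Mk) s 9 (I m) := by
    refine (Runs.push hAM hr).mono le_rfl ?_
    rintro s' ⟨hv, hA, hMk, ho⟩
    refine ⟨by omega, le_rfl, ho D hDA hDM, ho P hPA hPM, fun _ => u, rfl, ?_, ?_, ?_, ?_, ?_, ?_,
      ?_⟩
    · intro j hj
      have : j = 0 := by omega
      subst this
      simp [hm]
    · intro j hj
      omega
    · rw [hv, Function.update_of_ne hr.symm, hu]
    · rw [hv, Function.update_self]
      omega
    · intro j hj
      have : j = 0 := by omega
      subst this
      rw [hA, Nat.add_zero, Function.update_self, hu]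
    · intro i hi
      rw [hA, Function.update_of_ne (by omega)]
    · intro v
      rw [hMk, hu]
      by_cases hvu : u = v
      · subst hvu
        simp only [Function.update_self, and_true, true_iff]
        exact .inr ⟨0, by omega⟩
      · rw [Function.update_of_ne (fun h => hvu (Fin.ext h.symm))]
        simp [hvu]
  have hloop : ∀ s', I m s' → Runs (.loop (.not (.eq (.read D (.var 17)) (.const 1)))
      (.seq (.assign 17 (.read P (.var 17))) (PathEcc.push A r Mk))) s' (m * 17 + 5) (I 1) := by
    intro s' hs'
    refine (Runs.loop_uniform (B := 12) I ?_ hs').mono (by simp [Test.cost, Expr.cost]) ?_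
    · rintro i t ⟨hi1, him, htD, htP, w, hw0, hwd, hwa, h17, htr, htA, htA', htM⟩ hb
      simp only [Test.holds, Expr.eval, h17, htD, hd, hwd (m - i) (by omega)] at hb
      obtain ⟨x, hx, hxa, hxd⟩ := hP (w (m - i)) (by rw [hwd (m - i) (by omega)]; omega)
      rw [hwd (m - i) (by omega)] at hxd
      refine Runs.seq (B := 3) (B' := 9) (Runs.assign ?_)
      refine (Runs.push hAM hr).mono le_rfl ?_
      rintro t' ⟨hv, hA, hMk, ho⟩
      simp only [Expr.eval, h17, htP, hx, Function.update_self, Function.update_of_ne hr, htr]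
        at hv hA hMk ho
      have hwn : ∀ j, j < m + 1 - i → Function.update w (m + 1 - i) x j = w j := fun j hj =>
        Function.update_of_ne (by omega) _ _
      refine ⟨i - 1, by omega, by omega, by omega, (ho D hDA hDM).trans htD,
        (ho P hPA hPM).trans htP, Function.update w (m + 1 - i) x, ?_, ?_, ?_, ?_, ?_, ?_, ?_, ?_⟩
      · rw [hwn 0 (by omega), hw0]
      · intro j hj
        by_cases hj' : j = m + 1 - i
        · subst hj'
          rw [Function.update_self]
          omega
        · rw [hwn j (by omega)]
          exact hwd j (by omega)
      · intro j hj
        rw [hwn j (by omega)]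
        by_cases hj' : j + 1 = m + 1 - i
        · rw [hj', Function.update_self, show j = m - i by omega]
          exact hxa.symm
        · rw [hwn (j + 1) (by omega)]
          exact hwa j (by omega)
      · rw [hv, Function.update_of_ne hr.symm, Function.update_self,
          show m - (i - 1) = m + 1 - i by omega, Function.update_self]
      · rw [hv, Function.update_self]
        omega
      · intro j hj
        rw [hA]
        by_cases hj' : j = m + 1 - i
        · subst hj'
          rw [Function.update_self, Function.update_self]
        · rw [hwn j (by omega), Function.update_of_ne (by omega)]
          exact htA j (by omega)
      · intro j hj
        rw [hA, Function.update_of_ne (by omega)]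
        exact htA' j hj
      · intro v
        rw [hMk]
        by_cases hvx : x = v
        · subst hvx
          simp only [Function.update_self, true_iff]
          exact .inr ⟨m + 1 - i, by omega, Function.update_self ..⟩
        · rw [Function.update_of_ne (fun h => hvx (Fin.ext h.symm)), htM v]
          refine or_congr_right ⟨?_, ?_⟩
          · rintro ⟨j, hj, hjv⟩
            exact ⟨j, by omega, by rw [hwn j hj, hjv]⟩
          · rintro ⟨j, hj, hjv⟩
            by_cases hj' : j = m + 1 - i
            · subst hj'
              rw [Function.update_self] at hjv
              exact absurd hjv hvx
            · rw [hwn j (by omega)] at hjv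
              exact ⟨j, by omega, hjv⟩
    · rintro t ⟨⟨i, hi1, him, htD, htP, w, hw0, hwd, hwa, h17, hrest⟩, hb⟩
      have : i = 1 := by
        simp only [Test.holds, Expr.eval, h17, htD, hd, hwd (m - i) (by omega)] at hb
        omega
      subst this
      exact ⟨le_rfl, him, htD, htP, w, hw0, hwd, hwa, h17, hrest⟩
  have hrun : Runs (PathEcc.walk D P A r Mk) s (9 + (m * 17 + 5)) (I 1) :=
    Runs.seq (hfirst.mono le_rfl hloop)
  -- The running time depends on `m`. The bound `m ≤ n` comes from the completed chain, whose labels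
  -- are distinct.
  have hfin : Runs (PathEcc.walk D P A r Mk) s (9 + (m * 17 + 5)) (fun s' => I 1 s' ∧ m ≤ n) := by
    refine hrun.mono le_rfl fun s' hs' => ⟨hs', ?_⟩
    obtain ⟨_, _, _, _, w, hw0, hwd, hwa, _⟩ := hs'
    exact IsChain.le_card (G := G) (d := d) (w := w) ⟨hwd, hwa⟩
  obtain ⟨t, s', he, ht, hs', hmn⟩ := hfin
  refine ⟨t, s', he, by omega, ?_⟩
  obtain ⟨_, _, _, _, w, hw0, hwd, hwa, _, h1, h2, h3, h4⟩ := hs'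
  exact ⟨w, hw0, ⟨hwd, hwa⟩, h1, h2, h3, h4⟩

theorem Ready.then_walk {n : ℕ} {G : SimpleGraph (Fin n)} {M k B : ℕ} {s : State} {Q : Program}
    {post : State → Prop} (h : Ready G M k s) {D P A r Mk : ℕ}
    {d : Fin n → ℕ} (hd : ∀ v : Fin n, s.arr D v = d v) (hP : IsParent G d (s.arr P))
    (hne : A ≠ Mk ∧ D ≠ A ∧ D ≠ Mk ∧ P ≠ A ∧ P ≠ Mk) (hr : r ≠ 17 ∧ 0 ∉ [17, r] ∧ 1 ∉ [17, r])
    (hY : 0 ∉ [A, Mk] ∧ 1 ∉ [A, Mk] ∧ 22 ∉ [A, Mk])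
    {u : Fin n} (hu : s.var 17 = u) (hu0 : d u ≠ 0)
    (hQ : ∀ s', Ready G M k s' → Same [17, r] [A, Mk] s s' → ∀ w : ℕ → Fin n,
      w 0 = u → IsChain G d (d u) w → s'.var r = s.var r + d u →
      (∀ j < d u, s'.arr A (s.var r + j) = w j) →
      (∀ i < s.var r, s'.arr A i = s.arr A i) →
      (∀ v : Fin n, s'.arr Mk v = 1 ↔ s.arr Mk v = 1 ∨ ∃ j < d u, w j = v) → Runs Q s' B post) :
    Runs (.seq (walk D P A r Mk) Q) s (unit n M + B) post := by
  refine (Runs.seq (B := 17 * n + 14) (B' := B) ?_).le (by unfold unit; omega)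
  refine (Runs.walk hd hP hne hr.1 hu hu0).frame.mono le_rfl ?_
  rintro s' ⟨⟨w, h1, h2, h3, h4, h5, h6⟩, hv, ha⟩
  have hs : Same [17, r] [A, Mk] s s' := by
    refine ⟨fun x hx => hv x ?_, fun A hA => ha A ?_⟩
    · simp only [List.mem_cons, List.not_mem_nil, or_false, not_or] at hx
      simp [PathEcc.walk, PathEcc.push, Program.vars, hx]
    · simp only [List.mem_cons, List.not_mem_nil, or_false, not_or] at hA
      simp [PathEcc.walk, PathEcc.push, Program.arrs, hA]
  exact hQ s' (h.of_same hs hr.2 hY) hs w h1 h2 h3 h4 h5 h6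

end PathEcc

namespace PathEcc

/-! ### The program

Registers: `5` is the end `a` of the current path, `6` tells whether the search goes on, `40` is the
length of the list in array `5`. Arrays: `2` and `3` hold the current path as a list and as a mask,
`4` is the mask of the unvisited vertices, `5` ends with the path that leaves `a`, in reverse order,
and `9` is the mask of the unvisited neighbors of `a`. -/

/-- Cell `10` of array `D` holds `c`. -/
def labeled (D c : ℕ) : Test := .eq (.read D (.var 10)) (.const c)

/-- Registers `10` and `x` agree. -/
def isVar (x : ℕ) : Test := .eq (.var 10) (.var x)

/-- Cell `10` of array `D` holds more than `k`. -/
def exceeds (D : ℕ) : Test := .lt (.var 1) (.read D (.var 10))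

theorem labeled_holds {D c i : ℕ} {s : State} : (labeled D c).holds (s.at i) ↔ s.arr D i = c := by
  simp [labeled, Test.holds, Expr.eval, State.at]

theorem isVar_holds {x i : ℕ} {s : State} (hx : x ≠ 10) :
    (isVar x).holds (s.at i) ↔ i = s.var x := by
  simp [isVar, Test.holds, Expr.eval, State.at, Function.update_of_ne hx]

theorem exceeds_holds {D i : ℕ} {s : State} :
    (exceeds D).holds (s.at i) ↔ s.var 1 < s.arr D i := by
  simp [exceeds, Test.holds, Expr.eval, State.at]

theorem not_holds {b : Test} {s : State} : b.not.holds s ↔ ¬ b.holds s := Iff.rfl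

theorem and_holds {b c : Test} {s : State} : (b.and c).holds s ↔ b.holds s ∧ c.holds s := Iff.rfl

theorem maskSet_congr {n : ℕ} {s s' : State} {A : ℕ} (h : s'.arr A = s.arr A) :
    (maskSet s' A : Set (Fin n)) = maskSet s A := by
  simp only [maskSet, h]

/-- Go to the vertex in register `43`. -/
def moveProg : Program :=
  .seq (.write 2 (.var 3) (.var 43)) <|
  .seq (.assign 3 (.succ (.var 3))) <|
  .seq (.write 3 (.var 43) (.const 1)) <|
  .seq (.assign 5 (.var 43)) .skip

/-- Choose the next vertex, update the unvisited vertices, and go there if that is useful. -/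
def advanceProg : Program :=
  .seq (mapMask 7 (isVar 41)) <|
  .seq (bfs 7 4 28 25) <|
  .seq (find 43 (labeled 9 1)) <|
  .seq (argmax 43 9 28) <|
  .seq (mapMask 8 (.and (labeled 4 1) (.not (isVar 43)))) <|
  .seq (bfs 7 8 29 25) <|
  .seq (mapMask 30 (.and (.not (labeled 29 0)) (.not (isVar 43)))) <|
  .seq (copy 4 30) <|
  .seq (bfs 30 22 31 25) <|
  .seq (mapMask 7 (isVar 43)) <|
  .seq (bfs 7 22 32 33) <|
  -- Label `k` means distance `k - 1` from the vertex in register `43`; a label above `k` in array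
  -- `31` means far from the new unvisited set.
  .seq (find 44 (.and (.eq (.read 32 (.var 10)) (.var 1)) (exceeds 31))) <|
  .branch (.lt (.var 44) (.var 0))
    (.seq (.assign 17 (.var 44)) <|
      .seq (.assign 40 (.const 0)) <|
      .seq (walk 32 33 5 40 23) moveProg)
    (.seq (find 44 (.and (labeled 9 1) (labeled 30 1))) <|
      .branch (.lt (.var 44) (.var 0))
        .skip
        -- Because the leg is stored in reverse, a new first vertex is appended at the end. Only the
        -- last `k` entries matter.
        (.seq (.write 5 (.var 40) (.var 43)) <|
          .seq (.assign 40 (.succ (.var 40))) moveProg))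

/-- Output a path in the unvisited vertices and the path that leaves `a`. -/
def obstructProg : Program :=
  .seq (mapMask 7 (isVar 42)) <|
  .seq (bfs 7 4 24 25) <|
  .seq (.assign 17 (.var 41)) <|
  .seq (.assign 18 (.const 0)) <|
  .seq (walk 24 25 21 18 23) <|
  .seq (.assign 33 (.const 0)) <|
  -- No vertex before position `k` is in the mask. Registers `33` and `34` advance together, which
  -- yields the position minus `k` without a subtraction.
  .seq (.assign 34 (.var 1)) <|
  .seq (.loop (.not (.eq (.read 9 (.read 21 (.var 34))) (.const 1)))
    (.seq (.assign 33 (.succ (.var 33))) (.assign 34 (.succ (.var 34))))) <|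
  .seq (.assign 35 (.pred (.var 18))) <|
  .seq (.loop (.not (.eq (.read 9 (.read 21 (.var 35))) (.const 1)))
    (.assign 35 (.pred (.var 35)))) <|
  .seq (.assign 36 (.const 0)) <|
  .seq (.loop (.lt (.var 36) (.var 1))
    (.seq (.assign 35 (.succ (.var 35))) (.assign 36 (.succ (.var 36))))) <|
  .seq (.assign 3 (.const 0)) <|
  .seq (.loop (.not (.lt (.var 35) (.var 33)))
    (.seq (.write 2 (.var 3) (.read 21 (.var 33)))
      (.seq (.assign 3 (.succ (.var 3))) (.assign 33 (.succ (.var 33)))))) <|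
  .seq (.assign 36 (.const 0)) <|
  .seq (.loop (.lt (.var 36) (.var 1))
    (.seq (.assign 40 (.pred (.var 40)))
      (.seq (.write 2 (.var 3) (.read 5 (.var 40)))
        (.seq (.assign 3 (.succ (.var 3))) (.assign 36 (.succ (.var 36))))))) <|
  .seq (.assign 2 (.const 1)) <|
  .seq (.assign 6 (.const 0)) .skip

/-- One round of the search. -/
def roundProg : Program :=
  .seq (bfs 3 22 24 25) <|
  .seq (find 41 (exceeds 24)) <|
  .branch (.eq (.var 41) (.var 0))
    (.seq (.assign 6 (.const 0)) .skip)
    (.seq (mapMask 7 (isVar 5)) <|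
      .seq (bfs 7 22 24 25) <|
      .seq (mapMask 9 (.and (labeled 4 1) (labeled 24 2))) <|
      .seq (bfs 9 4 26 25) <|
      .seq (find 41 (labeled 9 1)) <|
      .seq (find 44 (.and (labeled 4 1) (exceeds 26))) <|
      .seq (.branch (.lt (.var 44) (.var 0)) (.assign 41 (.var 44)) .skip) <|
      .seq (mapMask 7 (isVar 41)) <|
      .seq (mapMask 8 (.and (labeled 4 1) (.not (labeled 9 1)))) <|
      .seq (bfs 7 8 27 25) <|
      .seq (find 42 (.and (.and (labeled 4 1) (exceeds 26)) (labeled 27 0))) <|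
      .branch (.lt (.var 42) (.var 0)) obstructProg advanceProg)

/-- Add the vertex in register `43` to the connected set in array `6` if it has a neighbor there and
if the set still does not cover the graph then; in this case, go back to the first vertex. -/
def growStep : Program :=
  .seq (.assign 44 (.var 0)) <|
  .seq (bfs 6 22 24 25) <|
  .seq (.branch (.eq (.read 24 (.var 43)) (.const 2))
    (.seq (mapMask 7 (.not (.and (.not (labeled 6 1)) (.not (isVar 43))))) <|
      .seq (bfs 7 22 24 25) <|
      .seq (find 44 (exceeds 24)) .skip)
    .skip) <|
  .branch (.lt (.var 44) (.var 0))
    (.seq (.write 6 (.var 43) (.const 1)) <|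
      .seq (.assign 43 (.const 0)) .skip)
    (.seq (.assign 43 (.succ (.var 43))) .skip)

/-- Grow the connected set in array `6` as long as it does not cover the graph. -/
def growProg : Program :=
  .seq (.assign 43 (.const 0)) <|
  .seq (.loop (.lt (.var 43) (.var 0)) growStep) .skip

/-- Set up the search. -/
def startProg : Program :=
  .seq (bfs 6 22 24 25) <|
  .seq (find 41 (exceeds 24)) <|
  .seq (find 5 (labeled 24 2)) <|
  .seq (mapMask 7 (isVar 5)) <|
  .seq (bfs 7 22 32 33) <|
  -- The test compares register `10` with itself, so this clears the mask.
  .seq (mapMask 3 (.not (isVar 10))) <|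
  .seq (.assign 3 (.const 0)) <|
  .seq (.assign 17 (.var 41)) <|
  .seq (walk 32 33 2 3 3) <|
  .seq (copy 5 2) <|
  .seq (.assign 40 (.var 3)) <|
  .seq (mapMask 7 (.and (labeled 3 1) (.not (isVar 5)))) <|
  .seq (bfs 7 22 24 25) <|
  .seq (mapMask 8 (.and (.not (labeled 24 1)) (.and (.not (labeled 24 2)) (.not (isVar 5))))) <|
  .seq (bfs 6 8 29 25) <|
  .seq (mapMask 4 (.not (labeled 29 0))) <|
  .seq (.assign 6 (.const 1)) .skip

/-- The whole program. -/
def mainProg : Program :=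
  .seq (mapMask 22 (.eq (.var 10) (.var 10))) <|
  .seq (mapMask 6 (.eq (.var 10) (.const 0))) <|
  .seq (bfs 6 22 24 25) <|
  .seq (find 41 (exceeds 24)) <|
  .branch (.eq (.var 41) (.var 0))
    (.seq (.write 2 (.const 0) (.const 0)) <|
      .seq (.assign 3 (.const 1)) .skip)
    (.seq growProg <| .seq startProg <| .loop (.eq (.var 6) (.const 1)) roundProg)

/-! ### The state of the search -/

/-- The list `l` is stored in array `2` and register `3`, and register `2` holds the flag `0`. -/
structure Stored {n : ℕ} (s : State) (l : List (Fin n)) : Prop where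
  flag : s.var 2 = 0
  len : s.var 3 = l.length
  get : ∀ (i : ℕ) (h : i < l.length), s.arr 2 i = (l[i] : ℕ)

/-- The list `q` is the current path, with end `a`, and `leg` is the path that leaves `a`. -/
structure Current {n : ℕ} (G : SimpleGraph (Fin n)) (k : ℕ) (s : State) (q : List (Fin n))
    (a : Fin n) (leg : ℕ → Fin n) : Prop where
  stored : Stored s q
  chain : q.IsChain G.Adj
  nodup : q.Nodup
  last : q.getLast? = some a
  mask : (maskSet s 3 : Set (Fin n)) = {v | v ∈ q}
  end_eq : s.var 5 = a
  leg_len : k ≤ s.var 40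
  leg_eq : ∀ i < k, s.arr 5 (s.var 40 - 1 - i) = leg i

/-- The search goes on. -/
def Searching {n : ℕ} (G : SimpleGraph (Fin n)) (k : ℕ) (s : State) : Prop :=
  ∃ q a leg, Current G k s q a leg ∧ (Inv G k {v | v ∈ q} (maskSet s 4) a leg ∨
    ∀ x, ¬ Far G k {v | v ∈ q} x)

section

variable {n : ℕ} {G : SimpleGraph (Fin n)} {M k : ℕ} {s : State}

/-- Only the path and its end are updated here; the leg of the new end has to be in array `5`
already. -/
theorem Runs.moveProg (hs : Ready G M k s) {q : List (Fin n)} {a v : Fin n} {leg : ℕ → Fin n}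
    (hq : Stored s q) (hc : q.IsChain G.Adj) (hnd : q.Nodup) (hl : q.getLast? = some a)
    (hm : (maskSet s 3 : Set (Fin n)) = {v | v ∈ q}) (hv : s.var 43 = v) (hav : G.Adj a v)
    (hvq : v ∉ q) (hk : k ≤ s.var 40) (hleg : ∀ i < k, s.arr 5 (s.var 40 - 1 - i) = leg i) :
    Runs moveProg s (4 * unit n M + 1) fun s' => Ready G M k s' ∧ s'.var 6 = s.var 6 ∧
      s'.arr 4 = s.arr 4 ∧ Current G k s' (q ++ [v]) v leg := by
  refine (hs.then_write (B := 3 * unit n M + 1) (by decide) (by decide)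
    fun s₁ r₁ f₁ h₁ h₁' => ?_).le (by omega)
  refine (r₁.then_assign (B := 2 * unit n M + 1) (by decide) (by decide)
    fun s₂ r₂ f₂ h₂ => ?_).le (by omega)
  refine (r₂.then_write (B := unit n M + 1) (by decide) (by decide)
    fun s₃ r₃ f₃ h₃ h₃' => ?_).le (by omega)
  refine r₃.then_assign (by decide) (by decide) fun s₄ r₄ f₄ h₄ => Runs.skip ⟨r₄, ?_, ?_, ?_⟩
  · simp (disch := decide) only [f₄.var, f₃.var, f₂.var, f₁.var]
  · simp (disch := decide) only [f₄.arr, f₃.arr, f₂.arr, f₁.arr]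
  simp (disch := decide) only [Expr.eval, f₃.var, f₂.var, f₁.var, f₂.arr, f₁.arr, hv,
    hq.len] at h₁ h₁' h₂ h₃ h₃' h₄
  refine ⟨⟨?_, ?_, ?_⟩, ?_, ?_, ?_, ?_, h₄, ?_, ?_⟩
  · simp (disch := decide) only [f₄.var, f₃.var, f₂.var, f₁.var, hq.flag]
  · simp (disch := decide) only [f₄.var, f₃.var, h₂, List.length_append, List.length_singleton]
  · intro i hi
    simp (disch := decide) only [f₄.arr, f₃.arr, f₂.arr]
    rw [List.length_append, List.length_singleton] at hi
    by_cases h : i < q.length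
    · rw [h₁' i (by omega), hq.get i h, List.getElem_append_left h]
    · have : i = q.length := by omega
      subst this
      rw [h₁]
      simp
  · rw [List.isChain_append]
    refine ⟨hc, by simp, ?_⟩
    intro x hx y hy
    rw [hl] at hx
    simp only [Option.mem_def, Option.some.injEq, List.head?_cons] at hx hy
    rw [← hx, ← hy]
    exact hav
  · rw [List.nodup_append]
    refine ⟨hnd, by simp, ?_⟩
    intro x hx y hy hxy
    simp only [List.mem_singleton] at hy
    exact hvq (hy ▸ hxy ▸ hx)
  · simp
  · ext x
    have hmx : s.arr 3 x = 1 ↔ x ∈ q := by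
      rw [← mem_maskSet, hm]; rfl
    simp only [mem_maskSet, List.mem_append, List.mem_singleton, Set.mem_ofPred_eq]
    simp (disch := decide) only [f₄.arr]
    by_cases hx : x = v
    · subst hx
      simp [h₃]
    · rw [h₃' x (fun h => hx (Fin.ext h)), hmx]
      simp [hx]
  · simpa (disch := decide) only [f₄.var, f₃.var, f₂.var, f₁.var] using hk
  · simpa (disch := decide) only [f₄.var, f₃.var, f₂.var, f₁.var, f₄.arr, f₃.arr, f₂.arr, f₁.arr]
      using hleg

/-- The computed labels form a `Round`, and the outcomes of the two searches for register `44`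
select `Round.inv_newLeg`, `Round.inv_delete` or `Round.inv_shift`. -/
theorem Runs.advanceProg (hG : G.Connected) (hk : 1 ≤ k) (hs : Ready G M k s) {q : List (Fin n)}
    {a w₀ : Fin n} {leg : ℕ → Fin n} (hc : Current G k s q a leg)
    (hinv : Inv G k {v | v ∈ q} (maskSet s 4) a leg)
    (hN : ∀ x : Fin n, x ∈ (maskSet s 9 : Set (Fin n)) ↔
      x ∈ (maskSet s 4 : Set (Fin n)) ∧ G.Adj a x)
    (hF : IsBfs G (maskSet s 9) (maskSet s 4) (fun v => s.arr 26 v)) (hw₀ : s.var 41 = w₀)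
    (hpick : (w₀ ∈ (maskSet s 4 : Set (Fin n)) ∧ k < s.arr 26 w₀) ∨
      (w₀ ∈ (maskSet s 9 : Set (Fin n)) ∧ ∀ x ∈ (maskSet s 4 : Set (Fin n)), s.arr 26 x ≤ k))
    (hW : IsBfs G {w₀} (maskSet s 4 \ maskSet s 9) (fun v => s.arr 27 v))
    (hdeep : ∀ y ∈ (maskSet s 4 : Set (Fin n)), k < s.arr 26 y → s.arr 27 y ≠ 0) :
    Runs advanceProg s (25 * unit n M) fun s' => Ready G M k s' ∧ s'.var 6 = s.var 6 ∧
      Searching G k s' ∧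
      (maskSet s' 4 : Set (Fin n)).ncard < (maskSet s 4 : Set (Fin n)).ncard := by
  have hu : 1 ≤ unit n M := by unfold unit; omega
  refine (hs.then_mapMask (B := 24 * unit n M) (by decide) (by decide) (by decide)
    fun s₁ r₁ f₁ h₁ => ?_).le (by omega)
  refine (r₁.then_bfs (B := 23 * unit n M) (by decide) (by decide) (by decide)
    fun s₂ r₂ f₂ h₂ _ => ?_).le (by omega)
  refine (r₂.then_find (B := 22 * unit n M) (by decide) (by decide) (by decide)
    fun s₃ r₃ f₃ h₃ => ?_).le (by omega)
  -- The maximization needs a member of the mask to start from; there is one because `a` has a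
  -- neighbor in the unvisited set.
  obtain ⟨v₀, hv₀, hv₀N⟩ : ∃ v₀ : Fin n, s₃.var 43 = v₀ ∧ v₀ ∈ (maskSet s₃ 9 : Set (Fin n)) := by
    simp (disch := decide) only [labeled_holds, f₂.arr, f₁.arr] at h₃
    rcases h₃ with ⟨v, hv, h⟩ | ⟨-, h⟩
    · refine ⟨v, hv, ?_⟩
      simpa (disch := decide) only [mem_maskSet, f₃.arr, f₂.arr, f₁.arr] using h
    · obtain ⟨u, hu, hau⟩ := hinv.nbr
      exact absurd ((hN u).2 ⟨hu, hau⟩) (h u)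
  refine (r₃.then_argmax (B := 21 * unit n M) (D := 28) (by decide) hv₀ hv₀N
    fun s₄ r₄ f₄ v hv hvN hvmax => ?_).le (by omega)
  refine (r₄.then_mapMask (B := 20 * unit n M) (by decide) (by decide) (by decide)
    fun s₅ r₅ f₅ h₅ => ?_).le (by omega)
  refine (r₅.then_bfs (B := 19 * unit n M) (by decide) (by decide) (by decide)
    fun s₆ r₆ f₆ h₆ _ => ?_).le (by omega)
  refine (r₆.then_mapMask (B := 18 * unit n M) (by decide) (by decide) (by decide)
    fun s₇ r₇ f₇ h₇ => ?_).le (by omega)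
  refine (r₇.then_copy (B := 17 * unit n M) (by decide) (by decide)
    fun s₈ r₈ f₈ h₈ => ?_).le (by omega)
  refine (r₈.then_bfs (B := 16 * unit n M) (by decide) (by decide) (by decide)
    fun s₉ r₉ f₉ h₉ _ => ?_).le (by omega)
  refine (r₉.then_mapMask (B := 15 * unit n M) (by decide) (by decide) (by decide)
    fun s₁₀ r₁₀ f₁₀ h₁₀ => ?_).le (by omega)
  refine (r₁₀.then_bfs (B := 14 * unit n M) (by decide) (by decide) (by decide)
    fun s₁₁ r₁₁ f₁₁ h₁₁ hpar => ?_).le (by omega)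
  refine (r₁₁.then_find (B := 13 * unit n M) (by decide) (by decide) (by decide)
    fun s₁₂ r₁₂ f₁₂ h₁₂ => ?_).le (by omega)
  have hv4 : s₄.var 43 = v := hv
  have e7 : (maskSet s₁ 7 : Set (Fin n)) = {w₀} := by
    ext x
    rw [h₁, isVar_holds (by decide), hw₀, Set.mem_singleton_iff, Fin.ext_iff]
  have e7' : (maskSet s₅ 7 : Set (Fin n)) = {w₀} := by
    rw [← e7]
    refine maskSet_congr ?_
    simp (disch := decide) only [f₅.arr, f₄.arr, f₃.arr, f₂.arr]
  have e4 : (maskSet s₁ 4 : Set (Fin n)) = maskSet s 4 := maskSet_congr (f₁.arr 4 (by decide))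
  have e8 : (maskSet s₅ 8 : Set (Fin n)) = maskSet s 4 \ {v} := by
    ext x
    rw [h₅, and_holds, not_holds, labeled_holds, isVar_holds (by decide), hv4, Set.mem_sdiff,
      Set.mem_singleton_iff, Fin.ext_iff, mem_maskSet]
    simp (disch := decide) only [f₄.arr, f₃.arr, f₂.arr, f₁.arr]
  have e9 : (maskSet s₃ 9 : Set (Fin n)) = maskSet s 9 := by
    refine maskSet_congr ?_
    simp (disch := decide) only [f₃.arr, f₂.arr, f₁.arr]
  rw [e9] at hvN hvmax
  have eH : ∀ x, s₃.arr 28 x = s₂.arr 28 x := fun x => by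
    simp (disch := decide) only [f₃.arr]
  simp only [eH] at hvmax
  rw [e7, e4] at h₂
  rw [e7', e8] at h₆
  have hR : Round G k {v | v ∈ q} (maskSet s 4) a leg (maskSet s 9) w₀ v (fun v => s.arr 26 v)
      (fun v => s.arr 27 v) (fun v => s₂.arr 28 v) (fun v => s₆.arr 29 v) :=
    ⟨hG, hinv, hN, hF, hpick, hW, hdeep, h₂, hvN, hvmax, h₆⟩
  have hv6 : s₆.var 43 = v := by
    rw [← hv4]
    simp (disch := decide) only [f₆.var, f₅.var]
  set next : Set (Fin n) := Round.next (fun v : Fin n => s₆.arr 29 v) v with hnext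
  have e30 : (maskSet s₇ 30 : Set (Fin n)) = next := by
    ext x
    rw [h₇, and_holds, not_holds, not_holds, labeled_holds, isVar_holds (by decide), hv6,
      ← Fin.ext_iff]
    rfl
  have e4' : (maskSet s₈ 4 : Set (Fin n)) = next := by
    rw [← e30]
    ext x
    rw [mem_maskSet, mem_maskSet, h₈ x x.2]
  have e30' : (maskSet s₈ 30 : Set (Fin n)) = next := by
    rw [← e30]
    exact maskSet_congr (f₈.arr 30 (by decide))
  rw [e30', r₈.maskSet_all] at h₉
  have hv9 : s₉.var 43 = v := by
    rw [← hv6]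
    simp (disch := decide) only [f₉.var, f₈.var, f₇.var]
  have e7'' : (maskSet s₁₀ 7 : Set (Fin n)) = {v} := by
    ext x
    rw [h₁₀, isVar_holds (by decide), hv9, Set.mem_singleton_iff, Fin.ext_iff]
  rw [e7'', r₁₀.maskSet_all] at h₁₁
  have hdist : ∀ x : Fin n, s₁₁.arr 32 x = G.dist v x + 1 := fun x => h₁₁.eq_dist hG rfl x
  have hvq : v ∉ q := hinv.disj v hR.v_mem
  have hins : {x | x ∈ q ++ [v]} = insert v {x | x ∈ q} := by
    ext x
    simp [or_comm]
  have hst : Stored s₁₂ q := by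
    refine ⟨?_, ?_, fun i hi => ?_⟩
    · rw [← hc.stored.flag]
      simp (disch := decide) only [f₁₂.var, f₁₁.var, f₁₀.var, f₉.var, f₈.var, f₇.var, f₆.var,
        f₅.var, f₄.var, f₃.var, f₂.var, f₁.var]
    · rw [← hc.stored.len]
      simp (disch := decide) only [f₁₂.var, f₁₁.var, f₁₀.var, f₉.var, f₈.var, f₇.var, f₆.var,
        f₅.var, f₄.var, f₃.var, f₂.var, f₁.var]
    · rw [← hc.stored.get i hi]
      simp (disch := decide) only [f₁₂.arr, f₁₁.arr, f₁₀.arr, f₉.arr, f₈.arr, f₇.arr, f₆.arr,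
        f₅.arr, f₄.arr, f₃.arr, f₂.arr, f₁.arr]
  have hm : (maskSet s₁₂ 3 : Set (Fin n)) = {v | v ∈ q} := by
    rw [← hc.mask]
    refine maskSet_congr ?_
    simp (disch := decide) only [f₁₂.arr, f₁₁.arr, f₁₀.arr, f₉.arr, f₈.arr, f₇.arr, f₆.arr,
      f₅.arr, f₄.arr, f₃.arr, f₂.arr, f₁.arr]
  have h12_6 : s₁₂.var 6 = s.var 6 := by
    simp (disch := decide) only [f₁₂.var, f₁₁.var, f₁₀.var, f₉.var, f₈.var, f₇.var, f₆.var,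
      f₅.var, f₄.var, f₃.var, f₂.var, f₁.var]
  have h12_40 : s₁₂.var 40 = s.var 40 := by
    simp (disch := decide) only [f₁₂.var, f₁₁.var, f₁₀.var, f₉.var, f₈.var, f₇.var, f₆.var,
      f₅.var, f₄.var, f₃.var, f₂.var, f₁.var]
  have h12_5 : s₁₂.var 5 = s.var 5 := by
    simp (disch := decide) only [f₁₂.var, f₁₁.var, f₁₀.var, f₉.var, f₈.var, f₇.var, f₆.var,
      f₅.var, f₄.var, f₃.var, f₂.var, f₁.var]
  have h12_a5 : s₁₂.arr 5 = s.arr 5 := by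
    simp (disch := decide) only [f₁₂.arr, f₁₁.arr, f₁₀.arr, f₉.arr, f₈.arr, f₇.arr, f₆.arr,
      f₅.arr, f₄.arr, f₃.arr, f₂.arr, f₁.arr]
  have h12_v : s₁₂.var 43 = v := by
    rw [← hv9]
    simp (disch := decide) only [f₁₂.var, f₁₁.var, f₁₀.var]
  have h12_4 : (maskSet s₁₂ 4 : Set (Fin n)) = next := by
    rw [← e4']
    refine maskSet_congr ?_
    simp (disch := decide) only [f₁₂.arr, f₁₁.arr, f₁₀.arr, f₉.arr]
  have h12_32 : s₁₂.arr 32 = s₁₁.arr 32 := f₁₂.arr 32 (by decide)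
  have h12_33 : s₁₂.arr 33 = s₁₁.arr 33 := f₁₂.arr 33 (by decide)
  have hcard : next.ncard < (maskSet s 4 : Set (Fin n)).ncard := hR.card_next_lt
  have h11_31 : s₁₁.arr 31 = s₉.arr 31 := by
    simp (disch := decide) only [f₁₁.arr, f₁₀.arr]
  -- Stated as `dist + 1 = k` rather than with `k - 1`, this is literally the comparison of a label
  -- with register `1`.
  have hh12 : ∀ x : Fin n, ((Test.eq (.read 32 (.var 10)) (.var 1)).and (exceeds 31)).holds
      (s₁₁.at x) ↔ G.dist v x + 1 = k ∧ k < s₉.arr 31 x := by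
    intro x
    rw [and_holds, exceeds_holds, h11_31, r₁₁.k_eq, ← hdist x, ← r₁₁.k_eq]
    simp [Test.holds, Expr.eval, State.at]
  simp only [hh12] at h₁₂
  refine (r₁₂.then_branch (B := 12 * unit n M) (by decide) (fun hb => ?_) fun hb => ?_).le
    (by omega)
  · simp only [Test.holds, Expr.eval] at hb
    rw [r₁₂.graph.n_eq] at hb
    obtain ⟨y, hy, hvy, hy31⟩ : ∃ y : Fin n, s₁₂.var 44 = y ∧ G.dist v y + 1 = k ∧
        k < s₉.arr 31 y := by
      rcases h₁₂ with h | ⟨h, -⟩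
      · exact h
      · omega
    refine (r₁₂.then_assign (B := 11 * unit n M) (by decide) (by decide)
      fun s₁₃ r₁₃ f₁₃ h₁₃ => ?_).le (by omega)
    refine (r₁₃.then_assign (B := 10 * unit n M) (by decide) (by decide)
      fun s₁₄ r₁₄ f₁₄ h₁₄ => ?_).le (by omega)
    have hlab : ∀ x : Fin n, s₁₄.arr 32 x = G.dist v x + 1 := fun x => by
      rw [← hdist, ← h12_32]
      simp (disch := decide) only [f₁₄.arr, f₁₃.arr]
    refine (r₁₄.then_walk (B := 9 * unit n M) (d := fun x => G.dist v x + 1) hlab ?_ (by decide)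
      (by decide) (by decide) (u := y) ?_ (by simp)
      fun s₁₅ r₁₅ f₁₅ w hw0 hch hlen hget _ _ => ?_).le (by omega)
    · have h1 : s₁₄.arr 33 = s₁₁.arr 33 := by
        rw [← h12_33]
        simp (disch := decide) only [f₁₄.arr, f₁₃.arr]
      rw [h1]
      simpa only [hdist] using hpar
    · rw [f₁₄.var 17 (by decide), h₁₃]
      exact hy
    simp only [Expr.eval] at h₁₄
    rw [h₁₄, Nat.zero_add, hvy] at hlen
    simp only [h₁₄, Nat.zero_add, hvy] at hget hch
    refine (Runs.moveProg r₁₅ (q := q) (a := a) (v := v) (leg := fun i => w (k - 1 - i))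
      ?_ hc.chain hc.nodup hc.last ?_ ?_ hR.adj_v hvq ?_ ?_).mono (by omega) ?_
    · refine ⟨?_, ?_, fun i hi => ?_⟩
      · rw [← hst.flag]
        simp (disch := decide) only [f₁₅.var, f₁₄.var, f₁₃.var]
      · rw [← hst.len]
        simp (disch := decide) only [f₁₅.var, f₁₄.var, f₁₃.var]
      · rw [← hst.get i hi]
        simp (disch := decide) only [f₁₅.arr, f₁₄.arr, f₁₃.arr]
    · rw [← hm]
      refine maskSet_congr ?_
      simp (disch := decide) only [f₁₅.arr, f₁₄.arr, f₁₃.arr]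
    · rw [← h12_v]
      simp (disch := decide) only [f₁₅.var, f₁₄.var, f₁₃.var]
    · rw [hlen]
    · intro i hi
      rw [hlen]
      exact hget _ (by omega)
    · rintro s' ⟨hr', h6', h4', hcur⟩
      have h4'' : (maskSet s' 4 : Set (Fin n)) = next := by
        rw [← h12_4, maskSet_congr h4']
        refine maskSet_congr ?_
        simp (disch := decide) only [f₁₅.arr, f₁₄.arr, f₁₃.arr]
      refine ⟨hr', ?_, ⟨q ++ [v], v, _, hcur, ?_⟩, ?_⟩
      · rw [h6', ← h12_6]
        simp (disch := decide) only [f₁₅.var, f₁₄.var, f₁₃.var]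
      · rw [hins, h4'']
        -- If `w₀ = v`, the invariant need not survive, but the extended path covers the graph and
        -- the next round stops.
        by_cases hw : w₀ = v
        · exact .inr (hR.not_far_of_eq hw hk)
        · refine .inl (hR.inv_newLeg hk hw (y := y) ?_ ?_ ?_ ?_ ?_)
          · obtain ⟨u, hu, -⟩ := hR.nbr_next hw
            exact (h₉.far_iff hG ⟨u, hu⟩).2 hy31
          · have h1 := hch.label (k - 1) (by omega)
            have h2 : G.dist v (w (k - 1)) = 0 := by omega
            exact (hG.dist_eq_zero_iff.1 h2).symm
          · simpa using hw0
          · intro i hi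
            have h1 := hch.label (k - 1 - i) (by omega)
            omega
          · intro i hi
            have h1 := hch.adj (k - 1 - (i + 1)) (by omega)
            rw [show k - 1 - (i + 1) + 1 = k - 1 - i by omega] at h1
            exact h1.symm
      · rw [h4'']
        exact hcard
  · simp only [Test.holds, Expr.eval] at hb
    rw [r₁₂.graph.n_eq] at hb
    have hno : ∀ y : Fin n, G.dist v y + 1 = k → ¬ k < s₉.arr 31 y := by
      rcases h₁₂ with ⟨y, hy, -⟩ | ⟨-, h⟩
      · exact absurd (hy ▸ y.2) hb
      · exact fun y h1 h2 => h y ⟨h1, h2⟩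
    refine (r₁₂.then_find (B := 11 * unit n M) (by decide) (by decide) (by decide)
      fun s₁₃ r₁₃ f₁₃ h₁₃ => ?_).le (by omega)
    have hh13 : ∀ x : Fin n, ((labeled 9 1).and (labeled 30 1)).holds (s₁₂.at x) ↔
        x ∈ (maskSet s 9 : Set (Fin n)) ∧ x ∈ next := by
      intro x
      rw [and_holds, labeled_holds, labeled_holds, ← e30, mem_maskSet, mem_maskSet]
      simp (disch := decide) only [f₁₂.arr, f₁₁.arr, f₁₀.arr, f₉.arr, f₈.arr, f₇.arr, f₆.arr,
        f₅.arr, f₄.arr, f₃.arr, f₂.arr, f₁.arr]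
    simp only [hh13] at h₁₃
    refine (r₁₃.then_branch (B := 10 * unit n M) (by decide) (fun hb' => ?_) fun hb' => ?_).le
      (by omega)
    · simp only [Test.holds, Expr.eval] at hb'
      rw [r₁₃.graph.n_eq] at hb'
      obtain ⟨x, -, hx⟩ : ∃ x : Fin n, s₁₃.var 44 = x ∧ x ∈ (maskSet s 9 : Set (Fin n)) ∧
          x ∈ next := by
        rcases h₁₃ with h | ⟨h, -⟩
        · exact h
        · omega
      have h4'' : (maskSet s₁₃ 4 : Set (Fin n)) = next := by
        rw [← h12_4]
        exact maskSet_congr (f₁₃.arr 4 (by decide))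
      refine (Runs.skip ⟨r₁₃, ?_, ⟨q, a, leg, ⟨⟨?_, ?_, fun i hi => ?_⟩, hc.chain, hc.nodup, hc.last,
        ?_, ?_, ?_, ?_⟩, .inl ?_⟩, ?_⟩).le (by omega)
      · rw [f₁₃.var 6 (by decide), h12_6]
      · rw [f₁₃.var 2 (by decide), hst.flag]
      · rw [f₁₃.var 3 (by decide), hst.len]
      · rw [f₁₃.arr 2 (by decide), hst.get i hi]
      · rw [← hm]
        exact maskSet_congr (f₁₃.arr 3 (by decide))
      · rw [f₁₃.var 5 (by decide), h12_5, hc.end_eq]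
      · rw [f₁₃.var 40 (by decide), h12_40]
        exact hc.leg_len
      · rw [f₁₃.var 40 (by decide), f₁₃.arr 5 (by decide), h12_40, h12_a5]
        exact hc.leg_eq
      · rw [h4'']
        refine hR.inv_delete hk ⟨x, hx⟩ fun y hy hfar => hno y hy ?_
        exact (h₉.far_iff hG ⟨x, hx.2⟩).1 hfar
      · rw [h4'']
        exact hcard
    · simp only [Test.holds, Expr.eval] at hb'
      rw [r₁₃.graph.n_eq] at hb'
      have hnoN : ∀ x ∈ (maskSet s 9 : Set (Fin n)), x ∉ next := by
        rcases h₁₃ with ⟨y, hy, -⟩ | ⟨-, h⟩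
        · exact absurd (hy ▸ y.2) hb'
        · exact fun x h1 h2 => h x ⟨h1, h2⟩
      refine (r₁₃.then_write (B := 9 * unit n M) (by decide) (by decide)
        fun s₁₄ r₁₄ f₁₄ h₁₄ h₁₄' => ?_).le (by omega)
      refine (r₁₄.then_assign (B := 8 * unit n M) (by decide) (by decide)
        fun s₁₅ r₁₅ f₁₅ h₁₅ => ?_).le (by omega)
      simp only [Expr.eval] at h₁₄ h₁₄' h₁₅
      rw [f₁₃.var 40 (by decide), h12_40] at h₁₄ h₁₄'
      rw [f₁₄.var 40 (by decide), f₁₃.var 40 (by decide), h12_40] at h₁₅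
      rw [f₁₃.var 43 (by decide), h12_v] at h₁₄
      simp only [f₁₃.arr 5 (by decide), h12_a5] at h₁₄'
      refine (Runs.moveProg r₁₅ (q := q) (a := a) (v := v)
        -- The last vertex of the old leg drops out, so that the new leg has `k` vertices again.
        (leg := fun i => if i = 0 then v else leg (i - 1))
        ?_ hc.chain hc.nodup hc.last ?_ ?_ hR.adj_v hvq ?_ ?_).mono (by omega) ?_
      · refine ⟨?_, ?_, fun i hi => ?_⟩
        · rw [← hst.flag]
          simp (disch := decide) only [f₁₅.var, f₁₄.var, f₁₃.var]
        · rw [← hst.len]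
          simp (disch := decide) only [f₁₅.var, f₁₄.var, f₁₃.var]
        · rw [← hst.get i hi]
          simp (disch := decide) only [f₁₅.arr, f₁₄.arr, f₁₃.arr]
      · rw [← hm]
        refine maskSet_congr ?_
        simp (disch := decide) only [f₁₅.arr, f₁₄.arr, f₁₃.arr]
      · rw [← h12_v]
        simp (disch := decide) only [f₁₅.var, f₁₄.var, f₁₃.var]
      · rw [h₁₅]
        have := hc.leg_len
        omega
      · intro i hi
        have hl := hc.leg_len
        rw [h₁₅, f₁₅.arr 5 (by decide)]
        by_cases hi0 : i = 0
        · subst hi0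
          simpa using h₁₄
        · simp only [if_neg hi0]
          rw [← hc.leg_eq (i - 1) (by omega), h₁₄' _ (by omega)]
          congr 1
          omega
      · rintro s' ⟨hr', h6', h4', hcur⟩
        have h4'' : (maskSet s' 4 : Set (Fin n)) = next := by
          rw [← h12_4, maskSet_congr h4']
          refine maskSet_congr ?_
          simp (disch := decide) only [f₁₅.arr, f₁₄.arr, f₁₃.arr]
        refine ⟨hr', ?_, ⟨q ++ [v], v, _, hcur, ?_⟩, ?_⟩
        · rw [h6', ← h12_6]
          simp (disch := decide) only [f₁₅.var, f₁₄.var, f₁₃.var]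
        · rw [hins, h4'']
          by_cases hw : w₀ = v
          · exact .inr (hR.not_far_of_eq hw hk)
          · exact .inl (hR.inv_shift hk hw hnoN (by simp) fun i _ => by simp)
        · rw [h4'']
          exact hcard

end

end PathEcc

/-! ### Finding and writing out the obstruction -/

namespace PathEcc

/-- The loop rule for loops with at most `n` rounds. -/
theorem Ready.then_loop {n : ℕ} {G : SimpleGraph (Fin n)} {M k B : ℕ} {s : State}
    {post : State → Prop} (h : Ready G M k s) {b : Test} {P Q : Program} {c : ℕ}
    (I : ℕ → State → Prop) (hc : b.cost + c ≤ 40) (hX : 0 ∉ P.vars ∧ 1 ∉ P.vars)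
    (hY : 0 ∉ P.arrs ∧ 1 ∉ P.arrs ∧ 22 ∉ P.arrs) {j : ℕ} (hj : j ≤ n) (hI : I j s)
    (hstep : ∀ j t, Same P.vars P.arrs s t → I j t → b.holds t →
      Runs P t c fun t' => ∃ j' < j, I j' t')
    (hQ : ∀ s', Ready G M k s' → Same P.vars P.arrs s s' → (∃ j', I j' s') → ¬ b.holds s' →
      Runs Q s' B post) :
    Runs (.seq (.loop b P) Q) s (unit n M + B) post := by
  refine (Runs.seq (B := j * (b.cost + c) + b.cost) (B' := B) ?_).le ?_
  · refine (Runs.loop_uniform (fun j t => Same P.vars P.arrs s t ∧ I j t) ?_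
      ⟨⟨fun _ _ => rfl, fun _ _ => rfl⟩, hI⟩).mono le_rfl ?_
    · rintro j t ⟨hs, ht⟩ hb
      refine (hstep j t hs ht hb).frame.mono le_rfl ?_
      rintro t' ⟨⟨j', hj', ht'⟩, hv, ha⟩
      exact ⟨j', hj', ⟨fun x hx => (hv x hx).trans (hs.var x hx),
        fun A hA => (ha A hA).trans (hs.arr A hA)⟩, ht'⟩
    · rintro s' ⟨⟨j', hs, hj'⟩, hb⟩
      exact hQ s' (h.of_same hs hX hY) hs ⟨j', hj'⟩ hb
  · have h1 : j * (b.cost + c) ≤ n * 40 := Nat.mul_le_mul hj hc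
    unfold unit
    omega

/-- The memory holds a correct output. -/
def Done {n : ℕ} (G : SimpleGraph (Fin n)) (k : ℕ) (s : State) : Prop :=
  ∃ l : List (Fin n),
    (Outputs s 0 l ∧
      ∃ (u v : Fin n) (p : G.Walk u v), p.IsPath ∧ p.support = l ∧ eccentricity p < k) ∨
    (Outputs s 1 l ∧ l.Nodup ∧
      (Nonempty (G.induce {v | v ∈ l} ≃g subdividedClaw k) ∨
        Nonempty (G.induce {v | v ∈ l} ≃g subdividedNet k) ∨
        IsMk k (G.induce {v | v ∈ l})))

section

variable {n : ℕ} {G : SimpleGraph (Fin n)} {M k : ℕ} {s : State}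

/-- The output is the path followed by the leg. Which obstruction it is depends only on whether the
extreme attachment vertices coincide. -/
theorem IsTripod.done {e : ℕ} {w leg : ℕ → Fin n} (h : IsTripod G k e w leg) (hk : 1 ≤ k)
    (h2 : s.var 2 = 1) (h3 : s.var 3 = e + 2 * k + 1 + k)
    (hw : ∀ i < e + 2 * k + 1, s.arr 2 i = w i)
    (hleg : ∀ i < k, s.arr 2 (e + 2 * k + 1 + i) = leg i) : Done G k s := by
  set T := e + 2 * k + 1 with hT
  set f : Fin (T + k) → Fin n := fun i => if (i : ℕ) < T then w i else leg (i - T) with hf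
  have hset : {v | v ∈ List.ofFn f} = verts k e w leg := by
    ext v
    simp only [Set.mem_ofPred_eq, List.mem_ofFn, verts, hf]
    constructor
    · rintro ⟨i, hi⟩
      split_ifs at hi with hlt
      · exact .inl ⟨i, hlt, hi⟩
      · exact .inr ⟨i - T, by omega, hi⟩
    · rintro (⟨i, hi, rfl⟩ | ⟨i, hi, rfl⟩)
      · exact ⟨⟨i, by omega⟩, by simp [show i < T from hi]⟩
      · exact ⟨⟨T + i, by omega⟩, by simp⟩
  refine ⟨List.ofFn f, .inr ⟨⟨h2, by simpa using h3, ?_⟩, ?_, ?_⟩⟩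
  · intro i hi
    rw [List.length_ofFn] at hi
    rw [List.getElem_ofFn]
    simp only [hf]
    split_ifs with hlt
    · exact hw i hlt
    · rw [← hleg (i - T) (by omega)]
      congr 1
      omega
  · rw [List.nodup_ofFn]
    intro i j hij
    simp only [hf] at hij
    have := i.2
    have := j.2
    split_ifs at hij with h1 h2 h2
    · exact Fin.ext (h.path.inj _ h1 _ h2 hij)
    · exact absurd hij (h.ne _ h1 _ (by omega))
    · exact absurd hij.symm (h.ne _ h2 _ (by omega))
    · have := h.leg_path.inj _ (by omega) _ (by omega) hij
      exact Fin.ext (by omega)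
  · rw [hset]
    rcases Nat.eq_zero_or_pos e with rfl | he
    · exact .inl h.claw
    · exact .inr (.inr (h.isMk hk he))

/-- The path is cut to `k` vertices before its first and `k` vertices after its last neighbor of
`a`; the invariant of the search forbids any other contact with the leg. -/
theorem Inv.isTripod {V : Type*} {G : SimpleGraph V} {Q C N : Set V} {a : V} {leg : ℕ → V}
    (hinv : Inv G k Q C a leg) (hN : ∀ x, x ∈ N ↔ x ∈ C ∧ G.Adj a x) {m : ℕ}
    {w : ℕ → V} (hw : IsIndPath G m w) (hC : ∀ j < m, w j ∈ C) {j₁ j₂ : ℕ} (h12 : j₁ ≤ j₂)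
    (h₁ : w j₁ ∈ N) (h₂ : w j₂ ∈ N) (hkj : k ≤ j₁) (hjm : j₂ + k < m)
    (hrange : ∀ j < m, w j ∈ N → j₁ ≤ j ∧ j ≤ j₂) :
    IsTripod G k (j₂ - j₁) (fun i => w (j₁ - k + i)) leg := by
  refine ⟨?_, hinv.leg_path, ?_, ?_, ?_, ?_, ?_⟩
  · refine ⟨fun i hi j hj hij => ?_, fun i hi j hj => ?_⟩
    · have := hw.inj _ (by omega) _ (by omega) hij
      omega
    · rw [hw.adj _ (by omega) _ (by omega)]
      omega
  · intro i hi j hj hij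
    exact hinv.leg_notMem j hj (hij ▸ hC _ (by omega))
  · intro i hi j hj1 hj
    exact hinv.leg_nadj j hj1 hj _ (hC _ (by omega))
  · rw [hinv.leg_zero, show j₁ - k + k = j₁ by omega]
    exact ((hN _).1 h₁).2
  · rw [hinv.leg_zero, show j₁ - k + (k + (j₂ - j₁)) = j₂ by omega]
    exact ((hN _).1 h₂).2
  · intro i hi hadj
    rw [hinv.leg_zero] at hadj
    have := hrange (j₁ - k + i) (by omega) ((hN _).2 ⟨hC _ (by omega), hadj⟩)
    omega

theorem Runs.obstructProg (hk : 1 ≤ k) (hs : Ready G M k s) {Q : Set (Fin n)}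
    {a w₀ y : Fin n} {leg : ℕ → Fin n} (hlen : k ≤ s.var 40)
    (hleg : ∀ i < k, s.arr 5 (s.var 40 - 1 - i) = leg i)
    (hinv : Inv G k Q (maskSet s 4) a leg)
    (hN : ∀ x : Fin n, x ∈ (maskSet s 9 : Set (Fin n)) ↔
      x ∈ (maskSet s 4 : Set (Fin n)) ∧ G.Adj a x)
    (hF : IsBfs G (maskSet s 9) (maskSet s 4) (fun v => s.arr 26 v)) (hw₀ : s.var 41 = w₀)
    (hw₀F : k < s.arr 26 w₀)
    (hW : IsBfs G {w₀} (maskSet s 4 \ maskSet s 9) (fun v => s.arr 27 v))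
    (hy : s.var 42 = y) (hyC : y ∈ (maskSet s 4 : Set (Fin n))) (hyF : k < s.arr 26 y)
    (hyW : s.arr 27 y = 0) :
    Runs obstructProg s (25 * unit n M) fun s' => s'.var 6 = 0 ∧ Done G k s' := by
  have hu : 1 ≤ unit n M := by unfold unit; omega
  have hw₀C : w₀ ∈ (maskSet s 4 : Set (Fin n)) := by
    rcases hF.mem_or_mem (w := w₀) (by omega) with h | h
    · exact ((hN _).1 h).1
    · exact h
  refine (hs.then_mapMask (B := 24 * unit n M) (by decide) (by decide) (by decide)
    fun s₁ r₁ f₁ h₁ => ?_).le (by omega)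
  refine (r₁.then_bfs (B := 23 * unit n M) (by decide) (by decide) (by decide)
    fun s₂ r₂ f₂ h₂ hpar => ?_).le (by omega)
  refine (r₂.then_assign (B := 22 * unit n M) (by decide) (by decide)
    fun s₃ r₃ f₃ h₃ => ?_).le (by omega)
  refine (r₃.then_assign (B := 21 * unit n M) (by decide) (by decide)
    fun s₄ r₄ f₄ h₄ => ?_).le (by omega)
  have e7 : (maskSet s₁ 7 : Set (Fin n)) = {y} := by
    ext x
    rw [h₁, isVar_holds (by decide), hy, Set.mem_singleton_iff, Fin.ext_iff]
  have e4 : (maskSet s₁ 4 : Set (Fin n)) = maskSet s 4 := maskSet_congr (f₁.arr 4 (by decide))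
  rw [e7, e4] at h₂
  have hL0 : s₂.arr 24 w₀ ≠ 0 := h₂.reach_of_chain subset_rfl
    (h₂.source_ne_zero (Set.mem_singleton y)) (hinv.linked y hyC w₀ hw₀C)
  refine (r₄.then_walk (B := 20 * unit n M) (d := fun x => s₂.arr 24 x) (u := w₀)
    (fun v => by simp (disch := decide) only [f₄.arr, f₃.arr]) ?_ (by decide)
    (by decide) (by decide) ?_ hL0 fun s₅ r₅ f₅ w hw0 hch hm5 hget _ _ => ?_).le (by omega)
  · simpa (disch := decide) only [f₄.arr, f₃.arr] using hpar
  · rw [f₄.var 17 (by decide), h₃]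
    simp (disch := decide) only [Expr.eval, f₂.var, f₁.var, hw₀]
  have hmn := hch.le_card
  obtain ⟨hlabel, hadj⟩ := hch
  generalize hm : s₂.arr 24 w₀ = m at hlabel hm5 hget hadj hmn
  simp only [Expr.eval] at h₄
  simp only [h₄, Nat.zero_add] at hm5 hget
  obtain ⟨hpath, hC, ⟨jh, hjh, hjhN⟩, hkN⟩ := obstruction_of_deep hinv hN hF hw₀F hW hyC hyF hyW
    h₂ hw0 hlabel hadj (by omega)
  have hmem9 : ∀ x : Fin n, s.arr 9 x = 1 ↔ x ∈ (maskSet s 9 : Set (Fin n)) := fun x => Iff.rfl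
  -- the first neighbor
  refine (r₅.then_assign (B := 19 * unit n M) (by decide) (by decide)
    fun s₆ r₆ f₆ h₆ => ?_).le (by omega)
  refine (r₆.then_assign (B := 18 * unit n M) (by decide) (by decide)
    fun s₇ r₇ f₇ h₇ => ?_).le (by omega)
  have h79 : s₇.arr 9 = s.arr 9 := by
    simp (disch := decide) only [f₇.arr, f₆.arr, f₅.arr, f₄.arr, f₃.arr, f₂.arr, f₁.arr]
  have h721 : ∀ j < m, s₇.arr 21 j = w j := by
    simpa (disch := decide) only [f₇.arr, f₆.arr] using hget
  simp only [Expr.eval] at h₆ h₇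
  rw [r₆.k_eq] at h₇
  -- The known occurrence `jh` of a vertex of `N` bounds the upward scan, which may stop earlier.
  refine (r₇.then_loop (B := 17 * unit n M) (c := 6) (j := jh - k) (fun j t =>
    t.var 34 + j = jh ∧ t.var 33 + k = t.var 34 ∧ ∀ i < t.var 34, w i ∉ (maskSet s 9 : Set (Fin n)))
    (by decide) (by decide) (by decide) (by omega) ?_ ?_
    fun s₈ r₈ f₈ h₈ hb₈ => ?_).le (by omega)
  · have := hkN jh hjh hjhN
    rw [h₇]
    refine ⟨by omega, ?_, fun i hi hmem => ?_⟩
    · rw [f₇.var 33 (by decide), h₆]; omega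
    · have := hkN i (by omega) hmem
      omega
  · rintro j t ft ⟨ht1, ht2, ht3⟩ hb
    simp only [Test.holds, Expr.eval, ft.arr 9 (by decide), ft.arr 21 (by decide), h79,
      h721 _ (show t.var 34 < m by omega), hmem9] at hb
    have hne : t.var 34 ≠ jh := fun h => hb (h ▸ hjhN)
    refine Runs.seq (B := 3) (B' := 3) (Runs.assign (Runs.assign ⟨j - 1, by omega, ?_, ?_, ?_⟩))
    · simp [Expr.eval]; omega
    · simp [Expr.eval]; omega
    · intro i hi
      simp only [Expr.eval, Function.update_self] at hi
      rcases Nat.lt_or_ge i (t.var 34) with h | h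
      · exact ht3 i h
      · rw [show i = t.var 34 by
          rw [Function.update_of_ne (by decide)] at hi; omega]
        exact hb
  obtain ⟨_, h34, h33, hfirst⟩ := h₈
  have h821 : ∀ j < m, s₈.arr 21 j = w j := by
    simpa (disch := decide) only [f₈.arr] using h721
  have h89 : s₈.arr 9 = s.arr 9 := (f₈.arr 9 (by decide)).trans h79
  simp only [Test.holds, Expr.eval, h89, h821 _ (show s₈.var 34 < m by omega), hmem9, not_not]
    at hb₈
  generalize s₈.var 34 = j₁ at h33 h34 hb₈ hfirst
  have hj1 := hkN j₁ (by omega) hb₈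
  -- the last neighbor
  refine (r₈.then_assign (B := 16 * unit n M) (by decide) (by decide)
    fun s₉ r₉ f₉ h₉ => ?_).le (by omega)
  have h918 : s₈.var 18 = m := by
    rw [← hm5]
    simp (disch := decide) only [f₈.var, f₇.var, f₆.var]
  simp only [Expr.eval, h918] at h₉
  -- The downward scan stops at `j₁` at the latest.
  refine (r₉.then_loop (B := 15 * unit n M) (c := 3) (j := m - 1 - j₁) (fun j t =>
    t.var 35 = j₁ + j ∧ t.var 35 < m ∧
      ∀ i < m, t.var 35 < i → w i ∉ (maskSet s 9 : Set (Fin n)))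
    (by decide) (by decide) (by decide) (by omega) ?_ ?_
    fun s₁₀ r₁₀ f₁₀ h₁₀ hb₁₀ => ?_).le (by omega)
  · rw [h₉]
    refine ⟨by omega, by omega, fun i hi hi' => by omega⟩
  · rintro j t ft ⟨ht1, ht2, ht3⟩ hb
    simp only [Test.holds, Expr.eval, ft.arr 9 (by decide), ft.arr 21 (by decide),
      f₉.arr 9 (by decide), f₉.arr 21 (by decide), h89,
      h821 _ ht2, hmem9] at hb
    have hne : t.var 35 ≠ j₁ := fun h => hb (h ▸ hb₈)
    refine Runs.assign ⟨j - 1, by omega, ?_, ?_, ?_⟩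
    · simp [Expr.eval]; omega
    · simp [Expr.eval]; omega
    · intro i hi hi'
      simp only [Expr.eval, Function.update_self] at hi'
      rcases Nat.lt_or_ge (t.var 35) i with h | h
      · exact ht3 i hi h
      · rw [show i = t.var 35 by omega]
        exact hb
  obtain ⟨_, h35, h35m, hlast⟩ := h₁₀
  simp only [Test.holds, Expr.eval, f₁₀.arr 9 (by decide), f₁₀.arr 21 (by decide),
    f₉.arr 9 (by decide), f₉.arr 21 (by decide), h89, h821 _ h35m, hmem9, not_not] at hb₁₀
  generalize hj2 : s₁₀.var 35 = j₂ at h35 h35m hb₁₀ hlast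
  have hj2' := hkN j₂ h35m hb₁₀
  have htri : IsTripod G k (j₂ - j₁) (fun i => w (j₁ - k + i)) leg := by
    refine hinv.isTripod hN hpath hC (by omega) hb₈ hb₁₀ hj1.1 hj2'.2 fun j hj hjN => ⟨?_, ?_⟩
    · by_contra hlt
      exact hfirst j (by omega) hjN
    · by_contra hlt
      exact hlast j hj (by omega) hjN
  -- the last vertex of the output path
  refine (r₁₀.then_assign (B := 14 * unit n M) (by decide) (by decide)
    fun s₁₁ r₁₁ f₁₁ h₁₁ => ?_).le (by omega)
  simp only [Expr.eval] at h₁₁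
  -- The machine cannot add, so `j₂ + k` is produced by `k` increments; `k ≤ n` follows from the
  -- length of the path.
  refine (r₁₁.then_loop (B := 13 * unit n M) (c := 6) (j := k) (fun j t =>
    t.var 36 + j = k ∧ t.var 35 = j₂ + t.var 36)
    (by decide) (by decide) (by decide) (by omega) ?_ ?_
    fun s₁₂ r₁₂ f₁₂ h₁₂ hb₁₂ => ?_).le (by omega)
  · rw [h₁₁, f₁₁.var 35 (by decide), hj2]
    omega
  · rintro j t ft ⟨ht1, ht2⟩ hb
    simp only [Test.holds, Expr.eval, ft.var 1 (by decide), r₁₁.k_eq] at hb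
    refine Runs.seq (B := 3) (B' := 3) (Runs.assign (Runs.assign ⟨j - 1, by omega, ?_, ?_⟩))
    · simp [Expr.eval]; omega
    · simp [Expr.eval]; omega
  obtain ⟨_, h36, h35'⟩ := h₁₂
  simp only [Test.holds, Expr.eval, r₁₂.k_eq] at hb₁₂
  have h36' : s₁₂.var 36 = k := by omega
  rw [h36'] at h35'
  have h1233 : s₁₂.var 33 = j₁ - k := by
    have : s₁₂.var 33 = s₈.var 33 := by
      simp (disch := decide) only [f₁₂.var, f₁₁.var, f₁₀.var, f₉.var]
    omega
  have h1221 : ∀ j < m, s₁₂.arr 21 j = w j := by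
    simpa (disch := decide) only [f₁₂.arr, f₁₁.arr, f₁₀.arr, f₉.arr] using h821
  -- output the path
  refine (r₁₂.then_assign (B := 12 * unit n M) (by decide) (by decide)
    fun s₁₃ r₁₃ f₁₃ h₁₃ => ?_).le (by omega)
  simp only [Expr.eval] at h₁₃
  obtain ⟨T, hT⟩ : ∃ T, j₂ - j₁ + 2 * k + 1 = T := ⟨_, rfl⟩
  refine (r₁₃.then_loop (B := 11 * unit n M) (c := 10) (j := T) (fun j t =>
    t.var 3 + j = T ∧ t.var 33 = j₁ - k + t.var 3 ∧
      ∀ i < t.var 3, t.arr 2 i = w (j₁ - k + i))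
    (by decide) (by decide) (by decide) (by omega) ?_ ?_
    fun s₁₄ r₁₄ f₁₄ h₁₄ hb₁₄ => ?_).le (by omega)
  · rw [h₁₃, f₁₃.var 33 (by decide), h1233]
    refine ⟨by omega, by omega, fun i hi => absurd hi (by omega)⟩
  · rintro j t ft ⟨ht1, ht2, ht3⟩ hb
    simp only [Test.holds, Expr.eval, ft.var 35 (by decide), f₁₃.var 35 (by decide), h35', ht2]
      at hb
    refine Runs.seq (B := 4) (B' := 6) (Runs.write (Runs.seq (B := 3) (B' := 3)
      (Runs.assign (Runs.assign ⟨j - 1, by omega, ?_, ?_, ?_⟩))))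
    · simp [Expr.eval]; omega
    · simp [Expr.eval]; omega
    · intro i hi
      simp only [Expr.eval, Function.update_self] at hi ⊢
      rw [Function.update_of_ne (by decide), Function.update_self] at hi
      rcases Nat.lt_or_ge i (t.var 3) with h | h
      · rw [Function.update_of_ne (by omega)]
        exact ht3 i h
      · have hi' : i = t.var 3 := by omega
        subst hi'
        rw [Function.update_self, ft.arr 21 (by decide), f₁₃.arr 21 (by decide), ht2]
        exact h1221 _ (by omega)
  obtain ⟨_, h3T, h33', hout⟩ := h₁₄
  simp only [Test.holds, Expr.eval, f₁₄.var 35 (by decide), f₁₃.var 35 (by decide), h35', h33',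
    not_not] at hb₁₄
  have h3T' : s₁₄.var 3 = T := by omega
  rw [h3T'] at hout
  -- output the leg
  have h1440 : s₁₄.var 40 = s.var 40 := by
    simp (disch := decide) only [f₁₄.var, f₁₃.var, f₁₂.var, f₁₁.var, f₁₀.var, f₉.var, f₈.var,
      f₇.var, f₆.var, f₅.var, f₄.var, f₃.var, f₂.var, f₁.var]
  have h145 : s₁₄.arr 5 = s.arr 5 := by
    simp (disch := decide) only [f₁₄.arr, f₁₃.arr, f₁₂.arr, f₁₁.arr, f₁₀.arr, f₉.arr, f₈.arr,
      f₇.arr, f₆.arr, f₅.arr, f₄.arr, f₃.arr, f₂.arr, f₁.arr]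
  refine (r₁₄.then_assign (B := 10 * unit n M) (by decide) (by decide)
    fun s₁₅ r₁₅ f₁₅ h₁₅ => ?_).le (by omega)
  simp only [Expr.eval] at h₁₅
  refine (r₁₅.then_loop (B := 9 * unit n M) (c := 13) (j := k) (fun j t =>
    t.var 36 + j = k ∧ t.var 3 = T + t.var 36 ∧ t.var 40 = s.var 40 - t.var 36 ∧
      (∀ i < T, t.arr 2 i = w (j₁ - k + i)) ∧ ∀ i < t.var 36, t.arr 2 (T + i) = leg i)
    (by decide) (by decide) (by decide) (by omega) ?_ ?_
    fun s₁₆ r₁₆ f₁₆ h₁₆ hb₁₆ => ?_).le (by omega)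
  · rw [h₁₅, f₁₅.var 3 (by decide), f₁₅.var 40 (by decide), f₁₅.arr 2 (by decide), h3T', h1440]
    exact ⟨by omega, by omega, by omega, hout, fun i hi => absurd hi (by omega)⟩
  · rintro j t ft ⟨ht1, ht2, ht3, ht4, ht5⟩ hb
    simp only [Test.holds, Expr.eval, ft.var 1 (by decide), r₁₅.k_eq] at hb
    have h3' : Function.update t.var 40 (t.var 40 - 1) 3 = t.var 3 :=
      Function.update_of_ne (by decide) _ _
    refine Runs.seq (B := 3) (B' := 10) (Runs.assign (Runs.seq (B := 4) (B' := 6) (Runs.write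
      (Runs.seq (B := 3) (B' := 3) (Runs.assign (Runs.assign ⟨j - 1, by omega, ?_, ?_, ?_, ?_,
        ?_⟩))))))
    · simp [Expr.eval]; omega
    · simp [Expr.eval]; omega
    · simp [Expr.eval]; omega
    · intro i hi
      simp only [Expr.eval, Function.update_self]
      rw [h3', Function.update_of_ne (by omega)]
      exact ht4 i hi
    · intro i hi
      simp only [Expr.eval, Function.update_self] at hi ⊢
      rw [Function.update_of_ne (by decide), Function.update_of_ne (by decide)] at hi
      rw [h3', ht2]
      rcases Nat.lt_or_ge i (t.var 36) with h | h
      · rw [Function.update_of_ne (by omega)]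
        exact ht5 i h
      · have hi' : i = t.var 36 := by omega
        subst hi'
        rw [Function.update_self, ft.arr 5 (by decide), f₁₅.arr 5 (by decide), h145, ht3,
          ← hleg _ (by omega)]
        congr 1
        omega
  obtain ⟨_, h36f, h3f, -, hout1, hout2⟩ := h₁₆
  simp only [Test.holds, Expr.eval, r₁₆.k_eq] at hb₁₆
  have h36k : s₁₆.var 36 = k := by omega
  rw [h36k] at h3f hout2
  refine (r₁₆.then_assign (B := 8 * unit n M) (by decide) (by decide)
    fun s₁₇ r₁₇ f₁₇ h₁₇ => ?_).le (by omega)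
  refine (r₁₇.then_assign (B := 7 * unit n M) (by decide) (by decide)
    fun s₁₈ r₁₈ f₁₈ h₁₈ => ?_).le (by omega)
  refine (Runs.skip ⟨h₁₈, htri.done hk ?_ ?_ ?_ ?_⟩).le (by omega)
  · rw [f₁₈.var 2 (by decide), h₁₇]; rfl
  · rw [f₁₈.var 3 (by decide), f₁₇.var 3 (by decide), h3f, hT]
  · rw [hT, f₁₈.arr 2 (by decide), f₁₇.arr 2 (by decide)]
    exact hout1
  · rw [hT, f₁₈.arr 2 (by decide), f₁₇.arr 2 (by decide)]
    exact hout2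

end

end PathEcc

/-! ### A complete round of the program -/

namespace PathEcc

theorem Same.trans {X Y X' Y' : List ℕ} {s s' s'' : State} (h : Same X Y s s')
    (h' : Same X' Y' s' s'') : Same (X ++ X') (Y ++ Y') s s'' := by
  refine ⟨fun x hx => ?_, fun A hA => ?_⟩
  · rw [List.mem_append, not_or] at hx
    rw [h'.var x hx.2, h.var x hx.1]
  · rw [List.mem_append, not_or] at hA
    rw [h'.arr A hA.2, h.arr A hA.1]

theorem Ready.then_choose {n : ℕ} {G : SimpleGraph (Fin n)} {M k B : ℕ} {s : State} {Q : Program}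
    {post : State → Prop} (h : Ready G M k s) {b : Test} {x : ℕ} {e : Expr}
    (hb : b.cost + e.cost ≤ 20) (hx : 0 ∉ [x] ∧ 1 ∉ [x])
    (hQ : ∀ s', Ready G M k s' → Same [x] [] s s' →
      ((b.holds s ∧ s'.var x = e.eval s) ∨ (¬ b.holds s ∧ s'.var x = s.var x)) →
      Runs Q s' B post) :
    Runs (.seq (.branch b (.assign x e) .skip) Q) s (unit n M + B) post := by
  refine (Runs.seq (B := b.cost + (e.cost + 1)) (B' := B) (Runs.branch (fun hh => Runs.assign ?_)
    fun hh => (Runs.skip ?_).le (by omega))).le (by unfold unit; omega)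
  · have hs : Same [x] [] s { s with var := Function.update s.var x (e.eval s) } :=
      ⟨fun y hy => Function.update_of_ne (by simpa using hy) _ _, fun _ _ => rfl⟩
    exact hQ _ (h.of_same hs hx (by decide)) hs (.inl ⟨hh, Function.update_self ..⟩)
  · exact hQ _ h ⟨fun _ _ => rfl, fun _ _ => rfl⟩ (.inr ⟨hh, rfl⟩)

section

variable {n : ℕ} {G : SimpleGraph (Fin n)} {M k : ℕ} {s : State}

theorem Stored.of_same {q : List (Fin n)} (h : Stored s q) {X Y : List ℕ} {s' : State}
    (hs : Same X Y s s') (hX : 2 ∉ X ∧ 3 ∉ X) (hY : 2 ∉ Y) : Stored s' q := by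
  refine ⟨?_, ?_, fun i hi => ?_⟩
  · rw [hs.var 2 hX.1, h.flag]
  · rw [hs.var 3 hX.2, h.len]
  · rw [hs.arr 2 hY, h.get i hi]

theorem Current.of_same {q : List (Fin n)} {a : Fin n} {leg : ℕ → Fin n}
    (h : Current G k s q a leg) {X Y : List ℕ} {s' : State} (hs : Same X Y s s')
    (hX : (2 ∉ X ∧ 3 ∉ X) ∧ 5 ∉ X ∧ 40 ∉ X) (hY : 2 ∉ Y ∧ 3 ∉ Y ∧ 5 ∉ Y) :
    Current G k s' q a leg := by
  refine ⟨h.stored.of_same hs hX.1 hY.1, h.chain, h.nodup, h.last, ?_, ?_, ?_, ?_⟩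
  · rw [maskSet_congr (hs.arr 3 hY.2.1), h.mask]
  · rw [hs.var 5 hX.2.1, h.end_eq]
  · rw [hs.var 40 hX.2.2]
    exact h.leg_len
  · rw [hs.var 40 hX.2.2, hs.arr 5 hY.2.2]
    exact h.leg_eq

theorem Stored.done {q : List (Fin n)} (h : Stored s q) (hc : q.IsChain G.Adj) (hnd : q.Nodup)
    (hne : q ≠ []) (hcov : ∀ x, ¬ Far G k {v | v ∈ q} x) : Done G k s := by
  refine ⟨q, .inl ⟨⟨h.flag, h.len, h.get⟩, _, _, SimpleGraph.Walk.ofSupport q hne hc, ?_, ?_, ?_⟩⟩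
  · rw [SimpleGraph.Walk.isPath_def, SimpleGraph.Walk.support_ofSupport]
    exact hnd
  · exact SimpleGraph.Walk.support_ofSupport ..
  · have hd : ∀ x, distTo (SimpleGraph.Walk.ofSupport q hne hc) x < k := by
      intro x
      have := hcov x
      simp only [Far, not_forall, not_le] at this
      obtain ⟨y, hy, hlt⟩ := this
      have hmem : y ∈ (SimpleGraph.Walk.ofSupport q hne hc).support.toFinset := by
        rw [List.mem_toFinset, SimpleGraph.Walk.support_ofSupport]
        exact hy
      refine (Finset.inf'_le (G.dist x) hmem).trans_lt ?_
      rwa [SimpleGraph.dist_comm]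
    -- The supremum criterion needs `0 < k`, which any single vertex at distance less than `k`
    -- provides.
    rw [eccentricity, Finset.sup_lt_iff]
    · exact fun x _ => hd x
    · exact (Nat.zero_le _).trans_lt (hd (q.head hne))

/-- A round that does not finish shrinks the unvisited set, also when the path stays as it is. This
is what bounds the number of rounds. -/
theorem Runs.roundProg (hG : G.Connected) (hk : 1 ≤ k) (hs : Ready G M k s) (h6 : s.var 6 = 1)
    (hsearch : Searching G k s) :
    Runs roundProg s (40 * unit n M) fun s' => (s'.var 6 = 0 ∧ Done G k s') ∨
      (s'.var 6 = 1 ∧ Ready G M k s' ∧ Searching G k s' ∧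
        (maskSet s' 4 : Set (Fin n)).ncard < (maskSet s 4 : Set (Fin n)).ncard) := by
  have hu : 1 ≤ unit n M := by unfold unit; omega
  obtain ⟨q, a, leg, hc, hinv⟩ := hsearch
  have haq : a ∈ q := List.mem_of_getLast? hc.last
  have hne : q ≠ [] := List.ne_nil_of_mem haq
  refine (hs.then_bfs (B := 39 * unit n M) (by decide) (by decide) (by decide)
    fun s₁ r₁ f₁ h₁ _ => ?_).le (by omega)
  refine (r₁.then_find (B := 38 * unit n M) (by decide) (by decide) (by decide)
    fun s₂ r₂ f₂ h₂ => ?_).le (by omega)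
  rw [hc.mask, hs.maskSet_all] at h₁
  simp only [exceeds_holds, r₁.k_eq] at h₂
  have hfar : ∀ x, Far G k {v | v ∈ q} x ↔ k < s₁.arr 24 x := fun x => h₁.far_iff hG ⟨a, haq⟩
  simp only [← hfar] at h₂
  have f12 := f₁.trans f₂
  refine (r₂.then_branch (B := 37 * unit n M) (by decide) (fun hb => ?_) fun hb => ?_).le (by omega)
  · simp only [Test.holds, Expr.eval, r₂.graph.n_eq] at hb
    have hcov : ∀ x, ¬ Far G k {v | v ∈ q} x := by
      rcases h₂ with ⟨v, hv, -⟩ | ⟨-, h⟩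
      · have := v.2
        omega
      · exact h
    refine (r₂.then_assign (B := 36 * unit n M) (by decide) (by decide)
      fun s₃ r₃ f₃ h₃ => Runs.le (Runs.skip (.inl ⟨h₃, ?_⟩)) (by omega)).le (by omega)
    exact (hc.stored.of_same (f12.trans f₃) (by decide) (by decide)).done hc.chain hc.nodup hne hcov
  simp only [Test.holds, Expr.eval, r₂.graph.n_eq] at hb
  have hinv : Inv G k {v | v ∈ q} (maskSet s 4) a leg := by
    rcases hinv with h | h
    · exact h
    · rcases h₂ with ⟨v, -, hv⟩ | ⟨h', -⟩
      · exact absurd hv (h v)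
      · exact absurd h' hb
  refine (r₂.then_mapMask (B := 36 * unit n M) (by decide) (by decide) (by decide)
    fun s₃ r₃ f₃ h₃ => ?_).le (by omega)
  refine (r₃.then_bfs (B := 35 * unit n M) (by decide) (by decide) (by decide)
    fun s₄ r₄ f₄ h₄ _ => ?_).le (by omega)
  refine (r₄.then_mapMask (B := 34 * unit n M) (by decide) (by decide) (by decide)
    fun s₅ r₅ f₅ h₅ => ?_).le (by omega)
  have f15 := ((f12.trans f₃).trans f₄).trans f₅
  have e7 : (maskSet s₃ 7 : Set (Fin n)) = {a} := by
    ext x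
    rw [h₃, isVar_holds (by decide), f12.var 5 (by decide), hc.end_eq, Set.mem_singleton_iff,
      Fin.ext_iff]
  rw [e7, r₃.maskSet_all] at h₄
  have haC : a ∉ (maskSet s 4 : Set (Fin n)) := fun h => hinv.disj a h haq
  have hN5 : ∀ x : Fin n, x ∈ (maskSet s₅ 9 : Set (Fin n)) ↔
      x ∈ (maskSet s 4 : Set (Fin n)) ∧ G.Adj a x := by
    intro x
    rw [h₅, and_holds, labeled_holds, labeled_holds, h₄.eq_two_iff x,
      (((f12.trans f₃).trans f₄).arr 4 (by decide)), mem_maskSet]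
    refine and_congr_right fun hx => ?_
    simp only [Set.mem_singleton_iff, exists_eq_left]
    refine ⟨fun h => h.2, fun h => ⟨?_, h⟩⟩
    rintro rfl
    exact haC hx
  have e54 : (maskSet s₅ 4 : Set (Fin n)) = maskSet s 4 := maskSet_congr (f15.arr 4 (by decide))
  refine (r₅.then_bfs (B := 33 * unit n M) (by decide) (by decide) (by decide)
    fun s₆ r₆ f₆ h₆ _ => ?_).le (by omega)
  refine (r₆.then_find (B := 32 * unit n M) (by decide) (by decide) (by decide)
    fun s₇ r₇ f₇ h₇ => ?_).le (by omega)
  refine (r₇.then_find (B := 31 * unit n M) (by decide) (by decide) (by decide)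
    fun s₈ r₈ f₈ h₈ => ?_).le (by omega)
  refine (r₈.then_choose (B := 30 * unit n M) (by decide) (by decide)
    fun s₉ r₉ f₉ h₉ => ?_).le (by omega)
  rw [e54] at h₆
  have f69 := ((f₆.trans f₇).trans f₈).trans f₉
  -- Register `41` first receives some vertex of `N` and is then overwritten if there is a deep
  -- vertex.
  have hpick : ∃ w₀ : Fin n, s₉.var 41 = w₀ ∧
      ((w₀ ∈ (maskSet s 4 : Set (Fin n)) ∧ k < s₆.arr 26 w₀) ∨
        (w₀ ∈ (maskSet s₅ 9 : Set (Fin n)) ∧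
          ∀ x ∈ (maskSet s 4 : Set (Fin n)), s₆.arr 26 x ≤ k)) := by
    have hh8 : ∀ x : Fin n, ((labeled 4 1).and (exceeds 26)).holds (s₇.at x) ↔
        x ∈ (maskSet s 4 : Set (Fin n)) ∧ k < s₆.arr 26 x := by
      intro x
      rw [and_holds, labeled_holds, exceeds_holds, r₇.k_eq, f₇.arr 4 (by decide),
        f₇.arr 26 (by decide), f₆.arr 4 (by decide), f15.arr 4 (by decide), mem_maskSet]
    simp only [hh8] at h₈
    simp only [Test.holds, Expr.eval, r₈.graph.n_eq] at h₉
    rcases h₈ with ⟨x, hx, hx'⟩ | ⟨hx, hx'⟩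
    · refine ⟨x, ?_, .inl hx'⟩
      have := x.2
      omega
    · simp only [labeled_holds, f₆.arr 9 (by decide)] at h₇
      rcases h₇ with ⟨w, hw, hw'⟩ | ⟨-, hw'⟩
      · refine ⟨w, ?_, .inr ⟨hw', fun y hy => ?_⟩⟩
        · rw [f₈.var 41 (by decide)] at h₉
          omega
        · by_contra hlt
          exact hx' y ⟨hy, by omega⟩
      · obtain ⟨u, hu, hau⟩ := hinv.nbr
        exact absurd ((hN5 u).2 ⟨hu, hau⟩) (hw' u)
  obtain ⟨w₀, hw₀, hpick⟩ := hpick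
  refine (r₉.then_mapMask (B := 29 * unit n M) (by decide) (by decide) (by decide)
    fun s₁₀ r₁₀ f₁₀ h₁₀ => ?_).le (by omega)
  refine (r₁₀.then_mapMask (B := 28 * unit n M) (by decide) (by decide) (by decide)
    fun s₁₁ r₁₁ f₁₁ h₁₁ => ?_).le (by omega)
  refine (r₁₁.then_bfs (B := 27 * unit n M) (by decide) (by decide) (by decide)
    fun s₁₂ r₁₂ f₁₂ h₁₂ _ => ?_).le (by omega)
  refine (r₁₂.then_find (B := 26 * unit n M) (by decide) (by decide) (by decide)
    fun s₁₃ r₁₃ f₁₃ h₁₃ => ?_).le (by omega)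
  have e7' : (maskSet s₁₁ 7 : Set (Fin n)) = {w₀} := by
    rw [maskSet_congr (f₁₁.arr 7 (by decide))]
    ext x
    rw [h₁₀, isVar_holds (by decide), hw₀, Set.mem_singleton_iff, Fin.ext_iff]
  have e8 : (maskSet s₁₁ 8 : Set (Fin n)) = maskSet s 4 \ maskSet s₅ 9 := by
    ext x
    rw [h₁₁, and_holds, not_holds, labeled_holds, labeled_holds, Set.mem_sdiff,
      (f69.trans f₁₀).arr 4 (by decide), (f69.trans f₁₀).arr 9 (by decide), f15.arr 4 (by decide),
      mem_maskSet, mem_maskSet]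
  rw [e7', e8] at h₁₂
  have f1012 := (f₁₀.trans f₁₁).trans f₁₂
  have ff := ((f15.trans f69).trans f1012).trans f₁₃
  have e4 : (maskSet s₁₃ 4 : Set (Fin n)) = maskSet s 4 := maskSet_congr (ff.arr 4 (by decide))
  have e9 : (maskSet s₁₃ 9 : Set (Fin n)) = maskSet s₅ 9 :=
    maskSet_congr (((f69.trans f1012).trans f₁₃).arr 9 (by decide))
  have e26 : s₁₃.arr 26 = s₆.arr 26 :=
    ((((f₇.trans f₈).trans f₉).trans f1012).trans f₁₃).arr 26 (by decide)
  have e27 : s₁₃.arr 27 = s₁₂.arr 27 := f₁₃.arr 27 (by decide)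
  have e41 : s₁₃.var 41 = w₀ := by
    rw [(f1012.trans f₁₃).var 41 (by decide), hw₀]
  have hh13 : ∀ x : Fin n, (((labeled 4 1).and (exceeds 26)).and (labeled 27 0)).holds (s₁₂.at x) ↔
      (x ∈ (maskSet s 4 : Set (Fin n)) ∧ k < s₆.arr 26 x) ∧ s₁₂.arr 27 x = 0 := by
    intro x
    rw [and_holds, and_holds, labeled_holds, labeled_holds, exceeds_holds, r₁₂.k_eq, ← e26,
      f₁₃.arr 26 (by decide), mem_maskSet, ← ff.arr 4 (by decide), f₁₃.arr 4 (by decide)]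
  simp only [hh13] at h₁₃
  have hc' : Current G k s₁₃ q a leg := hc.of_same ff (by decide) (by decide)
  rw [← e4] at hinv h₁₂ h₆
  rw [← e9] at h₁₂ h₆
  rw [← e4, ← e9] at hN5
  refine (r₁₃.then_branch (B := 25 * unit n M) (by decide) (fun hb => ?_) fun hb => ?_).le
    (by omega)
  · simp only [Test.holds, Expr.eval, r₁₃.graph.n_eq] at hb
    obtain ⟨y, hy, ⟨hyC, hyF⟩, hyW⟩ : ∃ y : Fin n, s₁₃.var 42 = y ∧
        (y ∈ (maskSet s 4 : Set (Fin n)) ∧ k < s₆.arr 26 y) ∧ s₁₂.arr 27 y = 0 := by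
      rcases h₁₃ with h | ⟨h, -⟩
      · exact h
      · omega
    refine (Runs.obstructProg hk r₁₃ hc'.leg_len hc'.leg_eq hinv hN5 (by rwa [e26]) e41 ?_
      (by rwa [e27]) hy (by rwa [e4]) (by rwa [e26]) (by rwa [e27])).mono le_rfl fun s' h => .inl h
    rw [e26]
    rcases hpick with h | h
    · exact h.2
    · have := h.2 y hyC
      omega
  · simp only [Test.holds, Expr.eval, r₁₃.graph.n_eq] at hb
    refine (Runs.advanceProg hG hk r₁₃ hc' hinv hN5 (by rwa [e26]) e41 ?_ (by rwa [e27])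
      ?_).mono le_rfl ?_
    · rw [e26, e4, e9]
      exact hpick
    · rw [e26, e27, e4]
      intro y hy hyF h0
      rcases h₁₃ with ⟨z, hz, -⟩ | ⟨-, h⟩
      · have := z.2
        omega
      · exact h y ⟨⟨hy, hyF⟩, h0⟩
    · rintro s' ⟨hr, h6', hse, hlt⟩
      rw [e4] at hlt
      refine .inr ⟨?_, hr, hse, hlt⟩
      rw [h6', ff.var 6 (by decide), h6]

end

end PathEcc

/-! ### Growing the connected set and setting up the search -/

namespace PathEcc

theorem Linked.insert_of_adj {V : Type*} {G : SimpleGraph V} {R : Set V} (hR : Linked G R) {u v : V}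
    (hu : u ∈ R) (huv : G.Adj u v) : Linked G (insert v R) := by
  have key : ∀ x ∈ R, ∀ y ∈ R,
      Relation.ReflTransGen (fun a b => G.Adj a b ∧ a ∈ insert v R ∧ b ∈ insert v R) x y := by
    intro x hx y hy
    refine Relation.ReflTransGen.mono (p := fun a b => G.Adj a b ∧ a ∈ insert v R ∧ b ∈ insert v R)
      ?_ _ _ (hR x hx y hy)
    rintro a b ⟨h1, h2, h3⟩
    exact ⟨h1, .inr h2, .inr h3⟩
  rintro x (rfl | hx) y (rfl | hy)
  · exact .refl
  · exact .head ⟨huv.symm, .inl rfl, .inr hu⟩ (key u hu y hy)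
  · exact .tail (key x hx u hu) ⟨huv, .inr hu, .inl rfl⟩
  · exact key x hx y hy

section

variable {n : ℕ} {G : SimpleGraph (Fin n)} {M k : ℕ} {s : State}

/-- After a success the scan restarts, since vertices passed over before may have become adjacent to
the enlarged set. The value `n` of register `44` signals that the candidate is rejected. -/
theorem Runs.growStep (hG : G.Connected) (hs : Ready G M k s) {v : Fin n} (hv : s.var 43 = v) :
    Runs growStep s (11 * unit n M) fun s' => Ready G M k s' ∧ s'.var 2 = s.var 2 ∧
      ((s'.var 43 = 0 ∧ v ∉ (maskSet s 6 : Set (Fin n)) ∧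
        (∃ u ∈ (maskSet s 6 : Set (Fin n)), G.Adj u v) ∧
        (∃ x, Far G k (insert v (maskSet s 6)) x) ∧
        (maskSet s' 6 : Set (Fin n)) = insert v (maskSet s 6)) ∨
      (s'.var 43 = v + 1 ∧ (maskSet s' 6 : Set (Fin n)) = maskSet s 6 ∧
        (v ∉ (maskSet s 6 : Set (Fin n)) → (∃ u ∈ (maskSet s 6 : Set (Fin n)), G.Adj u v) →
          ∀ x, ¬ Far G k (insert v (maskSet s 6)) x))) := by
  have hu : 1 ≤ unit n M := by unfold unit; omega
  set R : Set (Fin n) := maskSet s 6 with hRdef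
  refine (hs.then_assign (B := 10 * unit n M) (by decide) (by decide)
    fun s₁ r₁ f₁ h₁ => ?_).le (by omega)
  refine (r₁.then_bfs (B := 9 * unit n M) (by decide) (by decide) (by decide)
    fun s₂ r₂ f₂ h₂ _ => ?_).le (by omega)
  have f12 := f₁.trans f₂
  rw [maskSet_congr (f₁.arr 6 (by decide)), r₁.maskSet_all] at h₂
  have hv2 : s₂.var 43 = v := (f12.var 43 (by decide)).trans hv
  have h44 : s₂.var 44 = n := by
    rw [f₂.var 44 (by decide), h₁]
    exact hs.graph.n_eq
  have hlab : s₂.arr 24 v = 2 ↔ v ∉ R ∧ ∃ u ∈ R, G.Adj u v := h₂.eq_two_iff v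
  refine (Runs.seq (B := 5 * unit n M) (B' := 4 * unit n M) ?_).le (by omega)
  refine Runs.mono (B := unit n M + 4 * unit n M)
    (post := fun t => Ready G M k t ∧ t.var 2 = s.var 2 ∧ t.var 43 = v ∧ t.arr 6 = s.arr 6 ∧
      ((∃ x : Fin n, t.var 44 = x ∧ v ∉ R ∧ (∃ u ∈ R, G.Adj u v) ∧ Far G k (insert v R) x) ∨
        (t.var 44 = n ∧ (v ∉ R → (∃ u ∈ R, G.Adj u v) → ∀ x, ¬ Far G k (insert v R) x))))
    ?_ (by omega) ?_
  · refine r₂.then_branch (by decide) (fun hb => ?_) fun hb => ?_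
    · simp only [Test.holds, Expr.eval, hv2, hlab] at hb
      refine (r₂.then_mapMask (B := 3 * unit n M) (by decide) (by decide) (by decide)
        fun s₃ r₃ f₃ h₃ => ?_).le (by omega)
      refine (r₃.then_bfs (B := 2 * unit n M) (by decide) (by decide) (by decide)
        fun s₄ r₄ f₄ h₄ _ => ?_).le (by omega)
      refine (r₄.then_find (B := unit n M) (by decide) (by decide) (by decide)
        fun s₅ r₅ f₅ h₅ => ?_).le (by omega)
      have ff := ((f12.trans f₃).trans f₄).trans f₅
      have e7 : (maskSet s₃ 7 : Set (Fin n)) = insert v R := by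
        ext x
        rw [h₃, not_holds, and_holds, not_holds, not_holds, labeled_holds, isVar_holds (by decide),
          hv2, f12.arr 6 (by decide), Set.mem_insert_iff, Fin.ext_iff, hRdef, mem_maskSet]
        tauto
      rw [e7, r₃.maskSet_all] at h₄
      simp only [exceeds_holds, r₄.k_eq] at h₅
      simp only [← h₄.far_iff hG (Set.insert_nonempty v R)] at h₅
      refine (Runs.skip ⟨r₅, ff.var 2 (by decide), (ff.var 43 (by decide)).trans hv,
        ff.arr 6 (by decide), ?_⟩).le (by omega)
      rcases h₅ with ⟨x, hx, hx'⟩ | ⟨hx, hx'⟩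
      · exact .inl ⟨x, hx, hb.1, hb.2, hx'⟩
      · exact .inr ⟨hx, fun _ _ => hx'⟩
    · simp only [Test.holds, Expr.eval, hv2, hlab] at hb
      refine (Runs.skip ⟨r₂, f12.var 2 (by decide), hv2, f12.arr 6 (by decide), .inr ⟨h44, ?_⟩⟩).le
        (by omega)
      intro h1 h2
      exact absurd ⟨h1, h2⟩ hb
  · rintro t ⟨rt, ht2, ht43, ht6, ht⟩
    refine (rt.then_branch (B := 2 * unit n M + 1) (by decide) (fun hb => ?_) fun hb => ?_).le
      (by omega)
    · simp only [Test.holds, Expr.eval, rt.graph.n_eq] at hb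
      obtain ⟨x, -, hvR, hadj, hx⟩ : ∃ x : Fin n, t.var 44 = x ∧ v ∉ R ∧ (∃ u ∈ R, G.Adj u v) ∧
          Far G k (insert v R) x := by
        rcases ht with h | ⟨h, -⟩
        · exact h
        · omega
      refine (rt.then_write (B := unit n M + 1) (by decide) (by decide)
        fun s₃ r₃ f₃ h₃ h₃' => ?_).le (by omega)
      refine r₃.then_assign (by decide) (by decide) fun s₄ r₄ f₄ h₄ => Runs.skip ⟨r₄, ?_, ?_⟩
      · rw [(f₃.trans f₄).var 2 (by decide), ht2]
      · refine .inl ⟨h₄, hvR, hadj, ⟨x, hx⟩, ?_⟩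
        simp only [Expr.eval, ht43] at h₃ h₃'
        ext y
        rw [mem_maskSet, f₄.arr 6 (by decide), Set.mem_insert_iff, hRdef, mem_maskSet, ← ht6]
        by_cases hy : y = v
        · subst hy
          simp [h₃]
        · rw [h₃' y fun h => hy (Fin.ext h)]
          simp [hy]
    · simp only [Test.holds, Expr.eval, rt.graph.n_eq] at hb
      refine (rt.then_assign (B := 1) (by decide) (by decide)
        fun s₃ r₃ f₃ h₃ => Runs.skip ⟨r₃, ?_, .inr ⟨?_, ?_, ?_⟩⟩).le (by omega)
      · rw [f₃.var 2 (by decide), ht2]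
      · rw [h₃]
        simp only [Expr.eval, ht43]
      · refine maskSet_congr ?_
        rw [f₃.arr 6 (by decide), ht6]
      · rcases ht with ⟨x, hx, -⟩ | ⟨-, h⟩
        · have := x.2
          omega
        · exact h

/-- `R` is a connected set that does not cover the graph, but does so together with any vertex that
has a neighbor in it. -/
structure Grown {n : ℕ} (G : SimpleGraph (Fin n)) (k : ℕ) (R : Set (Fin n)) : Prop where
  linked : Linked G R
  nonempty : R.Nonempty
  far : ∃ x, Far G k R x
  maximal : ∀ v ∉ R, (∃ u ∈ R, G.Adj u v) → ∀ x, ¬ Far G k (insert v R) x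

/-- The pair of the number of vertices outside the set and the number of candidates left in the scan
drops lexicographically; as a number it is at most `n * (n + 1) + n`. No other part of the program
needs quadratically many searches. -/
theorem Runs.growProg (hG : G.Connected) (hs : Ready G M k s)
    (hlink : Linked G (maskSet s 6 : Set (Fin n))) (hne : (maskSet s 6 : Set (Fin n)).Nonempty)
    (hfar : ∃ x, Far G k (maskSet s 6 : Set (Fin n)) x) :
    Runs growProg s (2 * unit n M + (n * (n + 1) + n) * (13 * unit n M)) fun s' =>
      Ready G M k s' ∧ s'.var 2 = s.var 2 ∧ Grown G k (maskSet s' 6) := by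
  have hu : 1 ≤ unit n M := by unfold unit; omega
  refine (hs.then_assign (B := unit n M + (n * (n + 1) + n) * (13 * unit n M)) (by decide)
    (by decide) fun s₁ r₁ f₁ h₁ => ?_).le (by omega)
  refine (Runs.seq (B := (n * (n + 1) + n) * (13 * unit n M) + 3) (B' := 1) ?_).le
    (by unfold unit; omega)
  have hle : ∀ R : Set (Fin n), R.ncard ≤ n := fun R => by
    simpa using Set.ncard_le_card R
  have key := Runs.loop_uniform (b := .lt (.var 43) (.var 0)) (P := PathEcc.growStep) (s := s₁)
    (B := 11 * unit n M) (j := (n - (maskSet s₁ 6 : Set (Fin n)).ncard) * (n + 1) + n)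
    (fun j t => Ready G M k t ∧ t.var 2 = s.var 2 ∧ t.var 43 ≤ n ∧
      Linked G (maskSet t 6 : Set (Fin n)) ∧
      (maskSet t 6 : Set (Fin n)).Nonempty ∧ (∃ x, Far G k (maskSet t 6 : Set (Fin n)) x) ∧
      (∀ v : Fin n, (v : ℕ) < t.var 43 → v ∉ (maskSet t 6 : Set (Fin n)) →
        (∃ u ∈ (maskSet t 6 : Set (Fin n)), G.Adj u v) →
        ∀ x, ¬ Far G k (insert v (maskSet t 6)) x) ∧
      j = (n - (maskSet t 6 : Set (Fin n)).ncard) * (n + 1) + (n - t.var 43)) ?_ ?_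
  · refine key.mono ?_ ?_
    · have h1 : (Test.lt (.var 43) (.var 0)).cost = 3 := rfl
      rw [h1]
      have h3 : 3 + 11 * unit n M ≤ 13 * unit n M := by unfold unit; omega
      gcongr
      exact Nat.sub_le _ _
    · rintro t ⟨⟨j, hr, h2, hle, hl, hn, hf, hmax, -⟩, hb⟩
      simp only [Test.holds, Expr.eval, hr.graph.n_eq] at hb
      exact Runs.skip ⟨hr, h2, hl, hn, hf, fun v => hmax v (by omega)⟩
  · rintro j t ⟨hr, h2, -, hl, hn, hf, hmax, hj⟩ hb
    simp only [Test.holds, Expr.eval, hr.graph.n_eq] at hb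
    refine (Runs.growStep hG hr (v := ⟨t.var 43, hb⟩) rfl).mono le_rfl ?_
    rintro t' ⟨hr', h2', h⟩
    rcases h with ⟨h43, hv, ⟨u, hu, huv⟩, hx, hm⟩ | ⟨h43, hm, hv⟩
    · refine ⟨_, ?_, hr', h2'.trans h2, by omega, ?_, ?_, ?_, ?_, rfl⟩
      -- The new vertex releases `n + 1`, and the restart of the scan uses up at most `n` of it.
      · have h1 := hle (insert ⟨t.var 43, hb⟩ (maskSet t 6))
        rw [hm, hj, h43]
        rw [Set.ncard_insert_of_notMem hv] at h1 ⊢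
        have h3 : n - (maskSet t 6 : Set (Fin n)).ncard
            = (n - ((maskSet t 6 : Set (Fin n)).ncard + 1)) + 1 := by omega
        rw [h3, Nat.add_mul]
        omega
      · rw [hm]
        exact hl.insert_of_adj hu huv
      · rw [hm]
        exact Set.insert_nonempty _ _
      · rw [hm]
        exact hx
      · rw [h43]
        intro v hv
        omega
    · refine ⟨_, ?_, hr', h2'.trans h2, by rw [h43]; exact hb, ?_, ?_, ?_, ?_, rfl⟩
      · rw [hm, hj, h43]
        simp only
        omega
      · rwa [hm]
      · rwa [hm]
      · rwa [hm]
      · rw [hm, h43]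
        intro v hv'
        rcases Nat.lt_or_ge v (t.var 43) with h | h
        · exact hmax v h
        · have : v = ⟨t.var 43, hb⟩ := Fin.ext (by simp only at hv'; simp only; omega)
          rw [this]
          exact hv
  · have e6 : (maskSet s₁ 6 : Set (Fin n)) = maskSet s 6 := maskSet_congr (f₁.arr 6 (by decide))
    simp only [Expr.eval] at h₁
    rw [e6, h₁]
    refine ⟨r₁, f₁.var 2 (by decide), by omega, hlink, hne, hfar, fun v hv => absurd hv (by omega),
      by omega⟩

/-- Parents from `x` to `a` list the first path from `x` to `a`; the same list is the leg of `a` in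
the reverse order in which legs are stored, so a copy suffices. -/
theorem Runs.startProg (hG : G.Connected) (hk : 1 ≤ k) (hs : Ready G M k s) (h2 : s.var 2 = 0)
    (hR : Grown G k (maskSet s 6 : Set (Fin n))) :
    Runs startProg s (20 * unit n M) fun s' => Ready G M k s' ∧ s'.var 6 = 1 ∧
      Searching G k s' := by
  have hu : 1 ≤ unit n M := by unfold unit; omega
  set R : Set (Fin n) := maskSet s 6 with hRdef
  obtain ⟨r₀, hr₀⟩ := hR.nonempty
  obtain ⟨x₀, hx₀⟩ := hR.far
  refine (hs.then_bfs (B := 19 * unit n M) (by decide) (by decide) (by decide)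
    fun s₁ r₁ f₁ h₁ _ => ?_).le (by omega)
  refine (r₁.then_find (B := 18 * unit n M) (by decide) (by decide) (by decide)
    fun s₂ r₂ f₂ h₂ => ?_).le (by omega)
  refine (r₂.then_find (B := 17 * unit n M) (by decide) (by decide) (by decide)
    fun s₃ r₃ f₃ h₃ => ?_).le (by omega)
  rw [hs.maskSet_all] at h₁
  have hfar : ∀ x, Far G k R x ↔ k < s₁.arr 24 x := fun x => h₁.far_iff hG ⟨r₀, hr₀⟩
  have hlab : ∀ x : Fin n, s₁.arr 24 x = 2 ↔ x ∉ R ∧ ∃ u ∈ R, G.Adj u x := fun x =>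
    h₁.eq_two_iff x
  simp only [exceeds_holds, r₁.k_eq, ← hfar] at h₂
  simp only [labeled_holds, f₂.arr 24 (by decide), hlab] at h₃
  obtain ⟨x, hx41, hx⟩ : ∃ x : Fin n, s₂.var 41 = x ∧ Far G k R x := by
    rcases h₂ with h | ⟨-, h⟩
    · exact h
    · exact absurd hx₀ (h x₀)
  -- The vertex `x` is far from `R` and therefore outside it; a shortest path from `R` to `x` leaves
  -- `R` through a neighbor of `R`.
  obtain ⟨a, ha5, haR, hadjR⟩ : ∃ a : Fin n, s₃.var 5 = a ∧ a ∉ R ∧ ∃ u ∈ R, G.Adj u a := by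
    rcases h₃ with h | ⟨-, h⟩
    · exact h
    · have hxR : x ∉ R := fun h => by
        have := hx x h
        simp at this
        omega
      obtain ⟨u, hu, z, hz, huz, -⟩ := exists_exit hG hr₀ hxR
      exact absurd ⟨hz, u, hu, huz⟩ (h z)
  -- At least `k - 1` because a neighbor of `a` in `R` is `k` or more away from `x`; at most `k - 1`
  -- because `R` with `a` covers `x` and `R` does not.
  have hdist : G.dist a x + 1 = k := by
    have h1 := hR.maximal a haR hadjR x
    simp only [Far, not_forall, not_le] at h1
    obtain ⟨r, hr, hlt⟩ := h1
    obtain ⟨u, hu, hua⟩ := hadjR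
    have h3 := hx u hu
    have h4 := hG.dist_triangle (u := u) (v := a) (w := x)
    have h5 : G.dist u a = 1 := SimpleGraph.dist_eq_one_iff_adj.2 hua
    rcases hr with rfl | hr
    · omega
    · have := hx r hr
      omega
  refine (r₃.then_mapMask (B := 16 * unit n M) (by decide) (by decide) (by decide)
    fun s₄ r₄ f₄ h₄ => ?_).le (by omega)
  refine (r₄.then_bfs (B := 15 * unit n M) (by decide) (by decide) (by decide)
    fun s₅ r₅ f₅ h₅ hpar => ?_).le (by omega)
  refine (r₅.then_mapMask (B := 14 * unit n M) (by decide) (by decide) (by decide)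
    fun s₆ r₆ f₆ h₆ => ?_).le (by omega)
  refine (r₆.then_assign (B := 13 * unit n M) (by decide) (by decide)
    fun s₇ r₇ f₇ h₇ => ?_).le (by omega)
  refine (r₇.then_assign (B := 12 * unit n M) (by decide) (by decide)
    fun s₈ r₈ f₈ h₈ => ?_).le (by omega)
  have e7 : (maskSet s₄ 7 : Set (Fin n)) = {a} := by
    ext y
    rw [h₄, isVar_holds (by decide), ha5, Set.mem_singleton_iff, Fin.ext_iff]
  rw [e7, r₄.maskSet_all] at h₅
  have hd5 : ∀ y : Fin n, s₅.arr 32 y = G.dist a y + 1 := fun y => h₅.eq_dist hG rfl y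
  have f68 := (f₆.trans f₇).trans f₈
  refine (r₈.then_walk (B := 11 * unit n M) (d := fun y => G.dist a y + 1) (u := x) (fun y => ?_)
    ?_ (by decide) (by decide) (by decide) ?_ (by simp)
    fun s₉ r₉ f₉ w hw0 hch hlen hget _ hmask => ?_).le (by omega)
  · rw [f68.arr 32 (by decide), hd5]
  · rw [f68.arr 33 (by decide)]
    simpa only [hd5] using hpar
  · rw [h₈]
    simp only [Expr.eval]
    rw [((((f₃.trans f₄).trans f₅).trans f₆).trans f₇).var 41 (by decide), hx41]
  simp only [Expr.eval] at h₇
  have h83 : s₈.var 3 = 0 := (f₈.var 3 (by decide)).trans h₇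
  have hkn : k ≤ n := hdist ▸ hch.le_card
  simp only [h83, Nat.zero_add, hdist] at hlen hget hmask hch
  have hwa : ∀ i < k, G.dist a (w i) = k - 1 - i := by
    intro i hi
    have := hch.label i hi
    omega
  have hlast : w (k - 1) = a := by
    have h1 := hwa (k - 1) (by omega)
    rw [Nat.sub_self] at h1
    exact (hG.dist_eq_zero_iff.1 h1).symm
  have hinj : ∀ i < k, ∀ j < k, w i = w j → i = j := by
    intro i hi j hj hij
    have h1 := hwa i hi
    have h3 := hwa j hj
    rw [hij] at h1
    omega
  have e3 : ∀ y : Fin n, s₉.arr 3 y = 1 ↔ ∃ i < k, w i = y := by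
    intro y
    rw [hmask, (f₇.trans f₈).arr 3 (by decide), ← mem_maskSet, h₆]
    simp [isVar, Test.holds, Expr.eval]
  refine (r₉.then_copy (B := 10 * unit n M) (by decide) (by decide)
    fun s₁₀ r₁₀ f₁₀ h₁₀ => ?_).le (by omega)
  refine (r₁₀.then_assign (B := 9 * unit n M) (by decide) (by decide)
    fun s₁₁ r₁₁ f₁₁ h₁₁ => ?_).le (by omega)
  refine (r₁₁.then_mapMask (B := 8 * unit n M) (by decide) (by decide) (by decide)
    fun s₁₂ r₁₂ f₁₂ h₁₂ => ?_).le (by omega)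
  refine (r₁₂.then_bfs (B := 7 * unit n M) (by decide) (by decide) (by decide)
    fun s₁₃ r₁₃ f₁₃ h₁₃ _ => ?_).le (by omega)
  refine (r₁₃.then_mapMask (B := 6 * unit n M) (by decide) (by decide) (by decide)
    fun s₁₄ r₁₄ f₁₄ h₁₄ => ?_).le (by omega)
  refine (r₁₄.then_bfs (B := 5 * unit n M) (by decide) (by decide) (by decide)
    fun s₁₅ r₁₅ f₁₅ h₁₅ _ => ?_).le (by omega)
  refine (r₁₅.then_mapMask (B := 4 * unit n M) (by decide) (by decide) (by decide)
    fun s₁₆ r₁₆ f₁₆ h₁₆ => ?_).le (by omega)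
  refine (r₁₆.then_assign (B := 3 * unit n M) (by decide) (by decide)
    fun s₁₇ r₁₇ f₁₇ h₁₇ => ?_).le (by omega)
  have f39 := (((f₄.trans f₅).trans f68).trans f₉)
  have h11_5 : s₁₁.var 5 = a := by
    rw [((f39.trans f₁₀).trans f₁₁).var 5 (by decide), ha5]
  have h13_5 : s₁₃.var 5 = a := by
    rw [(f₁₂.trans f₁₃).var 5 (by decide), h11_5]
  -- The end `a` is left out here: its neighbors must stay available to the search from `R`.
  have hS : ∀ y : Fin n, y ∈ (maskSet s₁₂ 7 : Set (Fin n)) ↔ ∃ i < k - 1, w i = y := by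
    intro y
    rw [h₁₂, and_holds, not_holds, labeled_holds, isVar_holds (by decide), h11_5,
      (f₁₀.trans f₁₁).arr 3 (by decide), e3, ← Fin.ext_iff]
    constructor
    · rintro ⟨⟨i, hi, rfl⟩, hne⟩
      refine ⟨i, ?_, rfl⟩
      by_contra hlt
      rw [show i = k - 1 by omega] at hne
      exact hne hlast
    · rintro ⟨i, hi, rfl⟩
      refine ⟨⟨i, by omega, rfl⟩, fun h => ?_⟩
      have := hinj i (by omega) (k - 1) (by omega) (h.trans hlast.symm)
      omega
  rw [r₁₂.maskSet_all] at h₁₃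
  -- Labels 1 and 2 together mark the closed neighborhood of the path without `a`.
  have hA : ∀ y : Fin n, y ∈ (maskSet s₁₄ 8 : Set (Fin n)) ↔
      y ≠ a ∧ ∀ i < k - 1, y ≠ w i ∧ ¬ G.Adj (w i) y := by
    intro y
    rw [h₁₄, and_holds, and_holds, not_holds, not_holds, not_holds, labeled_holds, labeled_holds,
      isVar_holds (by decide), h13_5, ← Fin.ext_iff, h₁₃.source y, h₁₃.eq_two_iff y, hS]
    constructor
    · rintro ⟨h1, h3, h4⟩
      refine ⟨h4, fun i hi => ⟨fun h => h1 ⟨i, hi, h.symm⟩, fun h => h3 ⟨h1, w i, ?_, h⟩⟩⟩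
      exact (hS _).2 ⟨i, hi, rfl⟩
    · rintro ⟨h1, h3⟩
      refine ⟨?_, ?_, h1⟩
      · rintro ⟨i, hi, rfl⟩
        exact (h3 i hi).1 rfl
      · rintro ⟨-, u, hu, hadj⟩
        obtain ⟨i, hi, rfl⟩ := (hS u).1 hu
        exact (h3 i hi).2 hadj
  have f115 := ((f₁₂.trans f₁₃).trans f₁₄).trans f₁₅
  have f1017 := ((f₁₀.trans f₁₁).trans f115).trans (f₁₆.trans f₁₇)
  have f14 := (((((f₁.trans f₂).trans f₃).trans f39).trans (f₁₀.trans f₁₁)).trans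
    ((f₁₂.trans f₁₃).trans f₁₄))
  have e6 : (maskSet s₁₄ 6 : Set (Fin n)) = R := maskSet_congr (f14.arr 6 (by decide))
  rw [e6] at h₁₅
  have hinv := inv_init hG hk hR.linked hR.maximal hx haR hadjR hw0 hwa hch.adj hA h₁₅
  have e4 : (maskSet s₁₇ 4 : Set (Fin n)) = {v : Fin n | s₁₅.arr 29 v ≠ 0} := by
    rw [maskSet_congr (f₁₇.arr 4 (by decide))]
    ext y
    rw [h₁₆, not_holds, labeled_holds]
    rfl
  have hq : {v | v ∈ List.ofFn fun i : Fin k => w i} = {v | ∃ i < k, w i = v} := by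
    ext y
    simp only [Set.mem_ofPred_eq, List.mem_ofFn]
    constructor
    · rintro ⟨i, hi⟩
      exact ⟨i, i.2, hi⟩
    · rintro ⟨i, hi, h⟩
      exact ⟨⟨i, hi⟩, h⟩
  refine (Runs.skip ⟨r₁₇, h₁₇, List.ofFn fun i : Fin k => w i, a, fun i => w (k - 1 - i),
    ⟨⟨?_, ?_, ?_⟩, ?_, ?_, ?_, ?_, ?_, ?_, ?_⟩, .inl (by rw [hq, e4]; exact hinv)⟩).le (by omega)
  · rw [((f14.trans f₁₅).trans (f₁₆.trans f₁₇)).var 2 (by decide), h2]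
  · rw [f1017.var 3 (by decide), hlen, List.length_ofFn]
  · intro i hi
    rw [List.length_ofFn] at hi
    rw [f1017.arr 2 (by decide), hget i hi, List.getElem_ofFn]
  · rw [List.isChain_iff_getElem]
    intro i hi
    rw [List.length_ofFn] at hi
    rw [List.getElem_ofFn, List.getElem_ofFn]
    exact hch.adj i hi
  · rw [List.nodup_ofFn]
    intro i j hij
    exact Fin.ext (hinj i i.2 j j.2 hij)
  · rw [List.getLast?_eq_getElem?, List.length_ofFn, List.getElem?_ofFn, dif_pos (by omega)]
    rw [hlast]
  · rw [maskSet_congr (f1017.arr 3 (by decide)), hq]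
    ext y
    exact e3 y
  · rw [(f115.trans (f₁₆.trans f₁₇)).var 5 (by decide), h11_5]
  · rw [(f115.trans (f₁₆.trans f₁₇)).var 40 (by decide), h₁₁]
    simp only [Expr.eval]
    rw [f₁₀.var 3 (by decide), hlen]
  · rw [(f115.trans (f₁₆.trans f₁₇)).var 40 (by decide), h₁₁]
    simp only [Expr.eval]
    rw [f₁₀.var 3 (by decide), hlen]
    intro i hi
    rw [(f₁₁.trans (f115.trans (f₁₆.trans f₁₇))).arr 5 (by decide), h₁₀ _ (by omega),
      hget _ (by omega)]

end

end PathEcc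

/-! ### The input encoding and the total running time -/

namespace PathEcc

section

variable {n : ℕ} {G : SimpleGraph (Fin n)} {L : Fin n → List (Fin n)} {k : ℕ}

theorem inputState_offset_succ (u : Fin n) :
    (inputState L k).arr 0 (u + 1) = (inputState L k).arr 0 u + (L u).length := by
  have hu := u.2
  simp only [inputState, if_true]
  rw [if_pos (by omega), if_pos (by omega), List.take_add_one, List.map_append, List.sum_append]
  simp [hu]

/-- The offsets in array `0` cut the concatenation at partial sums of lengths, and the slice between
two consecutive ones is the list of `u`. -/
theorem inputState_list (u : Fin n) (j : ℕ) (hj : j < (L u).length) :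
    (inputState L k).arr 1 ((inputState L k).arr 0 u + j) = ((L u)[j] : ℕ) := by
  have hu := u.2
  have h1 := inputState_offset_succ (L := L) (k := k) u
  have h2 := List.drop_take_succ_flatten_eq_getElem (List.ofFn L) u (by simp)
  rw [← List.map_take, ← List.map_take] at h2
  have h3 : ∀ i ≤ n, (inputState L k).arr 0 i = (((List.ofFn L).take i).map List.length).sum := by
    intro i hi
    simp [inputState, hi]
  rw [← h3 u (by omega), ← h3 (u + 1) (by omega)] at h2
  have h4 : (L u)[j]? = (List.ofFn L).flatten[(inputState L k).arr 0 u + j]? := by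
    have h5 : (List.ofFn L)[(u : ℕ)]'(by simp) = L u := by simp
    rw [← h5, ← h2, List.getElem?_drop, List.getElem?_take, if_pos (by omega)]
  rw [List.getElem?_eq_getElem hj] at h4
  generalize (inputState L k).arr 0 u + j = e at h4
  simp only [inputState, one_ne_zero, if_false, if_true, List.getD, List.getElem?_map, ← h4,
    Option.map_some, Option.getD_some]

theorem IsAdjLists.hasGraph (hL : IsAdjLists G L) :
    HasGraph G (2 * G.edgeSet.ncard) (inputState L k) := by
  classical
  have hrow : ∀ (u : Fin n) e, (inputState L k).arr 0 u ≤ e → e < (inputState L k).arr 0 (u + 1) →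
      ∃ (j : ℕ) (hj : j < (L u).length), (inputState L k).arr 0 u + j = e ∧
        (inputState L k).arr 1 e = ((L u)[j] : ℕ) := by
    intro u e h1 h2
    rw [inputState_offset_succ] at h2
    refine ⟨e - (inputState L k).arr 0 u, by omega, by omega, ?_⟩
    rw [← inputState_list u _ (by omega)]
    congr 1
    omega
  refine ⟨rfl, fun u w => ⟨fun h => ?_, ?_⟩, ?_, ?_⟩
  · obtain ⟨j, hj, hjw⟩ := List.getElem_of_mem (((hL u).2 w).2 h)
    refine ⟨(inputState L k).arr 0 u + j, by omega, ?_, ?_⟩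
    · rw [inputState_offset_succ]
      omega
    · rw [inputState_list u j hj, hjw]
  · rintro ⟨e, h1, h2, h3⟩
    obtain ⟨j, hj, -, hej⟩ := hrow u e h1 h2
    rw [← (hL u).2]
    have : (L u)[j] = w := Fin.ext (by rw [← hej, h3])
    exact this ▸ List.getElem_mem hj
  · intro u hu e h1 h2
    obtain ⟨j, hj, -, hej⟩ := hrow ⟨u, hu⟩ e h1 h2
    rw [hej]
    exact Fin.is_lt _
  -- The lists have no repetitions, so their lengths are the degrees, which sum to twice the number
  -- of edges.
  · rw [Finset.sum_range, Set.ncard_eq_toFinset_card', ← SimpleGraph.edgeFinset,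
      ← G.sum_degrees_eq_twice_card_edges]
    refine le_of_eq (Finset.sum_congr rfl fun u _ => ?_)
    rw [inputState_offset_succ, Nat.add_sub_cancel_left, ← SimpleGraph.card_neighborFinset_eq_degree,
      ← List.toFinset_card_of_nodup (hL u).1]
    congr 1
    ext w
    rw [List.mem_toFinset, (hL u).2, SimpleGraph.mem_neighborFinset]

/-- The number of rounds left is at most the size of the unvisited set plus one; index 0 is kept for
the state in which the output is complete. -/
theorem Runs.search {M : ℕ} {s : State} (hG : G.Connected) (hk : 1 ≤ k) (hs : Ready G M k s)
    (h6 : s.var 6 = 1) (hsearch : Searching G k s) :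
    Runs (.loop (.eq (.var 6) (.const 1)) PathEcc.roundProg) s ((n + 1) * (3 + 40 * unit n M) + 3)
      (Done G k) := by
  refine (Runs.loop_uniform (b := .eq (.var 6) (.const 1)) (B := 40 * unit n M)
    (j := (maskSet s 4 : Set (Fin n)).ncard + 1)
    (fun j t => (t.var 6 = 0 ∧ Done G k t) ∨ (t.var 6 = 1 ∧ Ready G M k t ∧ Searching G k t ∧
      (maskSet t 4 : Set (Fin n)).ncard + 1 = j)) ?_ (.inr ⟨h6, hs, hsearch, rfl⟩)).mono ?_ ?_
  · rintro j t (⟨h, -⟩ | ⟨h, hr, hse, rfl⟩) hb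
    · simp only [Test.holds, Expr.eval, h] at hb
      exact absurd hb (by decide)
    · refine (Runs.roundProg hG hk hr h hse).mono le_rfl ?_
      rintro t' (h' | ⟨h6', hr', hse', hlt⟩)
      · exact ⟨0, by omega, .inl h'⟩
      · exact ⟨_, by omega, .inr ⟨h6', hr', hse', rfl⟩⟩
  · have h1 : (maskSet s 4 : Set (Fin n)).ncard ≤ n := by
      simpa using Set.ncard_le_card (maskSet s 4 : Set (Fin n))
    have h2 : (Test.eq (.var 6) (.const 1)).cost = 3 := rfl
    rw [h2]
    gcongr
  · rintro t ⟨⟨j, ⟨-, h⟩ | ⟨h, -⟩⟩, hb⟩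
    · exact h
    · exact absurd h hb

/-- Growth of the connected set contributes the quadratic number of building blocks; the search
contributes a linear number. -/
theorem Runs.mainProg {M : ℕ} {s : State} (hG : G.Connected) (hk : 1 ≤ k) (hs : HasGraph G M s)
    (hsk : s.var 1 = k) (h2 : s.var 2 = 0) :
    Runs mainProg s (200 * (n ^ 2 * unit n M)) (Done G k) := by
  have hn : 1 ≤ n := by
    obtain ⟨v⟩ := hG.nonempty
    exact v.pos
  have hu : 40 ≤ unit n M := by unfold unit; omega
  set v₀ : Fin n := ⟨0, hn⟩ with hv₀
  refine (Runs.seq (B := unit n M)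
    (B' := 30 * unit n M + (n * (n + 1) + n) * (13 * unit n M) +
      (n + 1) * (3 + 40 * unit n M)) ?_).le ?_
  rotate_left
  -- A connected graph has a vertex, so `n ≥ 1` and the lower-order terms are absorbed by `n ^ 2`.
  · have h1 : n ≤ n ^ 2 := by nlinarith
    have h3 : 1 ≤ n ^ 2 := by omega
    have h4 : (n * (n + 1) + n) ≤ 3 * n ^ 2 := by nlinarith
    have h5 : 3 + 40 * unit n M ≤ 41 * unit n M := by omega
    calc _ ≤ unit n M + (30 * unit n M + (3 * n ^ 2) * (13 * unit n M) +
          (2 * n ^ 2) * (41 * unit n M)) := by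
            gcongr
            omega
      _ = 31 * (1 * unit n M) + 121 * (n ^ 2 * unit n M) := by ring
      _ ≤ 31 * (n ^ 2 * unit n M) + 121 * (n ^ 2 * unit n M) := by gcongr
      _ ≤ 200 * (n ^ 2 * unit n M) := by omega
  refine ((Runs.mapMask (fun _ => True) hs.n_eq
    (fun i t _ _ _ _ _ => by simp [Test.holds])).frame).mono ?_ ?_
  · simp only [Test.cost, Expr.cost]
    unfold unit
    omega
  rintro s₁ ⟨hp, hv, ha⟩
  have f₁ : Same [10] [22] s s₁ :=
    ⟨fun x hx => hv x (by simpa [PathEcc.mapMask, PathEcc.forN, Program.vars] using hx),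
      fun A hA => ha A (by simpa [PathEcc.mapMask, PathEcc.forN, Program.arrs] using hA)⟩
  have r₁ : Ready G M k s₁ := by
    refine ⟨hs.of_eq (f₁.var 0 (by decide)) (f₁.arr 0 (by decide)) (f₁.arr 1 (by decide)), ?_,
      fun v => (hp v v.2).2 trivial⟩
    rw [f₁.var 1 (by decide), hsk]
  refine (r₁.then_mapMask (B := 29 * unit n M + (n * (n + 1) + n) * (13 * unit n M) +
      (n + 1) * (3 + 40 * unit n M)) (by decide) (by decide) (by decide)
    fun s₂ r₂ f₂ h₂ => ?_).le (by omega)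
  refine (r₂.then_bfs (B := 28 * unit n M + (n * (n + 1) + n) * (13 * unit n M) +
      (n + 1) * (3 + 40 * unit n M)) (by decide) (by decide) (by decide)
    fun s₃ r₃ f₃ h₃ _ => ?_).le (by omega)
  refine (r₃.then_find (B := 27 * unit n M + (n * (n + 1) + n) * (13 * unit n M) +
      (n + 1) * (3 + 40 * unit n M)) (by decide) (by decide) (by decide)
    fun s₄ r₄ f₄ h₄ => ?_).le (by omega)
  have e6 : (maskSet s₂ 6 : Set (Fin n)) = {v₀} := by
    ext x
    rw [h₂, Set.mem_singleton_iff, Fin.ext_iff]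
    simp [Test.holds, Expr.eval, State.at, hv₀]
  rw [e6, r₂.maskSet_all] at h₃
  simp only [exceeds_holds, r₃.k_eq] at h₄
  simp only [← h₃.far_iff hG (Set.singleton_nonempty v₀)] at h₄
  have ff := ((f₁.trans f₂).trans f₃).trans f₄
  have h42 : s₄.var 2 = 0 := (ff.var 2 (by decide)).trans h2
  refine (r₄.then_branch (B := 26 * unit n M + (n * (n + 1) + n) * (13 * unit n M) +
      (n + 1) * (3 + 40 * unit n M)) (by decide) (fun hb => ?_) fun hb => ?_).le (by omega)
  · simp only [Test.holds, Expr.eval, r₄.graph.n_eq] at hb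
    have hcov : ∀ x, ¬ Far G k {v | v ∈ [v₀]} x := by
      simp only [List.mem_singleton]
      rcases h₄ with ⟨v, hv, -⟩ | ⟨-, h⟩
      · have := v.2
        omega
      · exact h
    refine (r₄.then_write (B := unit n M + 1) (by decide) (by decide)
      fun s₅ r₅ f₅ h₅ _ => ?_).le (by omega)
    refine r₅.then_assign (by decide) (by decide) fun s₆ r₆ f₆ h₆ => Runs.skip ?_
    refine Stored.done (q := [v₀]) ⟨?_, h₆, ?_⟩ (.singleton _) (by simp) (by simp) hcov
    · rw [(f₅.trans f₆).var 2 (by decide), h42]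
    · intro i hi
      have hi0 : i = 0 := by simpa using hi
      subst hi0
      rw [f₆.arr 2 (by decide)]
      exact h₅
  · simp only [Test.holds, Expr.eval, r₄.graph.n_eq] at hb
    have e6' : (maskSet s₄ 6 : Set (Fin n)) = {v₀} := by
      rw [maskSet_congr ((f₃.trans f₄).arr 6 (by decide)), e6]
    refine (Runs.seq (B := 2 * unit n M + (n * (n + 1) + n) * (13 * unit n M))
      (B' := 21 * unit n M + (n + 1) * (3 + 40 * unit n M)) ?_).le (by omega)
    refine (Runs.growProg hG r₄ ?_ ?_ ?_).mono le_rfl ?_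
    · rw [e6']
      exact linked_singleton v₀
    · rw [e6']
      exact Set.singleton_nonempty v₀
    · rw [e6']
      rcases h₄ with ⟨v, -, h⟩ | ⟨h, -⟩
      · exact ⟨v, h⟩
      · exact absurd h hb
    · rintro t ⟨rt, ht2, hgrown⟩
      refine (Runs.seq (B := 20 * unit n M) (B' := (n + 1) * (3 + 40 * unit n M) + 3) ?_).le
        (by omega)
      refine (Runs.startProg hG hk rt (ht2.trans h42) hgrown).mono le_rfl ?_
      rintro t' ⟨rt', ht6, hse⟩
      exact Runs.search hG hk rt' ht6 hse

end

end PathEcc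

theorem theorem8 :
    ∃ (prog : PathEcc.Program) (c : ℕ),
      ∀ (n : ℕ) (G : SimpleGraph (Fin n)) (L : Fin n → List (Fin n)) (k : ℕ),
        G.Connected → PathEcc.IsAdjLists G L → 1 ≤ k →
        ∃ (t : ℕ) (s : PathEcc.State),
          PathEcc.Exec prog (PathEcc.inputState L k) t s ∧
          t ≤ c * (n ^ 2 * (n + G.edgeSet.ncard)) ∧
          ∃ l : List (Fin n),
            (PathEcc.Outputs s 0 l ∧
              ∃ (u v : Fin n) (p : G.Walk u v),
                p.IsPath ∧ p.support = l ∧ PathEcc.eccentricity p < k) ∨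
            (PathEcc.Outputs s 1 l ∧ l.Nodup ∧
              (Nonempty (G.induce {v | v ∈ l} ≃g PathEcc.subdividedClaw k) ∨
                Nonempty (G.induce {v | v ∈ l} ≃g PathEcc.subdividedNet k) ∨
                PathEcc.IsMk k (G.induce {v | v ∈ l}))) := by
  -- The constant is `200 * 80`: the program takes at most `200 * n ^ 2` units, and a unit `40 * (n
  -- + 2 * m + 1)` is at most `80 * (n + m)` because `n ≥ 1`.
  refine ⟨PathEcc.mainProg, 16000, fun n G L k hG hL hk => ?_⟩
  obtain ⟨t, s, he, ht, hs⟩ := PathEcc.Runs.mainProg hG hk (hL.hasGraph (k := k)) rfl rfl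
  refine ⟨t, s, he, ht.trans ?_, hs⟩
  have hn : 1 ≤ n := by
    obtain ⟨v⟩ := hG.nonempty
    exact v.pos
  have hu : PathEcc.unit n (2 * G.edgeSet.ncard) ≤ 80 * (n + G.edgeSet.ncard) := by
    unfold PathEcc.unit
    omega
  calc 200 * (n ^ 2 * PathEcc.unit n (2 * G.edgeSet.ncard))
      ≤ 200 * (n ^ 2 * (80 * (n + G.edgeSet.ncard))) := by gcongr
    _ = 16000 * (n ^ 2 * (n + G.edgeSet.ncard)) := by ring
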